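/- Let $\mathbb K$ be an algebraically closed field of characteristic zero and let $G=\mathrm{SL}_2\times T'$, where $T'$ is an algebraic torus (every connected reductive group of semisimple rank one is of this form up to a finite covering). Let $T_1\subset \mathrm{SL}_2$ be the torus of diagonal matrices, $U\subset \mathrm{SL}_2$ the group of upper unitriangular matrices, $T=T_1\times T'$ and $B=TU$. Let $\mathfrak X(T)$ be the character lattice of $T$, $\alpha\in\mathfrak X(T)$ the positive root, $\alpha^\vee$ the dual root, $\Lambda^+=\{\lambda\in\mathfrak X(T) : \langle\alpha^\vee,\lambda\rangle\ge 0\}$ the monoid of dominant weights, and $w$ the nontrivial element of the Weyl group, acting on $\mathfrak X(T)$. Let $X$ be an affine spherical $G$-variety, i.e. a normal irreducible affine variety with a regular $G$-action having an open $B$-orbit, and assume that $X$ is toric for $T$, i.e. that $T$ also has an open orbit in $X$. Let $\Gamma\subset\Lambda^+$ be the set of highest weights of the simple $G$-submodules of $\mathbb K[X]$, and put $M=\mathbb Z\Gamma$, $\mathcal G=\mathbb Q_{\ge0}\Gamma\subset M_{\mathbb Q}$. Let $\overline M=M+\mathbb Z\alpha$ and let $\overline{\mathcal G}\subset\overline M_{\mathbb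 Q}$ be the cone generated by $\mathcal G\cup w(\mathcal G)$. Let $\mathcal E$ and $\overline{\mathcal E}$ be the cones dual to $\mathcal G$ and $\overline{\mathcal G}$ in $N_{\mathbb Q}=\mathrm{Hom}(M,\mathbb Z)\otimes\mathbb Q$ and $\overline N_{\mathbb Q}=\mathrm{Hom}(\overline M,\mathbb Z)\otimes\mathbb Q$, respectively. Let $\mathcal E^1$ be the set of primitive elements $\rho$ of $N=\mathrm{Hom}(M,\mathbb Z)$ such that $\mathbb Q_{\ge0}\rho$ is a ray (a one-dimensional face) of $\mathcal E$; put $$\mathfrak R_\rho(\mathcal E)=\{e\in M : \langle\rho,e\rangle=-1,\ \langle\rho',e\rangle\ge0 \text{ for all }\rho'\in\mathcal E^1\setminus\{\rho\}\},\qquad \mathfrak R(\mathcal E)=\bigcup_{\rho\in\mathcal E^1}\mathfrak R_\rho(\mathcal E),$$ and define $\overline{\mathcal E}^1$ and $\mathfrak R_\rho(\overline{\mathcal E})$ in the same way from $\overline M$ and $\overline{\mathcal E}$. A $B$-root subgroup on $X$ is a subgroup $H\subset\mathrm{Aut}(X)$ that is the image of a nontrivial regular action of $\mathbb G_a=(\mathbb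 K,+)$ on $X$ and is normalized by $B$; its weight is the character $e$ of $B$ (equivalently, of $T$) through which $B$ acts on $H\cong\mathbb G_a$ by conjugation. It is called vertical if $H$ acts trivially on $\mathbb K[X]^U$, and horizontal otherwise. Theorem. (a) Every $B$-root subgroup on $X$ has a unique weight and is uniquely determined by it. (b) If $\mathrm{SL}_2$ acts nontrivially on $X$, then there is a unique $\rho_0\in\overline{\mathcal E}^1$ such that $\overline{\mathcal G}\cap\mathrm{Ker}\,\rho_0=\mathcal G$, and the set of weights of vertical $B$-root subgroups on $X$ is $\mathfrak R_{\rho_0}(\overline{\mathcal E})$. (c) The set of weights of horizontal $B$-root subgroups on $X$ is $\mathfrak R(\mathcal E)\cap\Lambda^+$. -/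

import Mathlib

namespace RootSubgroups

/-! ## Lattices, cones and Demazure roots

Lattices are subgroups `M` of an ambient rational vector space `V`; then `M_ℚ` is the `ℚ`-span of
`M` in `V`. -/

section Cones

variable {V : Type*} [AddCommGroup V] [Module ℚ V]

/-- The rational vector space `M_ℚ` spanned by the lattice `M`. -/
abbrev ratSpan (M : AddSubgroup V) : Submodule ℚ V := Submodule.span ℚ (M : Set V)

/-- The dual rational vector space `N_ℚ` of `M_ℚ`. -/
abbrev DualSpace (M : AddSubgroup V) : Type _ := Module.Dual ℚ (ratSpan M)

/-- The dual lattice `N = Hom(M, ℤ)` inside `N_ℚ`: the linear functions on `M_ℚ` that take integer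
values on `M`. -/
def dualLattice (M : AddSubgroup V) : Set (DualSpace M) :=
  {q | ∀ (m : V) (hm : m ∈ M), ∃ k : ℤ, q ⟨m, Submodule.subset_span hm⟩ = (k : ℚ)}

/-- The dual cone `𝓔 = 𝓖^∨` in `N_ℚ` of a cone `𝓖` in `M_ℚ`. -/
def dualCone (M : AddSubgroup V) (C : PointedCone ℚ V) : Set (DualSpace M) :=
  {q | ∀ v : ratSpan M, (v : V) ∈ C → 0 ≤ q v}

/-- `ρ` is a primitive element of the dual lattice `N` (in particular, `ρ ≠ 0`). -/
def IsPrimitive (M : AddSubgroup V) (ρ : DualSpace M) : Prop :=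
  ρ ∈ dualLattice M ∧ ∀ (k : ℤ) (ρ' : DualSpace M), ρ' ∈ dualLattice M → ρ = k • ρ' → IsUnit k

/-- The set `𝓔¹` of primitive elements `ρ` of `N` such that `ℚ_{≥0} ρ` is a ray of `𝓔 = 𝓖^∨`.
A face of `𝓔` is a subset of the form `{q ∈ 𝓔 | ⟨q, v⟩ = 0}` with `v ∈ 𝓖`, and a ray is a face of
dimension one. -/
def primitiveRays (M : AddSubgroup V) (C : PointedCone ℚ V) : Set (DualSpace M) :=
  {ρ | IsPrimitive M ρ ∧ ∃ v : ratSpan M, (v : V) ∈ C ∧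
    {q | q ∈ dualCone M C ∧ q v = 0} = {q | ∃ c : ℚ, 0 ≤ c ∧ q = c • ρ}}

/-- The face `𝓖 ∩ Ker ρ` of the cone `𝓖`. -/
def faceOf (M : AddSubgroup V) (C : PointedCone ℚ V) (ρ : DualSpace M) : Set V :=
  {v | v ∈ C ∧ ∃ hv : v ∈ ratSpan M, ρ ⟨v, hv⟩ = 0}

/-- The set `R_ρ(𝓔)` of `e ∈ M` such that `⟨ρ, e⟩ = -1` and `⟨ρ', e⟩ ≥ 0` for all other `ρ' ∈ 𝓔¹`,
where `𝓔 = 𝓖^∨`. -/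
def demazureRootsAt (M : AddSubgroup V) (C : PointedCone ℚ V) (ρ : DualSpace M) : Set V :=
  {e | ∃ he : e ∈ M, ρ ⟨e, Submodule.subset_span he⟩ = -1 ∧
    ∀ ρ' ∈ primitiveRays M C, ρ' ≠ ρ → 0 ≤ ρ' ⟨e, Submodule.subset_span he⟩}

/-- The set of Demazure roots of `𝓔 = 𝓖^∨`. -/
def demazureRoots (M : AddSubgroup V) (C : PointedCone ℚ V) : Set V :=
  {e | ∃ ρ ∈ primitiveRays M C, e ∈ demazureRootsAt M C ρ}

end Cones

/-! ## The group `G = SL₂ × T'` with `T' = (K^×)ⁿ` -/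

section Group

variable (K : Type*) [Field K] (n : ℕ)

/-- The group `G = SL₂(K) × (K^×)ⁿ`. -/
abbrev GroupG : Type _ := Matrix.SpecialLinearGroup (Fin 2) K × (Fin n → Kˣ)

/-- The maximal torus `T = T₁ × T'`, where `T₁` consists of the diagonal matrices in `SL₂`. -/
def torus : Subgroup (GroupG K n) where
  carrier := {g | g.1 0 1 = 0 ∧ g.1 1 0 = 0}
  mul_mem' := by
    rintro a b ⟨ha, ha'⟩ ⟨hb, hb'⟩
    simp only [Set.mem_ofPred_eq, Prod.fst_mul, Matrix.SpecialLinearGroup.coe_mul,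
      Matrix.mul_apply, Fin.sum_univ_two]
    simp [ha, ha', hb, hb']
  one_mem' := by simp
  inv_mem' := by
    rintro a ⟨ha, ha'⟩
    simp [Matrix.SpecialLinearGroup.coe_inv, Matrix.adjugate_fin_two, ha, ha']

/-- The Borel subgroup `B ⊇ T`: the upper triangular matrices in `SL₂`, times `T'`. -/
def borelSubgroup : Subgroup (GroupG K n) where
  carrier := {g | g.1 1 0 = 0}
  mul_mem' := by
    intro a b ha hb
    simp only [Set.mem_ofPred_eq] at ha hb
    simp only [Set.mem_ofPred_eq, Prod.fst_mul, Matrix.SpecialLinearGroup.coe_mul,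
      Matrix.mul_apply, Fin.sum_univ_two]
    simp [ha, hb]
  one_mem' := by simp
  inv_mem' := by
    intro a ha
    simp only [Set.mem_ofPred_eq] at ha
    simp [Matrix.SpecialLinearGroup.coe_inv, Matrix.adjugate_fin_two, ha]

/-- The unipotent radical `U` of `B`: the upper unitriangular matrices in `SL₂`. -/
def unipotent : Subgroup (GroupG K n) where
  carrier := {g | g.1 0 0 = 1 ∧ g.1 1 0 = 0 ∧ g.1 1 1 = 1 ∧ g.2 = 1}
  mul_mem' := by
    rintro a b ⟨ha, ha', ha'', ha3⟩ ⟨hb, hb', hb'', hb3⟩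
    simp only [Set.mem_ofPred_eq, Prod.fst_mul, Prod.snd_mul, Matrix.SpecialLinearGroup.coe_mul,
      Matrix.mul_apply, Fin.sum_univ_two]
    simp [ha, ha', ha'', ha3, hb, hb', hb'', hb3]
  one_mem' := by simp
  inv_mem' := by
    rintro a ⟨ha, ha', ha'', ha3⟩
    simp [Matrix.SpecialLinearGroup.coe_inv, Matrix.adjugate_fin_two, ha, ha', ha'', ha3]

/-- The algebra `K[G]` of regular functions on `G`, generated by the matrix entries and by the
coordinates on `T'` and their inverses. -/
def regularFunctions : Subalgebra K (GroupG K n → K) :=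
  Algebra.adjoin K
    ({f | ∃ i j : Fin 2, f = fun g => g.1 i j} ∪
      {f | ∃ i : Fin n, f = fun g => (g.2 i : K)} ∪
      {f | ∃ i : Fin n, f = fun g => (((g.2 i)⁻¹ : Kˣ) : K)})

/-- The algebra `K[𝔾_a]` of regular (that is, polynomial) functions on `𝔾_a = (K, +)`. -/
def regularFunctionsGa : Subalgebra K (Multiplicative K → K) :=
  Algebra.adjoin K {fun s => s.toAdd}

end Group

/-! ## The character lattice `𝔛(T)` -/

section Characters

/-- The character lattice `𝔛(T) = 𝔛(T₁) ⊕ 𝔛(T') = ℤ ⊕ ℤⁿ`. -/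
abbrev CharLattice (n : ℕ) : Type := ℤ × (Fin n → ℤ)

/-- The rational vector space `𝔛(T)_ℚ`. -/
abbrev RatCharSpace (n : ℕ) : Type := ℚ × (Fin n → ℚ)

/-- The inclusion `𝔛(T) ⊆ 𝔛(T)_ℚ`. -/
def toRat {n : ℕ} (e : CharLattice n) : RatCharSpace n := ((e.1 : ℚ), fun i => (e.2 i : ℚ))

/-- The value at `b` of the character `e = (a, m)`, regarded as a character of `B` (trivial
on `U`): if `b ∈ B` has diagonal part `(diag(t, t⁻¹), (t₁, …, tₙ))`, this is
`t ^ a * t₁ ^ m₁ * ⋯ * tₙ ^ mₙ`. -/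
def charEval {K : Type*} [Field K] {n : ℕ} (e : CharLattice n) (b : GroupG K n) : K :=
  (b.1 0 0) ^ e.1 * ∏ i, ((b.2 i : K)) ^ (e.2 i)

/-- The positive root `α`, given by `α(diag(t, t⁻¹), t') = t²`. -/
def posRoot (n : ℕ) : CharLattice n := (2, 0)

/-- The dominant weights: `λ` with `⟨α^∨, λ⟩ ≥ 0`, where `⟨α^∨, (a, m)⟩ = a`. -/
def dominantWeights (n : ℕ) : Set (CharLattice n) := {e | 0 ≤ e.1}

/-- The action on `𝔛(T)_ℚ` of the nontrivial element `w` of the Weyl group. -/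
def weylReflection {n : ℕ} (v : RatCharSpace n) : RatCharSpace n := (-v.1, v.2)

end Characters

/-! ## Actions on affine varieties

An irreducible affine variety `X` over the algebraically closed field `K` is given by its coordinate
algebra `A = K[X]`, a finitely generated domain; its points are the `K`-algebra homomorphisms
`A → K`.  The group `Aut(X)` is identified with `A ≃ₐ[K] A`, an automorphism `g` of `X` acting on
functions by `(g • f)(x) = f(g⁻¹ x)`. -/

section Actions

variable {K : Type*} [Field K] {A : Type*} [CommRing A] [Algebra K A]

/-- The action on `A = K[X]` of an algebraic group `S` with algebra of regular functions `R`
is rational, i.e. it comes from a regular action `S × X → X`: the map `g ↦ g • a` is an element of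
`R ⊗ A` for every `a`. -/
def IsRegularAction {S : Type*} [Group S] (R : Subalgebra K (S → K)) (act : S →* (A ≃ₐ[K] A)) :
    Prop :=
  ∀ a : A, ∃ (m : ℕ) (c : Fin m → (S → K)) (b : Fin m → A),
    (∀ i, c i ∈ R) ∧ ∀ g : S, act g a = ∑ i, c i g • b i

/-- The action of a group on the points of `X`: the function `f` takes the value `(g⁻¹ • f)(x)`
at `g x`. -/
def pointAct {S : Type*} [Group S] (act : S →* (A ≃ₐ[K] A)) (g : S) (x : A →ₐ[K] K) : A →ₐ[K] K :=
  x.comp (act g⁻¹ : A →ₐ[K] A)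

/-- Zariski open subsets of `X`. -/
def IsZariskiOpen (W : Set (A →ₐ[K] K)) : Prop :=
  ∃ I : Set A, W = {x | ∃ f ∈ I, x f ≠ 0}

/-- The subgroup `P` of `S` has an open orbit in `X`. -/
def HasOpenOrbit {S : Type*} [Group S] (act : S →* (A ≃ₐ[K] A)) (P : Subgroup S) : Prop :=
  ∃ x : A →ₐ[K] K, IsZariskiOpen {y | ∃ g ∈ P, y = pointAct act g x}

/-- A `𝔾_a`-action on `X` which is regular and nontrivial and has image `H` in `Aut(X)`. -/
structure IsGaParametrization (φ : Multiplicative K →* (A ≃ₐ[K] A)) (H : Subgroup (A ≃ₐ[K] A)) :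
    Prop where
  regular : IsRegularAction (regularFunctionsGa K) φ
  nontrivial : φ ≠ 1
  range_eq : φ.range = H

variable {n : ℕ}

/-- A `G`-variety: the group `G` acts regularly on `X`. -/
def IsGVariety (act : GroupG K n →* (A ≃ₐ[K] A)) : Prop :=
  IsRegularAction (regularFunctions K n) act

/-- The subgroup `H` of `Aut(X)` is a `B`-root subgroup: a `𝔾_a`-subgroup normalized by `B`. -/
def IsBRootSubgroup (act : GroupG K n →* (A ≃ₐ[K] A)) (H : Subgroup (A ≃ₐ[K] A)) : Prop :=
  (∃ φ, IsGaParametrization φ H) ∧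
    (borelSubgroup K n).map act ≤ Subgroup.normalizer (H : Set (A ≃ₐ[K] A))

/-- The group `B` acts by conjugation on the `𝔾_a`-subgroup `H` via the character `e`. -/
def HasWeight (act : GroupG K n →* (A ≃ₐ[K] A)) (H : Subgroup (A ≃ₐ[K] A)) (e : CharLattice n) :
    Prop :=
  ∃ φ, IsGaParametrization φ H ∧ ∀ b ∈ borelSubgroup K n, ∀ s : K,
    act b * φ (Multiplicative.ofAdd s) * (act b)⁻¹ = φ (Multiplicative.ofAdd (charEval e b * s))

/-- The function `f` is `U`-invariant. -/
def IsUInvariant (act : GroupG K n →* (A ≃ₐ[K] A)) (f : A) : Prop :=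
  ∀ u ∈ unipotent K n, act u f = f

/-- The subgroup `H` acts trivially on `K[X]^U`. -/
def IsVertical (act : GroupG K n →* (A ≃ₐ[K] A)) (H : Subgroup (A ≃ₐ[K] A)) : Prop :=
  ∀ h ∈ H, ∀ f : A, IsUInvariant act f → h f = f

/-- The weights of the vertical `B`-root subgroups on `X`. -/
def verticalWeights (act : GroupG K n →* (A ≃ₐ[K] A)) : Set (CharLattice n) :=
  {e | ∃ H, IsBRootSubgroup act H ∧ IsVertical act H ∧ HasWeight act H e}

/-- The weights of the horizontal (i.e. not vertical) `B`-root subgroups on `X`. -/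
def horizontalWeights (act : GroupG K n →* (A ≃ₐ[K] A)) : Set (CharLattice n) :=
  {e | ∃ H, IsBRootSubgroup act H ∧ ¬ IsVertical act H ∧ HasWeight act H e}

/-- The subspace `W` of `K[X]` is `G`-stable. -/
def IsGStable (act : GroupG K n →* (A ≃ₐ[K] A)) (W : Submodule K A) : Prop :=
  ∀ g : GroupG K n, ∀ f ∈ W, act g f ∈ W

/-- The subspace `W` of `K[X]` is a simple `G`-submodule. -/
def IsSimpleGSubmodule (act : GroupG K n →* (A ≃ₐ[K] A)) (W : Submodule K A) : Prop :=
  IsGStable act W ∧ W ≠ ⊥ ∧ ∀ W' : Submodule K A, IsGStable act W' → W' ≤ W → W' = ⊥ ∨ W' = W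

/-- The subspace `W` contains a highest-weight vector of weight `l`, that is, a nonzero
`U`-invariant function that is `T`-semi-invariant of weight `l`. -/
def HasHighestWeight (act : GroupG K n →* (A ≃ₐ[K] A)) (W : Submodule K A) (l : CharLattice n) :
    Prop :=
  ∃ f ∈ W, f ≠ 0 ∧ IsUInvariant act f ∧ ∀ t ∈ torus K n, act t f = charEval l t • f

/-- The weight monoid `Γ` of `X`: the dominant weights `l` such that `K[X]` contains a simple
`G`-submodule with highest weight `l`. -/
def weightMonoid (act : GroupG K n →* (A ≃ₐ[K] A)) : Set (CharLattice n) :=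
  {l | l ∈ dominantWeights n ∧ ∃ W, IsSimpleGSubmodule act W ∧ HasHighestWeight act W l}

/-- The lattice `M = ℤΓ`. -/
def latM (act : GroupG K n →* (A ≃ₐ[K] A)) : AddSubgroup (RatCharSpace n) :=
  AddSubgroup.closure (toRat '' weightMonoid act)

/-- The cone `𝓖 = ℚ_{≥0}Γ` in `M_ℚ`. -/
def coneG (act : GroupG K n →* (A ≃ₐ[K] A)) : PointedCone ℚ (RatCharSpace n) :=
  PointedCone.hull ℚ (toRat '' weightMonoid act)

/-- The lattice `M + ℤα`. -/
def latMBar (act : GroupG K n →* (A ≃ₐ[K] A)) : AddSubgroup (RatCharSpace n) :=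
  latM act ⊔ AddSubgroup.zmultiples (toRat (posRoot n))

/-- The cone generated by `𝓖 ∪ w(𝓖)`. -/
def coneGBar (act : GroupG K n →* (A ≃ₐ[K] A)) : PointedCone ℚ (RatCharSpace n) :=
  PointedCone.hull ℚ
    ((coneG act : Set (RatCharSpace n)) ∪ weylReflection '' (coneG act : Set (RatCharSpace n)))

/-- `ρ` is an element of the set of primitive ray generators of the dual of the cone generated by
`𝓖 ∪ w(𝓖)`, and the facet of the latter cone corresponding to `ρ` is `𝓖`. -/
def IsRhoZero (act : GroupG K n →* (A ≃ₐ[K] A)) (ρ : DualSpace (latMBar act)) : Prop :=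
  ρ ∈ primitiveRays (latMBar act) (coneGBar act) ∧
    faceOf (latMBar act) (coneGBar act) ρ = (coneG act : Set (RatCharSpace n))

end Actions

end RootSubgroups

open RootSubgroups

/-!
Since `T` has an open orbit in `X`, a `T`-semi-invariant function on `X` is determined by its value
at one point of this orbit. Hence `A = K[X]` is a monoid algebra: it has a basis of semi-invariants
`χ m`, multiplicative in `m`, where `m` runs through a finitely generated monoid `S` of characters,
which is saturated because `X` is normal (`exists_isWeightBasis`, `IsWeightBasis.fg`,
`IsWeightBasis.saturated`).

Regular `𝔾_a`-actions are exponentials of locally nilpotent derivations, and two parametrizations of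
the same `𝔾_a`-subgroup differ by a scalar. Conjugation by `B` rescales the derivation of a `B`-root
subgroup by a function of `b ∈ B`, which turns out to be a character; so the derivation is
homogeneous for `T` and commutes with the derivation of `U` (`IsBRootSubgroup.exists_hasWeight`,
`HasWeight.exists_derivation`). A homogeneous locally nilpotent derivation of weight `e` is, up to a
scalar, of the form `χ m ↦ ρ(m) χ (m + e)`, where `ρ` is a linear function with `ρ(e) = -1`, with
values in `ℕ` on `S`, and with `m + e ∈ S` whenever `ρ(m) ≠ 0`
(`IsWeightBasis.exists_isRootFunctional`). Such a `ρ` is determined by `e`, so the weight determines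
the `B`-root subgroup. By Farkas' lemma, the pairs `(ρ, e)` of this kind are exactly the primitive
ray generators `ρ` of the cone dual to that of `S` together with a Demazure root `e` belonging to
`ρ` (`IsRootFunctional.mem_demazureRootsAt`, `isRootFunctional_of_mem_demazureRootsAt`).

If `SL₂` acts nontrivially, then so does `U`, and the derivation of `U` has the above form for some
`ρ₀`, with the root `α`. The `U`-invariants are spanned by the `χ m` with `ρ₀(m) = 0`, and since the
components of `A` for the centre of `G` are simple modules, `Γ = S ∩ ker ρ₀`
(`weightMonoid_eq_kerMonoid`). As `S` is stable under `w` and every weight of `S` is on the segment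
from a highest weight `l` to `w l`, the lattice `M + ℤα` and the cone generated by `𝓖` and `w(𝓖)`
are those of `S`, and `𝓖` is the facet cut out by `ρ₀`. The derivations for `(ρ, e)` and `(ρ₀, α)`
commute if and only if `ρ₀(m) ρ(α) = ρ(m) ρ₀(e)` for all `m ∈ S`
(`commute_iff_of_isRootFunctional`). Vertical subgroups are those for which `ρ` vanishes on `Γ`,
that is, `ρ = ρ₀`, and then the relation holds for every root `e`. Otherwise the relation amounts to
`ρ₀(e) = 0` and `ρ(α) = 0`; such pairs correspond by restriction to the facet `𝓖` to its dominant
Demazure roots (`mem_demazureRoots_of_isRootFunctional`,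
`exists_isRootFunctional_of_mem_demazureRoots`). If `SL₂` acts trivially, then `Γ = S` and all
`B`-root subgroups are horizontal.
-/

namespace RootSubgroups

/-! ### Cones generated by finitely generated monoids -/

section Toric

variable {V : Type*} [AddCommGroup V] [Module ℚ V]

/-- Farkas' lemma over `ℚ` for finitely many generators. The induction step projects along the new
generator onto the hyperplane where the functional separating `b` from the others vanishes. -/
theorem farkas {ι : Type*} [DecidableEq ι] (s : Finset ι) (a : ι → V) (b : V) :
    (∃ c : ι → ℚ, (∀ i, 0 ≤ c i) ∧ b = ∑ i ∈ s, c i • a i) ∨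
      ∃ q : V →ₗ[ℚ] ℚ, (∀ i ∈ s, 0 ≤ q (a i)) ∧ q b < 0 := by
  induction s using Finset.induction_on generalizing a b with
  | empty =>
    by_cases hb : b = 0
    · exact Or.inl ⟨fun _ => 0, fun _ => le_rfl, by simp [hb]⟩
    · obtain ⟨q, hq⟩ := not_forall.1 (mt (Module.forall_dual_apply_eq_zero_iff ℚ b).1 hb)
      exact Or.inr ⟨-(q b)⁻¹ • q, by simp, by simp [inv_mul_cancel₀ hq]⟩
  | insert j s hj ih =>
    rcases ih a b with ⟨c, hc, hb⟩ | ⟨q, hq, hqb⟩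
    · refine Or.inl ⟨Function.update c j 0, fun i => ?_, ?_⟩
      · by_cases h : i = j
        · simp [h]
        · simp [Function.update_of_ne h, hc]
      · rw [Finset.sum_insert hj, hb]
        simp only [Function.update_self, zero_smul, zero_add]
        refine Finset.sum_congr rfl fun i hi => ?_
        rw [Function.update_of_ne (ne_of_mem_of_not_mem hi hj)]
    · by_cases hqj : 0 ≤ q (a j)
      · exact Or.inr ⟨q, by simpa [Finset.forall_mem_insert] using ⟨hqj, hq⟩, hqb⟩
      push Not at hqj
      rcases ih (fun i => a i - (q (a i) / q (a j)) • a j) (b - (q b / q (a j)) • a j) with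
        ⟨c, hc, hb⟩ | ⟨p, hp, hpb⟩
      · left
        refine ⟨Function.update c j (q b / q (a j) - ∑ i ∈ s, c i * (q (a i) / q (a j))),
          fun i => ?_, ?_⟩
        · by_cases h : i = j
          · subst h
            simp only [Function.update_self, sub_nonneg]
            refine le_trans (Finset.sum_nonpos fun k hk => ?_)
              (div_nonneg_of_nonpos hqb.le hqj.le)
            exact mul_nonpos_of_nonneg_of_nonpos (hc k)
              (div_nonpos_of_nonneg_of_nonpos (hq k hk) hqj.le)
          · simp [Function.update_of_ne h, hc]
        · rw [Finset.sum_insert hj, Function.update_self]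
          have h1 : ∑ i ∈ s, Function.update c j
              (q b / q (a j) - ∑ i ∈ s, c i * (q (a i) / q (a j))) i • a i
              = ∑ i ∈ s, c i • a i := by
            refine Finset.sum_congr rfl fun i hi => ?_
            rw [Function.update_of_ne (ne_of_mem_of_not_mem hi hj)]
          rw [h1]
          simp only [smul_sub, Finset.sum_sub_distrib, smul_smul, ← Finset.sum_smul] at hb
          rw [sub_smul]
          have aux : ∀ x y z w : V, x - y = z - w → x = y - w + z := by
            intro x y z w h
            rw [sub_eq_iff_eq_add.1 h]
            abel
          exact aux _ _ _ _ hb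
      · right
        refine ⟨p - (p (a j) / q (a j)) • q, ?_, ?_⟩
        · intro i hi
          rcases Finset.mem_insert.1 hi with rfl | hi
          · simp [div_mul_cancel₀ _ hqj.ne]
          · have := hp i hi
            simp only [map_sub, map_smul, smul_eq_mul] at this
            simp only [LinearMap.sub_apply, LinearMap.smul_apply, smul_eq_mul]
            convert this using 2
            ring
        · simp only [map_sub, map_smul, smul_eq_mul] at hpb
          simp only [LinearMap.sub_apply, LinearMap.smul_apply, smul_eq_mul]
          convert hpb using 2
          ring

variable {S : AddSubmonoid V}

theorem exists_domRestrict_eq (W : Submodule ℚ V) (q : Module.Dual ℚ W) :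
    ∃ Q : V →ₗ[ℚ] ℚ, Q.domRestrict W = q := by
  obtain ⟨Q, hQ⟩ := q.exists_extend
  exact ⟨Q, by ext v; exact LinearMap.congr_fun hQ v⟩

theorem ratSpan_closure (s : Set V) :
    ratSpan (AddSubgroup.closure s) = Submodule.span ℚ s := by
  refine le_antisymm (Submodule.span_le.2 ?_)
    (Submodule.span_mono AddSubgroup.subset_closure)
  exact (AddSubgroup.closure_le (Submodule.span ℚ s).toAddSubgroup).2 Submodule.subset_span

theorem eqOn_span {s : Set V} {Q Q' : V →ₗ[ℚ] ℚ} (h : ∀ v ∈ s, Q v = Q' v) {v : V}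
    (hv : v ∈ Submodule.span ℚ s) : Q v = Q' v :=
  LinearMap.eqOn_span (fun _ h' => h _ h') hv

theorem domRestrict_eq_iff {s : Set V} {Q Q' : V →ₗ[ℚ] ℚ} :
    Q.domRestrict (ratSpan (AddSubgroup.closure s)) = Q'.domRestrict _ ↔ ∀ v ∈ s, Q v = Q' v := by
  constructor
  · intro h v hv
    exact LinearMap.congr_fun h ⟨v, Submodule.subset_span (AddSubgroup.subset_closure hv)⟩
  · intro h
    ext ⟨v, hv⟩
    rw [ratSpan_closure] at hv
    exact eqOn_span h hv

theorem nonneg_of_mem_hull {s : Set V} {Q : V →ₗ[ℚ] ℚ} (h : ∀ v ∈ s, 0 ≤ Q v) {v : V}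
    (hv : v ∈ PointedCone.hull ℚ s) : 0 ≤ Q v := by
  induction hv using Submodule.span_induction with
  | mem x hx => exact h x hx
  | zero => simp
  | add x y _ _ hx hy => rw [map_add]; exact add_nonneg hx hy
  | smul c x _ hx =>
    have : Q (c • x) = (c : ℚ) * Q x := by
      rw [← smul_eq_mul, ← map_smul]; rfl
    rw [this]
    exact mul_nonneg c.2 hx

theorem mem_dualCone_hull_iff {s : Set V} {Q : V →ₗ[ℚ] ℚ} :
    Q.domRestrict _ ∈ dualCone (AddSubgroup.closure s) (PointedCone.hull ℚ s) ↔
      ∀ v ∈ s, 0 ≤ Q v :=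
  ⟨fun h v hv => h ⟨v, Submodule.subset_span (AddSubgroup.subset_closure hv)⟩
      (PointedCone.subset_hull hv), fun h _ hv => nonneg_of_mem_hull h hv⟩

theorem int_of_mem_closure {s : Set V} {Q : V →ₗ[ℚ] ℚ} (h : ∀ v ∈ s, ∃ k : ℤ, Q v = k) {v : V}
    (hv : v ∈ AddSubgroup.closure s) : ∃ k : ℤ, Q v = k := by
  induction hv using AddSubgroup.closure_induction with
  | mem x hx => exact h x hx
  | zero => exact ⟨0, by simp⟩
  | add x y _ _ hx hy =>
    obtain ⟨k, hk⟩ := hx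
    obtain ⟨l, hl⟩ := hy
    exact ⟨k + l, by rw [map_add, hk, hl]; push_cast; rfl⟩
  | neg x _ hx =>
    obtain ⟨k, hk⟩ := hx
    exact ⟨-k, by rw [map_neg, hk]; push_cast; rfl⟩

theorem mem_dualLattice_closure_iff {s : Set V} {Q : V →ₗ[ℚ] ℚ} :
    Q.domRestrict _ ∈ dualLattice (AddSubgroup.closure s) ↔ ∀ v ∈ s, ∃ k : ℤ, Q v = k :=
  ⟨fun h v hv => h v (AddSubgroup.subset_closure hv), fun h _ hm => int_of_mem_closure h hm⟩

/-- An integral functional taking a unit value on the lattice is primitive. -/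
theorem isPrimitive_of_isUnit {M : AddSubgroup V} {Q : V →ₗ[ℚ] ℚ}
    (hQ : Q.domRestrict _ ∈ dualLattice M) {v : V} (hv : v ∈ M) {u : ℤ} (hu : IsUnit u)
    (h : Q v = u) : IsPrimitive M (Q.domRestrict _) := by
  refine ⟨hQ, fun k ρ' hρ' hk => ?_⟩
  obtain ⟨l, hl⟩ := hρ' v hv
  have h1 := LinearMap.congr_fun hk ⟨v, Submodule.subset_span hv⟩
  simp only [LinearMap.domRestrict_apply, LinearMap.smul_apply, hl, h, zsmul_eq_mul] at h1
  have h2 : u = k * l := by exact_mod_cast h1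
  exact isUnit_of_mul_isUnit_left (h2 ▸ hu)

/-- A point of the cone spanned by a monoid has a positive multiple in the monoid. -/
theorem exists_nsmul_mem_of_mem_hull {v : V} (hv : v ∈ PointedCone.hull ℚ (S : Set V)) :
    ∃ k : ℕ, 0 < k ∧ k • v ∈ S := by
  induction hv using Submodule.span_induction with
  | mem x hx => exact ⟨1, one_pos, by simpa using hx⟩
  | zero => exact ⟨1, one_pos, by simp [S.zero_mem]⟩
  | add x y _ _ hx hy =>
    obtain ⟨k, hk, hk'⟩ := hx
    obtain ⟨l, hl, hl'⟩ := hy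
    refine ⟨k * l, Nat.mul_pos hk hl, ?_⟩
    rw [smul_add, mul_comm, mul_smul, mul_comm, mul_smul]
    exact S.add_mem (S.nsmul_mem hk' l) (S.nsmul_mem hl' k)
  | smul c x _ hx =>
    obtain ⟨k, hk, hk'⟩ := hx
    obtain ⟨c, hc⟩ := c
    refine ⟨c.den * k, Nat.mul_pos c.den_pos hk, ?_⟩
    have h1 : (c.den * k) • ((⟨c, hc⟩ : {c : ℚ // 0 ≤ c}) • x) = c.num.toNat • (k • x) := by
      change (c.den * k) • (c • x) = _
      rw [← Nat.cast_smul_eq_nsmul ℚ, ← Nat.cast_smul_eq_nsmul ℚ c.num.toNat,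
        ← Nat.cast_smul_eq_nsmul ℚ k, smul_smul, smul_smul]
      congr 1
      have h2 : ((c.num.toNat : ℕ) : ℚ) = (c.num : ℚ) := by
        have := Int.toNat_of_nonneg (Rat.num_nonneg.2 hc)
        exact_mod_cast this
      rw [h2]
      push_cast
      have := Rat.den_mul_eq_num c
      rw [← this]; ring
    rw [h1]
    exact S.nsmul_mem hk' _

theorem mem_hull_of_nsmul_mem {s : Set V} {k : ℕ} (hk : 0 < k) {v : V}
    (h : k • v ∈ PointedCone.hull ℚ s) : v ∈ PointedCone.hull ℚ s := by
  have h1 := PointedCone.smul_mem (PointedCone.hull ℚ s) (r := (k : ℚ)⁻¹) (by positivity) h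
  rwa [← Nat.cast_smul_eq_nsmul ℚ, smul_smul, inv_mul_cancel₀ (by positivity), one_smul] at h1

/-! ### Root functionals and Demazure roots -/

/-- The functional `ρ` and the vector `e` describe a homogeneous locally nilpotent derivation
`χᵐ ↦ ρ(m) χᵐ⁺ᵉ` of the monoid algebra of `S`. -/
structure IsRootFunctional (S : AddSubmonoid V) (e : V) (ρ : V →ₗ[ℚ] ℚ) : Prop where
  nat : ∀ m ∈ S, ∃ k : ℕ, ρ m = k
  root : ρ e = -1
  add_mem : ∀ m ∈ S, ρ m ≠ 0 → m + e ∈ S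
  ne_zero : ∃ m ∈ S, ρ m ≠ 0

namespace IsRootFunctional

variable {e : V} {ρ : V →ₗ[ℚ] ℚ}

theorem nonneg (h : IsRootFunctional S e ρ) {m : V} (hm : m ∈ S) : 0 ≤ ρ m := by
  obtain ⟨k, hk⟩ := h.nat m hm
  rw [hk]; exact k.cast_nonneg

theorem add_nsmul_mem (h : IsRootFunctional S e ρ) {m : V} (hm : m ∈ S) {k : ℕ}
    (hk : (k : ℚ) ≤ ρ m) : m + k • e ∈ S := by
  induction k with
  | zero => simpa using hm
  | succ k ih =>
    push_cast at hk
    have h1 := h.add_mem _ (ih (by linarith)) (by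
      rw [map_add, map_nsmul, h.root]
      simp only [smul_neg, nsmul_eq_mul, mul_one]
      linarith)
    rwa [add_assoc, ← succ_nsmul] at h1

theorem exists_add_nsmul_mem (h : IsRootFunctional S e ρ) {m : V} (hm : m ∈ S) :
    ∃ k : ℕ, ρ m = k ∧ m + k • e ∈ S ∧ ρ (m + k • e) = 0 := by
  obtain ⟨k, hk⟩ := h.nat m hm
  refine ⟨k, hk, h.add_nsmul_mem hm hk.ge, ?_⟩
  rw [map_add, map_nsmul, h.root, hk]
  simp

theorem mem_closure (h : IsRootFunctional S e ρ) : e ∈ AddSubgroup.closure (S : Set V) := by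
  obtain ⟨m, hm, hm'⟩ := h.ne_zero
  have := AddSubgroup.sub_mem _ (AddSubgroup.subset_closure (h.add_mem m hm hm'))
    (AddSubgroup.subset_closure hm)
  simpa using this

/-- A root functional is determined by its root: starting at `m` one can add `e` at least `ρ(m)`
times, so `ρ(m) ≤ ρ'(m)`. -/
theorem eq_of_mem (h : IsRootFunctional S e ρ) {ρ' : V →ₗ[ℚ] ℚ} (h' : IsRootFunctional S e ρ')
    {m : V} (hm : m ∈ S) : ρ m = ρ' m := by
  have key : ∀ {σ τ : V →ₗ[ℚ] ℚ}, IsRootFunctional S e σ → IsRootFunctional S e τ →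
      σ m ≤ τ m := by
    intro σ τ hσ hτ
    obtain ⟨k, hk, hk', -⟩ := hσ.exists_add_nsmul_mem hm
    have := hτ.nonneg hk'
    rw [map_add, map_nsmul, hτ.root] at this
    simp only [smul_neg, nsmul_eq_mul, mul_one] at this
    linarith
  exact le_antisymm (key h h') (key h' h)

/-- A functional that is nonnegative on `S` and vanishes on the points `m + ρ(m) e`, where `m` runs
through generators of `S`, is a nonnegative multiple of `ρ`. -/
theorem eq_smul_of_vanish (h : IsRootFunctional S e ρ) {F : Set V}
    (hF : AddSubmonoid.closure F = S) {q : V →ₗ[ℚ] ℚ} (hq : ∀ m ∈ S, 0 ≤ q m)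
    (h0 : ∀ m ∈ F, q (m + ρ m • e) = 0) :
    0 ≤ -q e ∧ ∀ m ∈ S, q m = -q e * ρ m := by
  have h1 : ∀ m ∈ S, q m = -q e * ρ m := by
    intro m hm
    have h2 : ∀ v ∈ F, q v = ((-q e) • ρ) v := by
      intro v hv
      have := h0 v hv
      rw [map_add, map_smul, smul_eq_mul] at this
      simp only [LinearMap.smul_apply, smul_eq_mul]
      linarith
    refine (eqOn_span h2 (?_ : m ∈ _)).trans (by simp)
    rw [← hF] at hm
    exact (AddSubmonoid.closure_le (S := (Submodule.span ℚ F).toAddSubmonoid)).2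
      Submodule.subset_span hm
  refine ⟨?_, h1⟩
  obtain ⟨m, hm, hm'⟩ := h.ne_zero
  have h3 := h1 m hm
  have h4 := hq m hm
  rw [h3] at h4
  exact nonneg_of_mul_nonneg_left h4 (lt_of_le_of_ne (h.nonneg hm) hm'.symm)

theorem isPrimitive (h : IsRootFunctional S e ρ) :
    IsPrimitive (AddSubgroup.closure (S : Set V)) (ρ.domRestrict _) := by
  refine isPrimitive_of_isUnit (mem_dualLattice_closure_iff.2 fun m hm => ?_) h.mem_closure
    (u := -1) (by simp) (by simp [h.root])
  obtain ⟨k, hk⟩ := h.nat m hm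
  exact ⟨k, by simpa using hk⟩

/-- A root functional spans a ray of the dual cone: the face cut out by the sum of the elements
`m + ρ(m) e`, where `m` runs through generators of `S`. -/
theorem mem_primitiveRays (h : IsRootFunctional S e ρ) (hfg : S.FG) :
    ρ.domRestrict _ ∈
      primitiveRays (AddSubgroup.closure (S : Set V)) (PointedCone.hull ℚ (S : Set V)) := by
  obtain ⟨F, hF⟩ := hfg
  have hFS : ∀ m ∈ F, m ∈ S := fun m hm => hF ▸ AddSubmonoid.subset_closure hm
  have hmem : ∀ m ∈ F, m + ρ m • e ∈ S := by
    intro m hm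
    obtain ⟨k, hk, hk', -⟩ := h.exists_add_nsmul_mem (hFS m hm)
    rwa [hk, Nat.cast_smul_eq_nsmul]
  have hv : ∑ m ∈ F, (m + ρ m • e) ∈ S := S.sum_mem hmem
  have hρv : ρ (∑ m ∈ F, (m + ρ m • e)) = 0 := by
    rw [map_sum]
    refine Finset.sum_eq_zero fun m _ => ?_
    rw [map_add, map_smul, h.root]
    simp
  refine ⟨h.isPrimitive, ⟨_, Submodule.subset_span (AddSubgroup.subset_closure hv)⟩,
    PointedCone.subset_hull hv, ?_⟩
  ext q
  constructor
  · rintro ⟨hq, hq0⟩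
    obtain ⟨Q, rfl⟩ := exists_domRestrict_eq _ q
    rw [mem_dualCone_hull_iff] at hq
    rw [LinearMap.domRestrict_apply, map_sum,
      Finset.sum_eq_zero_iff_of_nonneg fun m hm => hq _ (hmem m hm)] at hq0
    obtain ⟨h1, h2⟩ := h.eq_smul_of_vanish hF hq hq0
    refine ⟨-Q e, h1, ?_⟩
    exact domRestrict_eq_iff (Q' := (-Q e) • ρ).2 fun m hm => by simpa using h2 m hm
  · rintro ⟨c, hc, rfl⟩
    refine ⟨fun v hv => ?_, ?_⟩
    · exact mul_nonneg hc (nonneg_of_mem_hull (fun m hm => h.nonneg hm) hv)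
    · simp [hρv]

end IsRootFunctional

/-- A primitive vector that is a nonnegative multiple of an integral functional taking the value
`-1` on the lattice is equal to the latter. -/
theorem IsPrimitive.eq_of_smul_eq {M : AddSubgroup V} {ρ ρ' : DualSpace M}
    (h : IsPrimitive M ρ) {e : V} (he : e ∈ M) (he' : ρ' ⟨e, Submodule.subset_span he⟩ = -1)
    (hρ' : ρ' ∈ dualLattice M) {c : ℚ} (hc : 0 ≤ c) (hcr : ρ = c • ρ') : ρ = ρ' := by
  obtain ⟨k, hk⟩ := h.1 e he
  rw [hcr, LinearMap.smul_apply, he', smul_eq_mul] at hk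
  have h1 : c = ((-k : ℤ) : ℚ) := by push_cast; linarith
  have h2 := h.2 (-k) ρ' hρ' (by rw [hcr, h1, Int.cast_smul_eq_zsmul])
  rcases Int.isUnit_iff.1 h2 with h3 | h3
  · rw [hcr, h1, h3]; simp
  · rw [h1, h3] at hc; norm_num at hc

theorem IsPrimitive.ne_zero {M : AddSubgroup V} {ρ : DualSpace M} (h : IsPrimitive M ρ) :
    ρ ≠ 0 := by
  rintro rfl
  have := h.2 2 0 h.1 (by simp)
  exact absurd this (by decide)

theorem mem_dualCone_of_mem_primitiveRays {M : AddSubgroup V} {C : PointedCone ℚ V}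
    {ρ : DualSpace M} (h : ρ ∈ primitiveRays M C) : ρ ∈ dualCone M C := by
  obtain ⟨-, v, -, hv⟩ := h
  have : ρ ∈ {q | ∃ c : ℚ, 0 ≤ c ∧ q = c • ρ} := ⟨1, zero_le_one, by simp⟩
  rw [← hv] at this
  exact this.1

/-- The root `e` of a root functional `ρ` is a Demazure root belonging to the ray of `ρ`: if `ρ'`
spans the ray cut out by `v`, then `ρ` does not vanish on a suitable multiple `m` of `v` in `S`,
whence `0 ≤ ρ'(m + e) = ρ'(e)`. -/
theorem IsRootFunctional.mem_demazureRootsAt {e : V} {ρ : V →ₗ[ℚ] ℚ}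
    (h : IsRootFunctional S e ρ) :
    e ∈ demazureRootsAt (AddSubgroup.closure (S : Set V)) (PointedCone.hull ℚ (S : Set V))
      (ρ.domRestrict _) := by
  refine ⟨h.mem_closure, h.root, fun ρ' hρ' hne => ?_⟩
  have hρ'c := mem_dualCone_of_mem_primitiveRays hρ'
  obtain ⟨hprim, v, hv, hface⟩ := hρ'
  obtain ⟨k, hk, hkv⟩ := exists_nsmul_mem_of_mem_hull hv
  by_cases h0 : ρ (v : V) = 0
  · have h1 : ρ.domRestrict _ ∈ {q | ∃ c : ℚ, 0 ≤ c ∧ q = c • ρ'} := by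
      rw [← hface]
      exact ⟨mem_dualCone_hull_iff.2 fun m hm => h.nonneg hm, h0⟩
    obtain ⟨c, hc, hcρ⟩ := h1
    have hc0 : c ≠ 0 := by
      rintro rfl
      rw [zero_smul] at hcρ
      exact h.isPrimitive.ne_zero hcρ
    refine absurd (hprim.eq_of_smul_eq h.mem_closure h.root h.isPrimitive.1
      (inv_nonneg.2 hc) ?_) hne
    rw [hcρ, smul_smul, inv_mul_cancel₀ hc0, one_smul]
  · have h2 : k • (v : V) + e ∈ S := by
      refine h.add_mem _ hkv ?_
      rw [map_nsmul, nsmul_eq_mul]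
      exact mul_ne_zero (by positivity) h0
    have h3 : ρ' v = 0 := by
      have : ρ' ∈ {q | ∃ c : ℚ, 0 ≤ c ∧ q = c • ρ'} := ⟨1, zero_le_one, by simp⟩
      rw [← hface] at this
      exact this.2
    have h4 := hρ'c (k • v + ⟨e, Submodule.subset_span h.mem_closure⟩)
      (PointedCone.subset_hull h2)
    rwa [map_add, map_nsmul, h3, smul_zero, zero_add] at h4

/-- A functional on a finite set has a positive multiple that is integral and primitive on the
lattice spanned by the set. -/
theorem exists_pos_smul_isPrimitive {F : Finset V} {q : V →ₗ[ℚ] ℚ} (hq : ∃ f ∈ F, q f ≠ 0) :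
    ∃ c : ℚ, 0 < c ∧
      IsPrimitive (AddSubgroup.closure (F : Set V)) ((c • q).domRestrict _) := by
  classical
  set N : ℕ := ∏ f ∈ F, (q f).den with hN
  have hNpos : 0 < N := Finset.prod_pos fun f _ => (q f).den_pos
  have hint : ∀ v ∈ AddSubgroup.closure (F : Set V), ∃ k : ℤ, ((N : ℚ) • q) v = k := by
    intro v hv
    refine int_of_mem_closure (fun f hf => ?_) hv
    obtain ⟨d, hd⟩ := Finset.dvd_prod_of_mem (fun f => (q f).den) hf
    refine ⟨d * (q f).num, ?_⟩
    rw [LinearMap.smul_apply, smul_eq_mul, hN, hd]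
    push_cast
    rw [← Rat.den_mul_eq_num (q f)]
    ring
  let H : AddSubgroup ℤ :=
    { carrier := {k | ∃ v ∈ AddSubgroup.closure (F : Set V), ((N : ℚ) • q) v = k}
      zero_mem' := ⟨0, zero_mem _, by simp⟩
      add_mem' := by
        rintro a b ⟨v, hv, hva⟩ ⟨w, hw, hwb⟩
        exact ⟨v + w, add_mem hv hw, by rw [map_add, hva, hwb]; push_cast; rfl⟩
      neg_mem' := by
        rintro a ⟨v, hv, hva⟩
        exact ⟨-v, neg_mem hv, by rw [map_neg, hva]; push_cast; rfl⟩ }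
  obtain ⟨a, ha⟩ := Int.subgroup_cyclic H
  have ha0 : a ≠ 0 := by
    rintro rfl
    obtain ⟨f, hf, hqf⟩ := hq
    obtain ⟨k, hk⟩ := hint f (AddSubgroup.subset_closure hf)
    have hkH : k ∈ H := ⟨f, AddSubgroup.subset_closure hf, hk⟩
    rw [ha, AddSubgroup.mem_closure_singleton] at hkH
    obtain ⟨z, hz⟩ := hkH
    rw [smul_zero] at hz
    rw [← hz, LinearMap.smul_apply, smul_eq_mul] at hk
    simp only [Int.cast_zero, mul_eq_zero, Nat.cast_eq_zero] at hk
    exact hk.elim (fun h => hNpos.ne' h) hqf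
  have ha1 : (0 : ℚ) < |(a : ℚ)| := abs_pos.2 (by exact_mod_cast ha0)
  have hval : ∀ v : V, ∀ z : ℤ, ((N : ℚ) • q) v = z → (((N : ℚ) / |(a : ℚ)|) • q) v
      = z / |(a : ℚ)| := by
    intro v z hz
    rw [← hz]
    simp only [LinearMap.smul_apply, smul_eq_mul]
    ring
  have haH : a ∈ H := by
    rw [ha]; exact AddSubgroup.subset_closure rfl
  obtain ⟨v, hv, hva⟩ := haH
  refine ⟨N / |(a : ℚ)|, by positivity, ?_⟩
  have hlat : ((N / |(a : ℚ)|) • q).domRestrict _ ∈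
      dualLattice (AddSubgroup.closure (F : Set V)) := by
    intro m hm
    obtain ⟨k, hk⟩ := hint m hm
    have hkH : k ∈ H := ⟨m, hm, hk⟩
    rw [ha, AddSubgroup.mem_closure_singleton] at hkH
    obtain ⟨z, rfl⟩ := hkH
    rw [LinearMap.domRestrict_apply, hval m _ hk]
    rcases abs_choice (a : ℚ) with h | h
    · refine ⟨z, ?_⟩
      rw [div_eq_iff ha1.ne', h, smul_eq_mul]; push_cast; rfl
    · refine ⟨-z, ?_⟩
      rw [div_eq_iff ha1.ne', h, smul_eq_mul]; push_cast; ring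
  rcases abs_choice (a : ℚ) with h | h
  · refine isPrimitive_of_isUnit hlat hv isUnit_one ?_
    rw [hval v _ hva, div_eq_iff ha1.ne', h]; simp
  · refine isPrimitive_of_isUnit hlat hv (u := -1) (by simp) ?_
    rw [hval v _ hva, div_eq_iff ha1.ne', h]; simp

/-- A vector outside a finitely generated cone is separated from it by a primitive ray generator
of the dual cone: among the separating functionals, one vanishing on as many generators as
possible spans an extremal ray. -/
theorem exists_primitiveRay_neg (hfg : S.FG) {b : V}
    (hb : b ∈ ratSpan (AddSubgroup.closure (S : Set V)))
    (hbS : b ∉ PointedCone.hull ℚ (S : Set V)) :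
    ∃ ρ ∈ primitiveRays (AddSubgroup.closure (S : Set V)) (PointedCone.hull ℚ (S : Set V)),
      ρ ⟨b, hb⟩ < 0 := by
  classical
  obtain ⟨F, hF⟩ := hfg
  have hFS : ∀ m ∈ F, m ∈ S := fun m hm => hF ▸ AddSubmonoid.subset_closure hm
  have hcl : AddSubgroup.closure (S : Set V) = AddSubgroup.closure (F : Set V) := by
    refine le_antisymm ((AddSubgroup.closure_le _).2 ?_) (AddSubgroup.closure_mono hFS)
    rw [← hF]
    exact (AddSubmonoid.closure_le (S := (AddSubgroup.closure (F : Set V)).toAddSubmonoid)).2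
      AddSubgroup.subset_closure
  have hspan : ∀ m ∈ ratSpan (AddSubgroup.closure (S : Set V)),
      m ∈ Submodule.span ℚ (F : Set V) := by
    intro m hm
    rwa [hcl, ratSpan_closure] at hm
  have hSF : ∀ m ∈ S, m ∈ AddSubmonoid.closure (F : Set V) := fun m hm => by rwa [hF]
  have hnn : ∀ q : V →ₗ[ℚ] ℚ, (∀ f ∈ F, 0 ≤ q f) → ∀ m ∈ S, 0 ≤ q m := by
    intro q hq m hm
    induction hSF m hm using AddSubmonoid.closure_induction with
    | mem x hx => exact hq x hx
    | zero => simp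
    | add x y hx' hy' hx hy =>
      rw [map_add]
      exact add_nonneg (hx (hF ▸ hx')) (hy (hF ▸ hy'))
  -- the zero sets of separating functionals
  let P : Finset (Finset V) := F.powerset.filter fun I =>
    ∃ q : V →ₗ[ℚ] ℚ, (∀ f ∈ F, 0 ≤ q f) ∧ q b < 0 ∧ F.filter (fun f => q f = 0) = I
  have hP : P.Nonempty := by
    rcases farkas F id b with ⟨c, hc, hbc⟩ | ⟨q, hq, hqb⟩
    · refine absurd ?_ hbS
      rw [hbc]
      exact Submodule.sum_mem _ fun f hf =>
        PointedCone.smul_mem _ (hc f) (PointedCone.subset_hull (hFS f hf))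
    · exact ⟨_, Finset.mem_filter.2 ⟨Finset.mem_powerset.2 (Finset.filter_subset _ _),
        q, hq, hqb, rfl⟩⟩
  obtain ⟨I, hI, hmax⟩ := P.exists_max_image Finset.card hP
  obtain ⟨-, q, hq, hqb, rfl⟩ := Finset.mem_filter.1 hI
  -- moving from `q` in a direction `p` vanishing at `b` and on the zero set of `q` makes
  -- a further generator vanish
  have key : ∀ p : V →ₗ[ℚ] ℚ, (∀ f ∈ F, q f = 0 → p f = 0) → p b = 0 →
      ∀ f ∈ F, p f ≤ 0 := by
    intro p hp hpb f hf
    by_contra! hpf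
    obtain ⟨g, hg, hgmin⟩ := (F.filter fun f => 0 < p f).exists_min_image
      (fun f => q f / p f) ⟨f, Finset.mem_filter.2 ⟨hf, hpf⟩⟩
    obtain ⟨hgF, hpg⟩ := Finset.mem_filter.1 hg
    set t := q g / p g
    have ht : 0 ≤ t := div_nonneg (hq g hgF) hpg.le
    have hq' : ∀ f ∈ F, 0 ≤ (q - t • p) f := by
      intro f hf
      simp only [LinearMap.sub_apply, LinearMap.smul_apply, smul_eq_mul, sub_nonneg]
      rcases le_or_gt (p f) 0 with h | h
      · exact (mul_nonpos_of_nonneg_of_nonpos ht h).trans (hq f hf)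
      · exact (le_div_iff₀ h).1 (hgmin f (Finset.mem_filter.2 ⟨hf, h⟩))
    have h1 := hmax (F.filter fun f => (q - t • p) f = 0) (Finset.mem_filter.2
      ⟨Finset.mem_powerset.2 (Finset.filter_subset _ _), q - t • p, hq', by
        simpa [hpb] using hqb, rfl⟩)
    refine absurd h1 (not_le.2 (Finset.card_lt_card ?_))
    refine Finset.ssubset_iff_of_subset ?_ |>.2 ⟨g, ?_, ?_⟩
    · intro f hf
      obtain ⟨hfF, hqf⟩ := Finset.mem_filter.1 hf
      exact Finset.mem_filter.2 ⟨hfF, by simp [hqf, hp f hfF hqf]⟩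
    · refine Finset.mem_filter.2 ⟨hgF, ?_⟩
      simp [t, div_mul_cancel₀ _ hpg.ne']
    · intro h
      exact hpg.ne' (hp g hgF (Finset.mem_filter.1 h).2)
  have hext : ∀ p : V →ₗ[ℚ] ℚ, (∀ f ∈ F, q f = 0 → p f = 0) →
      ∀ f ∈ F, p f = (p b / q b) * q f := by
    intro p hp f hf
    have hb0 : (p - (p b / q b) • q) b = 0 := by
      simp [div_mul_cancel₀ _ hqb.ne]
    have hv : ∀ f ∈ F, q f = 0 → (p - (p b / q b) • q) f = 0 := by
      intro f hf h
      simp [h, hp f hf h]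
    have h1 := key _ hv hb0 f hf
    have h2 := key (-(p - (p b / q b) • q)) (fun f hf h => by
      rw [LinearMap.neg_apply, hv f hf h, neg_zero]) (by
      rw [LinearMap.neg_apply, hb0, neg_zero]) f hf
    simp only [LinearMap.neg_apply, LinearMap.sub_apply, LinearMap.smul_apply, smul_eq_mul]
      at h1 h2
    linarith
  obtain ⟨f₀, hf₀, hqf₀⟩ : ∃ f ∈ F, q f ≠ 0 := by
    by_contra! h
    exact hqb.ne ((eqOn_span (Q' := 0) (fun v hv => by simpa using h v hv)
      (hspan b hb)).trans (by simp))
  obtain ⟨c, hc, hprim⟩ := exists_pos_smul_isPrimitive ⟨f₀, hf₀, hqf₀⟩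
  have hvS : ∑ f ∈ F.filter (fun f => q f = 0), f ∈ S :=
    S.sum_mem fun f hf => hFS f (Finset.mem_filter.1 hf).1
  refine ⟨(c • q).domRestrict _, ⟨?_, ⟨_, Submodule.subset_span
    (AddSubgroup.subset_closure hvS)⟩, PointedCone.subset_hull hvS, ?_⟩, ?_⟩
  · rw [hcl]; exact hprim
  · ext p
    constructor
    · rintro ⟨hp, hp0⟩
      obtain ⟨Q, rfl⟩ := exists_domRestrict_eq _ p
      rw [mem_dualCone_hull_iff] at hp
      rw [LinearMap.domRestrict_apply, map_sum, Finset.sum_eq_zero_iff_of_nonneg fun m hm =>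
        hp _ (hFS _ (Finset.mem_filter.1 hm).1)] at hp0
      have h1 := hext Q fun f hf h => hp0 f (Finset.mem_filter.2 ⟨hf, h⟩)
      refine ⟨Q b / q b / c, div_nonneg ?_ hc.le, ?_⟩
      · have h2 := hp f₀ (hFS f₀ hf₀)
        rw [h1 f₀ hf₀] at h2
        exact nonneg_of_mul_nonneg_left h2 (lt_of_le_of_ne (hq f₀ hf₀) hqf₀.symm)
      · refine domRestrict_eq_iff (Q' := (Q b / q b / c) • (c • q)).2 fun m hm => ?_
        have h3 : ∀ f ∈ (F : Set V), Q f = ((Q b / q b) • q) f := h1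
        rw [eqOn_span h3 (hspan m (Submodule.subset_span (AddSubgroup.subset_closure hm)))]
        simp only [LinearMap.smul_apply, smul_eq_mul]
        field_simp
    · rintro ⟨d, hd, rfl⟩
      refine ⟨fun v hv => ?_, ?_⟩
      · exact mul_nonneg hd (mul_nonneg hc.le (nonneg_of_mem_hull (hnn q hq) hv))
      · simp only [LinearMap.smul_apply, LinearMap.domRestrict_apply, map_sum, smul_eq_mul]
        rw [← Finset.mul_sum, Finset.sum_eq_zero fun f hf => (Finset.mem_filter.1 hf).2]
        simp
  · simp only [LinearMap.domRestrict_apply, LinearMap.smul_apply, smul_eq_mul]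
    exact mul_neg_of_pos_of_neg hc hqb

/-- A Demazure root `e` belonging to the ray of `ρ` makes `ρ` a root functional, provided that `S`
is saturated: if `ρ(m) ≥ 1`, then `m + e` is nonnegative on all rays of the dual cone, hence lies
in the cone. -/
theorem isRootFunctional_of_mem_demazureRootsAt (hfg : S.FG)
    (hsat : ∀ v ∈ AddSubgroup.closure (S : Set V), ∀ k : ℕ, 0 < k → k • v ∈ S → v ∈ S)
    {e : V} {ρ : V →ₗ[ℚ] ℚ}
    (hρ : ρ.domRestrict _ ∈
      primitiveRays (AddSubgroup.closure (S : Set V)) (PointedCone.hull ℚ (S : Set V)))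
    (he : e ∈ demazureRootsAt (AddSubgroup.closure (S : Set V)) (PointedCone.hull ℚ (S : Set V))
      (ρ.domRestrict _)) :
    IsRootFunctional S e ρ := by
  obtain ⟨heM, hroot, hpos⟩ := he
  rw [LinearMap.domRestrict_apply] at hroot
  have hnn := mem_dualCone_hull_iff.1 (mem_dualCone_of_mem_primitiveRays hρ)
  have hnat : ∀ m ∈ S, ∃ k : ℕ, ρ m = k := by
    intro m hm
    obtain ⟨k, hk⟩ := mem_dualLattice_closure_iff.1 hρ.1.1 m hm
    have h0 := hnn m hm
    rw [hk] at h0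
    have h1 : 0 ≤ k := by exact_mod_cast h0
    exact ⟨k.toNat, by rw [hk]; exact_mod_cast (Int.toNat_of_nonneg h1).symm⟩
  refine ⟨hnat, hroot, fun m hm h0 => ?_, ?_⟩
  · have hmem : m + e ∈ AddSubgroup.closure (S : Set V) :=
      add_mem (AddSubgroup.subset_closure hm) heM
    have hhull : m + e ∈ PointedCone.hull ℚ (S : Set V) := by
      by_contra hne
      obtain ⟨ρ', hρ', hneg⟩ := exists_primitiveRay_neg hfg (Submodule.subset_span hmem) hne
      obtain ⟨Q, rfl⟩ := exists_domRestrict_eq _ ρ'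
      have hQm := mem_dualCone_hull_iff.1 (mem_dualCone_of_mem_primitiveRays hρ') m hm
      rw [LinearMap.domRestrict_apply, map_add] at hneg
      by_cases heq : Q.domRestrict (ratSpan (AddSubgroup.closure (S : Set V))) = ρ.domRestrict _
      · have h1 := LinearMap.congr_fun heq ⟨e, Submodule.subset_span heM⟩
        have h2 := LinearMap.congr_fun heq
          ⟨m, Submodule.subset_span (AddSubgroup.subset_closure hm)⟩
        simp only [LinearMap.domRestrict_apply] at h1 h2
        obtain ⟨k, hk⟩ := hnat m hm
        rw [h1, h2, hroot, hk] at hneg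
        rw [hk] at h0
        have h3 : 1 ≤ k := Nat.one_le_iff_ne_zero.2 (by exact_mod_cast h0)
        have h4 : (1 : ℚ) ≤ k := by exact_mod_cast h3
        linarith
      · have h1 := hpos _ hρ' heq
        rw [LinearMap.domRestrict_apply] at h1
        linarith
    obtain ⟨k, hk, hkm⟩ := exists_nsmul_mem_of_mem_hull hhull
    exact hsat _ hmem k hk hkm
  · by_contra! h
    have h1 := eqOn_span (Q' := 0) (fun v hv => by simpa using h v hv)
      ((ratSpan_closure (S : Set V)).le (Submodule.subset_span heM))
    rw [hroot] at h1
    simp at h1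

end Toric

/-! ### Actions of the additive group and locally nilpotent derivations -/

section Additive

open Polynomial

theorem eq_zero_of_sum_pow_smul_eq_zero {K E : Type*} [Field K] [Infinite K] [AddCommGroup E]
    [Module K E] {N : ℕ} {x : ℕ → E} (h : ∀ s : K, ∑ i ∈ Finset.range N, s ^ i • x i = 0)
    {i : ℕ} (hi : i < N) : x i = 0 := by
  rw [← Module.forall_dual_apply_eq_zero_iff K]
  intro l
  have h1 : (∑ j ∈ Finset.range N, C (l (x j)) * X ^ j : K[X]) = 0 := by
    refine Polynomial.funext fun s => ?_
    have := congrArg l (h s)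
    simp only [map_sum, map_smul, smul_eq_mul, map_zero] at this
    rw [eval_finsetSum, eval_zero, ← this]
    exact Finset.sum_congr rfl fun j _ => by rw [eval_mul, eval_C, eval_pow, eval_X, mul_comm]
  have h2 := congrArg (fun p => p.coeff i) h1
  simpa [finsetSum_coeff, coeff_C_mul, coeff_X_pow, hi] using h2

variable {K : Type*} [Field K] [CharZero K] {A : Type*} [CommRing A] [Algebra K A]

omit [CharZero K] in
theorem exists_polynomial_of_mem_regularFunctionsGa {c : Multiplicative K → K}
    (hc : c ∈ regularFunctionsGa K) :
    ∃ p : K[X], ∀ s : K, c (Multiplicative.ofAdd s) = p.eval s := by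
  induction hc using Algebra.adjoin_induction with
  | mem f hf => exact ⟨X, fun s => by rw [Set.mem_singleton_iff.1 hf]; simp⟩
  | algebraMap r => exact ⟨C r, fun s => by simp [Pi.algebraMap_apply]⟩
  | add f g _ _ hf hg =>
    obtain ⟨p, hp⟩ := hf
    obtain ⟨q, hq⟩ := hg
    exact ⟨p + q, fun s => by simp [hp, hq]⟩
  | mul f g _ _ hf hg =>
    obtain ⟨p, hp⟩ := hf
    obtain ⟨q, hq⟩ := hg
    exact ⟨p * q, fun s => by simp [hp, hq]⟩

/-- The `𝔾_a`-action `φ` is `s ↦ exp(s D)` for the locally nilpotent derivation `D`. -/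
def IsExponential (D : Derivation K A A) (φ : Multiplicative K →* (A ≃ₐ[K] A)) : Prop :=
  ∀ a : A, ∃ N : ℕ, D^[N] a = 0 ∧ ∀ s : K, φ (Multiplicative.ofAdd s) a =
    ∑ i ∈ Finset.range N, s ^ i • ((i.factorial : K)⁻¹ • D^[i] a)

omit [CharZero K] in
theorem iterate_derivation_smul (D : Derivation K A A) (n : ℕ) (r : K) (a : A) :
    D^[n] (r • a) = r • D^[n] a := by
  induction n with
  | zero => rfl
  | succ n ih => rw [Function.iterate_succ_apply', ih, D.map_smul, Function.iterate_succ_apply']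

omit [CharZero K] in
theorem iterate_eq_zero_of_le {D : Derivation K A A} {N n : ℕ} (h : N ≤ n) {a : A}
    (ha : D^[N] a = 0) : D^[n] a = 0 := by
  obtain ⟨k, rfl⟩ := Nat.exists_eq_add_of_le h
  rw [add_comm, Function.iterate_add_apply, ha]
  exact iterate_map_zero D k

omit [CharZero K] in
theorem sum_exp_eq {D : Derivation K A A} {N n : ℕ} (h : N ≤ n) {a : A} (ha : D^[N] a = 0)
    (s : K) : ∑ i ∈ Finset.range n, s ^ i • ((i.factorial : K)⁻¹ • D^[i] a) =
      ∑ i ∈ Finset.range N, s ^ i • ((i.factorial : K)⁻¹ • D^[i] a) := by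
  symm
  refine Finset.sum_subset (Finset.range_mono h) fun i _ hi => ?_
  rw [iterate_eq_zero_of_le (not_lt.1 fun h' => hi (Finset.mem_range.2 h')) ha, smul_zero,
    smul_zero]

omit [CharZero K] in
theorem IsExponential.exists_le {D : Derivation K A A} {φ : Multiplicative K →* (A ≃ₐ[K] A)}
    (h : IsExponential D φ) (a : A) : ∃ N : ℕ, ∀ n, N ≤ n → D^[n] a = 0 ∧
      ∀ s : K, φ (Multiplicative.ofAdd s) a =
        ∑ i ∈ Finset.range n, s ^ i • ((i.factorial : K)⁻¹ • D^[i] a) := by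
  obtain ⟨N, hN, hφ⟩ := h a
  refine ⟨N, fun n hn => ⟨iterate_eq_zero_of_le hn hN, fun s => ?_⟩⟩
  rw [hφ, sum_exp_eq hn hN]

/-- Regular `𝔾_a`-actions are exponentials of locally nilpotent derivations. -/
theorem exists_isExponential [IsDomain A] {φ : Multiplicative K →* (A ≃ₐ[K] A)}
    (hφ : IsRegularAction (regularFunctionsGa K) φ) :
    ∃ D : Derivation K A A, IsExponential D φ := by
  -- the action on `a` is a polynomial in the parameter, with linear coefficient `D a`
  have hex : ∀ a : A, ∃ P : A[X], ∀ s : K,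
      φ (Multiplicative.ofAdd s) a = P.eval (algebraMap K A s) := by
    intro a
    obtain ⟨m, c, b, hc, hg⟩ := hφ a
    choose p hp using fun i => exists_polynomial_of_mem_regularFunctionsGa (hc i)
    refine ⟨∑ i, (p i).map (algebraMap K A) * C (b i), fun s => ?_⟩
    rw [hg, eval_finsetSum]
    refine Finset.sum_congr rfl fun i _ => ?_
    rw [hp, eval_mul, eval_C, eval_map_algebraMap, aeval_algebraMap_apply, Algebra.smul_def]
    simp
  choose Φ hΦ using hex
  have hinj : ∀ {P Q : A[X]}, (∀ s : K, P.eval (algebraMap K A s) = Q.eval (algebraMap K A s)) →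
      P = Q := by
    intro P Q h
    refine eq_of_infinite_eval_eq P Q ((Set.infinite_range_of_injective
      (algebraMap K A).injective).mono ?_)
    rintro _ ⟨s, rfl⟩
    exact h s
  have hadd : ∀ a b, Φ (a + b) = Φ a + Φ b := fun a b => hinj fun s => by
    rw [← hΦ, map_add, hΦ, hΦ, eval_add]
  have hmul : ∀ a b, Φ (a * b) = Φ a * Φ b := fun a b => hinj fun s => by
    rw [← hΦ, map_mul, hΦ, hΦ, eval_mul]
  have hsmul : ∀ (r : K) a, Φ (r • a) = C (algebraMap K A r) * Φ a := fun r a => hinj fun s => by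
    rw [← hΦ, map_smul, hΦ, eval_mul, eval_C, Algebra.smul_def]
  have hzero : ∀ a, (Φ a).coeff 0 = a := fun a => by
    have := hΦ a 0
    rw [ofAdd_zero, map_one, map_zero, ← coeff_zero_eq_eval_zero] at this
    exact this.symm
  let D : Derivation K A A := Derivation.mk'
    { toFun := fun a => (Φ a).coeff 1
      map_add' := fun a b => by rw [hadd, coeff_add]
      map_smul' := fun r a => by
        rw [hsmul, coeff_C_mul, RingHom.id_apply, Algebra.smul_def] }
    (fun a b => by
      change (Φ (a * b)).coeff 1 = a • (Φ b).coeff 1 + b • (Φ a).coeff 1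
      rw [hmul, mul_coeff_one, hzero, hzero, smul_eq_mul, smul_eq_mul]
      ring)
  have hD : ∀ a, D a = (Φ a).coeff 1 := fun a => rfl
  -- differentiate the group law `φ (s + t) a = φ t (φ s a)` at `t = 0`
  have hder : ∀ a, derivative (Φ a) = (Φ a).sum fun j c => monomial j (D c) := by
    intro a
    refine hinj fun s => ?_
    have h1 : Φ (φ (Multiplicative.ofAdd s) a) = taylor (algebraMap K A s) (Φ a) := by
      refine hinj fun t => ?_
      rw [← hΦ, taylor_eval, ← map_add, ← hΦ, ofAdd_add, map_mul]
      rfl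
    have h2 := congrArg (fun p => p.coeff 1) h1
    simp only [taylor_coeff_one] at h2
    rw [← h2, ← hD, hΦ, eval_eq_sum, Polynomial.sum, Polynomial.sum, eval_finsetSum, map_sum]
    refine Finset.sum_congr rfl fun j _ => ?_
    rw [eval_monomial, ← map_pow, mul_comm, ← Algebra.smul_def, D.map_smul, Algebra.smul_def,
      mul_comm]
  have hcoeff : ∀ a j, D ((Φ a).coeff j) = ((j : A) + 1) * (Φ a).coeff (j + 1) := by
    intro a j
    have h1 := congrArg (fun p => p.coeff j) (hder a)
    simp only [coeff_derivative, Polynomial.sum, finsetSum_coeff, coeff_monomial] at h1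
    rw [Finset.sum_ite_eq' (Φ a).support j fun j => D ((Φ a).coeff j)] at h1
    rw [mul_comm, h1]
    split_ifs with h
    · rfl
    · rw [notMem_support_iff.1 h, map_zero]
  have hiter : ∀ a j, D^[j] a = (j.factorial : A) * (Φ a).coeff j := by
    intro a j
    induction j with
    | zero => simp [hzero]
    | succ j ih =>
      rw [Function.iterate_succ_apply', ih, D.leibniz, D.map_natCast, smul_zero, add_zero,
        smul_eq_mul, hcoeff, Nat.factorial_succ]
      push_cast
      ring
  refine ⟨D, fun a => ⟨(Φ a).natDegree + 1, ?_, fun s => ?_⟩⟩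
  · rw [hiter, coeff_eq_zero_of_natDegree_lt (Nat.lt_succ_self _), mul_zero]
  · rw [hΦ, eval_eq_sum_range]
    refine Finset.sum_congr rfl fun j _ => ?_
    have hj : (j.factorial : K) ≠ 0 := by exact_mod_cast j.factorial_ne_zero
    rw [hiter, Algebra.smul_def (s ^ j), map_pow, mul_comm]
    congr 1
    rw [Algebra.smul_def, ← mul_assoc, ← map_natCast (algebraMap K A), ← map_mul,
      inv_mul_cancel₀ hj, map_one, one_mul]

/-- Leibniz' rule for divided powers of a derivation. -/
theorem dividedPow_mul (D : Derivation K A A) (n : ℕ) (a b : A) :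
    ((n.factorial : K)⁻¹ • D^[n] (a * b)) = ∑ p ∈ Finset.HasAntidiagonal.antidiagonal n,
      ((p.1.factorial : K)⁻¹ • D^[p.1] a) * ((p.2.factorial : K)⁻¹ • D^[p.2] b) := by
  have h : D^[n] (a * b) = ∑ p ∈ Finset.HasAntidiagonal.antidiagonal n,
      (n.choose p.1 : K) • (D^[p.1] a * D^[p.2] b) := by
    induction n with
    | zero => simp
    | succ n ih =>
      rw [Function.iterate_succ_apply', ih, map_sum]
      simp only [D.map_smul, D.leibniz, smul_eq_mul, ← Function.iterate_succ_apply' (⇑D)]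
      have h1 := Finset.sum_antidiagonal_choose_succ_nsmul (M := A)
        (fun i j => D^[i] a * D^[j] b) n
      simp only [← Nat.cast_smul_eq_nsmul K] at h1
      rw [h1, ← Finset.sum_add_distrib]
      refine Finset.sum_congr rfl fun p hp => ?_
      have h2 : n.choose p.2 = n.choose p.1 :=
        (Nat.choose_symm_of_eq_add (Finset.HasAntidiagonal.mem_antidiagonal.1 hp).symm).symm
      rw [h2, ← smul_add, mul_comm (D^[p.2] b)]
  rw [h, Finset.smul_sum]
  refine Finset.sum_congr rfl fun p hp => ?_
  rw [smul_mul_smul_comm, smul_smul]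
  congr 1
  obtain rfl := Finset.HasAntidiagonal.mem_antidiagonal.1 hp
  rw [Nat.choose_symm_add, Nat.add_choose,
    Nat.cast_div (Nat.factorial_mul_factorial_dvd_factorial_add _ _)
    (by exact_mod_cast mul_ne_zero p.1.factorial_ne_zero p.2.factorial_ne_zero)]
  have := (p.1 + p.2).factorial_ne_zero
  have h3 : ((p.1 + p.2).factorial : K) ≠ 0 := by exact_mod_cast this
  push_cast
  field_simp

/-- Every locally nilpotent derivation can be exponentiated. -/
theorem exists_isExponential_of_locallyNilpotent (D : Derivation K A A)
    (hD : ∀ a, ∃ N, D^[N] a = 0) :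
    ∃ φ : Multiplicative K →* (A ≃ₐ[K] A), IsExponential D φ := by
  choose N hN using hD
  let E : K → A → A := fun s a =>
    ∑ i ∈ Finset.range (N a), s ^ i • ((i.factorial : K)⁻¹ • D^[i] a)
  have hE : ∀ s a n, D^[n] a = 0 →
      E s a = ∑ i ∈ Finset.range n, s ^ i • ((i.factorial : K)⁻¹ • D^[i] a) := by
    intro s a n hn
    rcases le_total n (N a) with h | h
    · exact sum_exp_eq h hn s
    · exact (sum_exp_eq h (hN a) s).symm
  have hiter_add : ∀ n a b, D^[n] (a + b) = D^[n] a + D^[n] b := fun n a b =>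
    iterate_map_add D n a b
  have hadd : ∀ s a b, E s (a + b) = E s a + E s b := by
    intro s a b
    have ha := iterate_eq_zero_of_le (le_max_left (N a) (N b)) (hN a)
    have hb := iterate_eq_zero_of_le (le_max_right (N a) (N b)) (hN b)
    rw [hE s a _ ha, hE s b _ hb, hE s (a + b) (max (N a) (N b)) (by
      rw [hiter_add, ha, hb, add_zero]), ← Finset.sum_add_distrib]
    simp only [hiter_add, smul_add]
  have hsmul : ∀ s (r : K) a, E s (r • a) = r • E s a := by
    intro s r a
    rw [hE s (r • a) (N a) (by rw [iterate_derivation_smul, hN, smul_zero]), Finset.smul_sum]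
    refine Finset.sum_congr rfl fun i _ => ?_
    rw [iterate_derivation_smul, smul_comm _ r, smul_comm _ r]
  have hzero : ∀ a, E 0 a = a := by
    intro a
    rw [hE 0 a (N a + 1) (iterate_eq_zero_of_le (Nat.le_succ _) (hN a)), Finset.sum_range_succ',
      Finset.sum_eq_zero]
    · simp
    · intro i _
      simp
  have hone : ∀ s, E s 1 = 1 := by
    intro s
    rw [hE s 1 1 (by simp)]
    simp
  have hmul : ∀ s a b, E s (a * b) = E s a * E s b := by
    intro s a b
    -- the polynomials whose coefficients are the divided powers of `D`
    let P : A → A[X] := fun a =>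
      ∑ i ∈ Finset.range (N a), monomial i ((i.factorial : K)⁻¹ • D^[i] a)
    have hP : ∀ a i, (P a).coeff i = (i.factorial : K)⁻¹ • D^[i] a := by
      intro a i
      simp only [P, finsetSum_coeff, coeff_monomial]
      rw [Finset.sum_ite_eq' (Finset.range (N a)) i fun i => (i.factorial : K)⁻¹ • D^[i] a]
      split_ifs with h
      · rfl
      · rw [iterate_eq_zero_of_le (not_lt.1 fun h' => h (Finset.mem_range.2 h')) (hN a),
          smul_zero]
    have hev : ∀ a, (P a).eval (algebraMap K A s) = E s a := by
      intro a
      rw [eval_finsetSum]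
      refine Finset.sum_congr rfl fun i _ => ?_
      rw [eval_monomial, ← map_pow, mul_comm, ← Algebra.smul_def]
    have hPmul : P (a * b) = P a * P b := by
      ext n
      rw [hP, coeff_mul, dividedPow_mul]
      simp only [hP]
    rw [← hev, hPmul, eval_mul, hev, hev]
  have hcomp : ∀ s t a, E s (E t a) = E (s + t) a := by
    intro s t a
    have h1 : ∀ i, D^[i] (E t a) =
        ∑ j ∈ Finset.range (N a), t ^ j • ((j.factorial : K)⁻¹ • D^[i + j] a) := by
      intro i
      change D^[i] (∑ j ∈ Finset.range (N a), t ^ j • ((j.factorial : K)⁻¹ • D^[j] a)) = _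
      have : ∀ (F : Finset ℕ) (f : ℕ → A), D^[i] (∑ j ∈ F, f j) = ∑ j ∈ F, D^[i] (f j) := by
        intro F f
        induction F using Finset.cons_induction with
        | empty => simp
        | cons x F hx ih => rw [Finset.sum_cons, Finset.sum_cons, hiter_add, ih]
      rw [this]
      refine Finset.sum_congr rfl fun j _ => ?_
      rw [iterate_derivation_smul, iterate_derivation_smul, Function.iterate_add_apply]
    have h2 : D^[N a] (E t a) = 0 := by
      rw [h1]
      refine Finset.sum_eq_zero fun j _ => ?_
      rw [iterate_eq_zero_of_le (Nat.le_add_right _ _) (hN a), smul_zero, smul_zero]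
    rw [hE s (E t a) _ h2]
    have h3 : ∀ i ∈ Finset.range (N a), s ^ i • ((i.factorial : K)⁻¹ • D^[i] (E t a)) =
        ∑ j ∈ Finset.range (N a - i), (s ^ i * (i.factorial : K)⁻¹ * (t ^ j *
          (j.factorial : K)⁻¹)) • D^[i + j] a := by
      intro i _
      rw [h1, Finset.smul_sum, Finset.smul_sum]
      symm
      refine Finset.sum_subset_zero_on_sdiff (Finset.range_mono (Nat.sub_le _ _)) ?_ ?_
      · intro j hj
        rw [Finset.mem_sdiff, Finset.mem_range, Finset.mem_range] at hj
        rw [iterate_eq_zero_of_le (by omega : N a ≤ i + j) (hN a)]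
        simp
      · intro j _
        simp only [smul_smul]
        congr 1
        ring
    rw [Finset.sum_congr rfl h3, ← Finset.sum_range_diag_flip (N a) (fun i j =>
      (s ^ i * (i.factorial : K)⁻¹ * (t ^ j * (j.factorial : K)⁻¹)) • D^[i + j] a)]
    refine Finset.sum_congr rfl fun m _ => ?_
    have h4 : ∀ k ∈ Finset.range (m + 1), (s ^ k * (k.factorial : K)⁻¹ * (t ^ (m - k) *
        ((m - k).factorial : K)⁻¹)) • D^[k + (m - k)] a =
        (s ^ k * t ^ (m - k) * (m.choose k : K) * (m.factorial : K)⁻¹) • D^[m] a := by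
      intro k hk
      have hkm : k ≤ m := Nat.lt_succ_iff.1 (Finset.mem_range.1 hk)
      rw [Nat.add_sub_cancel' hkm]
      congr 1
      rw [Nat.cast_choose K hkm]
      have h5 : (m.factorial : K) ≠ 0 := by exact_mod_cast m.factorial_ne_zero
      have h6 : (k.factorial : K) ≠ 0 := by exact_mod_cast k.factorial_ne_zero
      have h7 : ((m - k).factorial : K) ≠ 0 := by exact_mod_cast (m - k).factorial_ne_zero
      field_simp
    rw [Finset.sum_congr rfl h4, ← Finset.sum_smul, ← Finset.sum_mul, ← add_pow, smul_smul]
  let e : K → (A ≃ₐ[K] A) := fun s =>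
    AlgEquiv.ofAlgHom
      (AlgHom.ofLinearMap ⟨⟨E s, hadd s⟩, hsmul s⟩ (hone s) (hmul s))
      (AlgHom.ofLinearMap ⟨⟨E (-s), hadd (-s)⟩, hsmul (-s)⟩ (hone (-s)) (hmul (-s)))
      (by ext a; change E s (E (-s) a) = a; rw [hcomp, add_neg_cancel, hzero])
      (by ext a; change E (-s) (E s a) = a; rw [hcomp, neg_add_cancel, hzero])
  refine ⟨{ toFun := fun s => e s.toAdd, map_one' := ?_, map_mul' := ?_ }, fun a =>
    ⟨N a, hN a, fun s => rfl⟩⟩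
  · ext a; exact hzero a
  · intro s t
    ext a
    exact (hcomp s.toAdd t.toAdd a).symm

namespace IsExponential

variable {D : Derivation K A A} {φ : Multiplicative K →* (A ≃ₐ[K] A)}

omit [CharZero K] in
theorem isRegularAction (h : IsExponential D φ) : IsRegularAction (regularFunctionsGa K) φ := by
  intro a
  obtain ⟨N, -, hφ⟩ := h a
  refine ⟨N, fun i s => s.toAdd ^ (i : ℕ), fun i => ((i : ℕ).factorial : K)⁻¹ • D^[i] a,
    fun i => ?_, fun s => ?_⟩
  · have h1 : (fun s : Multiplicative K => s.toAdd) ∈ regularFunctionsGa K :=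
      Algebra.subset_adjoin (Set.mem_singleton _)
    exact pow_mem h1 (i : ℕ)
  · rw [← ofAdd_toAdd s, hφ, Finset.sum_range]
    rfl

omit [CharZero K] in
theorem unique (h : IsExponential D φ) {ψ : Multiplicative K →* (A ≃ₐ[K] A)}
    (h' : IsExponential D ψ) : φ = ψ := by
  refine MonoidHom.ext fun s => AlgEquiv.ext fun a => ?_
  obtain ⟨N, hN⟩ := h.exists_le a
  obtain ⟨N', hN'⟩ := h'.exists_le a
  rw [← ofAdd_toAdd s, (hN _ (le_max_left N N')).2, (hN' _ (le_max_right N N')).2]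

/-- A subspace stable under the `𝔾_a`-action is stable under the derivation. -/
theorem apply_mem (h : IsExponential D φ) {W : Submodule K A} {a : A}
    (hW : ∀ s : K, φ (Multiplicative.ofAdd s) a ∈ W) : D a ∈ W := by
  obtain ⟨N, hN⟩ := h.exists_le a
  have h1 := (hN (N + 2) (by omega)).2
  have h2 : ∀ s : K, ∑ i ∈ Finset.range (N + 2),
      s ^ i • W.mkQ ((i.factorial : K)⁻¹ • D^[i] a) = 0 := by
    intro s
    have := (Submodule.Quotient.mk_eq_zero W).2 (hW s)
    rw [← Submodule.mkQ_apply, h1, map_sum] at this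
    simpa only [map_smul] using this
  have h3 := eq_zero_of_sum_pow_smul_eq_zero h2 (show 1 < N + 2 by omega)
  rw [Submodule.mkQ_apply, Submodule.Quotient.mk_eq_zero] at h3
  simpa using h3

theorem apply_eq_zero_iff (h : IsExponential D φ) {a : A} :
    D a = 0 ↔ ∀ s : K, φ (Multiplicative.ofAdd s) a = a := by
  constructor
  · intro ha s
    obtain ⟨N, hN⟩ := h.exists_le a
    rw [(hN (N + 1) (by omega)).2, Finset.sum_range_succ', Finset.sum_eq_zero]
    · simp
    · intro i _
      rw [Function.iterate_succ_apply, ha, iterate_map_zero D i, smul_zero, smul_zero]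
  · intro ha
    obtain ⟨N, hN⟩ := h.exists_le a
    have h1 := (hN (N + 2) (by omega)).2
    have h2 : ∀ s : K, ∑ i ∈ Finset.range (N + 2),
        s ^ i • (((i.factorial : K)⁻¹ • D^[i] a) - if i = 0 then a else 0) = 0 := by
      intro s
      simp only [smul_sub, Finset.sum_sub_distrib, ← h1, ha]
      rw [Finset.sum_eq_single 0] <;> simp +contextual
    have h3 := eq_zero_of_sum_pow_smul_eq_zero h2 (show 1 < N + 2 by omega)
    simpa using h3

theorem eq_one_iff (h : IsExponential D φ) : φ = 1 ↔ D = 0 := by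
  constructor
  · rintro rfl
    ext a
    exact h.apply_eq_zero_iff.2 fun s => rfl
  · rintro rfl
    refine MonoidHom.ext fun s => AlgEquiv.ext fun a => ?_
    exact (h.apply_eq_zero_iff (a := a)).1 rfl s.toAdd

/-- Conjugation by `g` rescales the action by `c` if and only if it rescales the derivation. -/
theorem semiconj_iff (h : IsExponential D φ) (g : A ≃ₐ[K] A) (c : K) :
    (∀ s : K, g * φ (Multiplicative.ofAdd s) * g⁻¹ = φ (Multiplicative.ofAdd (c * s))) ↔
      ∀ a, g (D a) = c • D (g a) := by
  constructor
  · intro hg a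
    obtain ⟨N, hN⟩ := h.exists_le a
    obtain ⟨N', hN'⟩ := h.exists_le (g a)
    have h1 := (hN (N + N' + 2) (by omega)).2
    have h2 := (hN' (N + N' + 2) (by omega)).2
    have h3 : ∀ s : K, ∑ i ∈ Finset.range (N + N' + 2),
        s ^ i • (g ((i.factorial : K)⁻¹ • D^[i] a) -
          c ^ i • ((i.factorial : K)⁻¹ • D^[i] (g a))) = 0 := by
      intro s
      have h4 : g (φ (Multiplicative.ofAdd s) a) = φ (Multiplicative.ofAdd (c * s)) (g a) := by
        rw [← hg s]
        simp
      rw [h1, h2, map_sum] at h4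
      simp only [smul_sub, Finset.sum_sub_distrib, smul_smul] at h4 ⊢
      rw [sub_eq_zero]
      convert h4 using 2
      · rw [← map_smul, smul_smul]
      · rw [mul_pow, ← mul_assoc, mul_comm (c ^ _)]
    have h5 := eq_zero_of_sum_pow_smul_eq_zero h3 (show 1 < N + N' + 2 by omega)
    simpa [sub_eq_zero] using h5
  · intro hg s
    have hit : ∀ i a, g (D^[i] a) = c ^ i • D^[i] (g a) := by
      intro i a
      induction i with
      | zero => simp
      | succ i ih =>
        rw [Function.iterate_succ_apply', hg, ih, D.map_smul, smul_smul, ← pow_succ',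
          Function.iterate_succ_apply']
    ext a
    obtain ⟨N, hN⟩ := h.exists_le (g⁻¹ a)
    obtain ⟨N', hN'⟩ := h.exists_le a
    rw [AlgEquiv.mul_apply, AlgEquiv.mul_apply, (hN _ (le_max_left N N')).2,
      (hN' _ (le_max_right N N')).2, map_sum]
    refine Finset.sum_congr rfl fun i _ => ?_
    rw [map_smul, map_smul, hit, ← AlgEquiv.mul_apply, mul_inv_cancel, AlgEquiv.one_apply,
      mul_pow, mul_comm (c ^ i), mul_smul, smul_comm (c ^ i)]

omit [CharZero K] in
theorem smul (h : IsExponential D φ) (c : K) {ψ : Multiplicative K →* (A ≃ₐ[K] A)}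
    (hψ : ∀ s : K, ψ (Multiplicative.ofAdd s) = φ (Multiplicative.ofAdd (c * s))) :
    IsExponential (c • D) ψ := by
  have hit : ∀ i a, (c • D)^[i] a = c ^ i • D^[i] a := by
    intro i a
    induction i with
    | zero => simp
    | succ i ih =>
      rw [Function.iterate_succ_apply', ih, Derivation.smul_apply, D.map_smul, smul_smul,
        ← pow_succ', Function.iterate_succ_apply']
  intro a
  obtain ⟨N, hN, hφ⟩ := h a
  refine ⟨N, by rw [hit, hN, smul_zero], fun s => ?_⟩
  rw [hψ, hφ]
  refine Finset.sum_congr rfl fun i _ => ?_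
  rw [hit, mul_pow, mul_comm, mul_smul, smul_comm (c ^ i)]

omit [CharZero K] in
/-- The subgroup of a `𝔾_a`-action only depends on its derivation up to scaling. -/
theorem range_eq_of_smul (h : IsExponential D φ) {c : K} (hc : c ≠ 0)
    {ψ : Multiplicative K →* (A ≃ₐ[K] A)} (h' : IsExponential (c • D) ψ) :
    φ.range = ψ.range := by
  let m : K → (Multiplicative K →* Multiplicative K) := fun c =>
    AddMonoidHom.toMultiplicative (AddMonoidHom.mulLeft c)
  have h1 : ψ = φ.comp (m c) := h'.unique (h.smul c fun s => rfl)
  rw [h1]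
  ext g
  constructor
  · rintro ⟨s, rfl⟩
    refine ⟨Multiplicative.ofAdd (c⁻¹ * s.toAdd), ?_⟩
    change φ (Multiplicative.ofAdd (c * (c⁻¹ * s.toAdd))) = φ s
    rw [mul_inv_cancel_left₀ hc]
    rfl
  · rintro ⟨s, rfl⟩
    exact ⟨_, rfl⟩

end IsExponential

/-- Two parametrizations of the same `𝔾_a`-subgroup differ by a rescaling. Evaluated at a function
on which the first action is affine but not constant, the second one gives a polynomial expression
for the change of parameter, and an additive polynomial is linear in characteristic zero. -/
theorem IsGaParametrization.exists_eq_mul [IsDomain A] {H : Subgroup (A ≃ₐ[K] A)}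
    {φ ψ : Multiplicative K →* (A ≃ₐ[K] A)} (hφ : IsGaParametrization φ H)
    (hψ : IsGaParametrization ψ H) :
    ∃ c : K, c ≠ 0 ∧ ∀ s : K,
      ψ (Multiplicative.ofAdd s) = φ (Multiplicative.ofAdd (c * s)) := by
  obtain ⟨D, hD⟩ := exists_isExponential hφ.regular
  obtain ⟨D', hD'⟩ := exists_isExponential hψ.regular
  -- a function on which the first action is affine but not constant
  obtain ⟨a, ha, ha'⟩ : ∃ a, D a ≠ 0 ∧ D (D a) = 0 := by
    obtain ⟨b, hb⟩ : ∃ b, D b ≠ 0 := by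
      by_contra! h
      exact hφ.nontrivial (hD.eq_one_iff.2 (Derivation.ext h))
    have hex : ∃ N, D^[N] b = 0 := (hD b).imp fun _ h => h.1
    classical
    have h1 := Nat.find_spec hex
    have h2 : 2 ≤ Nat.find hex := by
      by_contra! h
      interval_cases hN : Nat.find hex
      · exact hb (by rw [show b = 0 from h1, map_zero])
      · exact hb h1
    obtain ⟨k, hk⟩ := Nat.exists_eq_add_of_le' h2
    rw [hk, Function.iterate_succ_apply', Function.iterate_succ_apply'] at h1
    refine ⟨D^[k] b, ?_, h1⟩
    rw [← Function.iterate_succ_apply' (⇑D)]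
    exact Nat.find_min hex (by omega)
  have haff : ∀ s : K, φ (Multiplicative.ofAdd s) a = a + s • D a := by
    intro s
    obtain ⟨N, hN⟩ := hD.exists_le a
    rw [(hN (N + 2) (by omega)).2, sum_exp_eq (N := 2) (by omega) ha', Finset.sum_range_succ,
      Finset.sum_range_one]
    simp
  have hσ : ∀ s : K, ∃ t : K, φ (Multiplicative.ofAdd t) = ψ (Multiplicative.ofAdd s) := by
    intro s
    have h1 : ψ (Multiplicative.ofAdd s) ∈ φ.range := by
      rw [hφ.range_eq, ← hψ.range_eq]
      exact ⟨_, rfl⟩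
    obtain ⟨t, ht⟩ := h1
    exact ⟨t.toAdd, ht⟩
  choose σ hσ using hσ
  have hinj : ∀ s t : K, a + s • D a = a + t • D a → s = t := fun s t h =>
    smul_left_injective K ha (add_left_cancel h)
  have hval : ∀ s : K, ψ (Multiplicative.ofAdd s) a = a + σ s • D a := fun s => by
    rw [← hσ, haff]
  have hnat : ∀ n : ℕ, σ n = n * σ 1 := by
    intro n
    apply hinj
    rw [← hval, ← haff]
    have h1 : Multiplicative.ofAdd (n : K) = Multiplicative.ofAdd (1 : K) ^ n := by
      rw [← ofAdd_nsmul, nsmul_one]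
    rw [h1, map_pow, ← hσ, ← map_pow, ← ofAdd_nsmul, nsmul_eq_mul]
  obtain ⟨l, hl⟩ : ∃ l : Module.Dual K A, l (D a) = 1 := by
    obtain ⟨l, hl⟩ := not_forall.1 (mt (Module.forall_dual_apply_eq_zero_iff K (D a)).1 ha)
    exact ⟨(l (D a))⁻¹ • l, by simp [inv_mul_cancel₀ hl]⟩
  obtain ⟨p, hp⟩ : ∃ p : K[X], ∀ s, σ s = p.eval s := by
    obtain ⟨N, -, hN⟩ := hD' a
    refine ⟨(∑ i ∈ Finset.range N, C (l ((i.factorial : K)⁻¹ • D'^[i] a)) * X ^ i) - C (l a),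
      fun s => ?_⟩
    have h1 := congrArg l ((hval s).symm.trans (hN s))
    rw [map_add, map_smul, hl, map_sum] at h1
    rw [eval_sub, eval_C, eval_finsetSum, eq_sub_iff_add_eq]
    simp only [smul_eq_mul, mul_one] at h1
    rw [add_comm, h1]
    refine Finset.sum_congr rfl fun i _ => ?_
    rw [map_smul, smul_eq_mul, eval_mul, eval_C, eval_pow, eval_X, mul_comm]
  have hlin : p = C (σ 1) * X := by
    refine eq_of_infinite_eval_eq _ _ ((Set.infinite_range_of_injective
      (Nat.cast_injective (R := K))).mono ?_)
    rintro _ ⟨n, rfl⟩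
    rw [Set.mem_ofPred_eq, ← hp, hnat, eval_mul, eval_C, eval_X, mul_comm]
  have hσ1 : ∀ s, σ s = σ 1 * s := fun s => by rw [hp, hlin]; simp
  refine ⟨σ 1, fun h0 => hψ.nontrivial ?_, fun s => by rw [← hσ1, hσ]⟩
  refine MonoidHom.ext fun s => AlgEquiv.ext fun b => ?_
  rw [← ofAdd_toAdd s, ← hσ, hσ1, h0, zero_mul, ofAdd_zero, map_one]
  rfl

end Additive

/-! ### The weight decomposition of the coordinate algebra -/

section Weights

variable {K : Type*} [Field K] {n : ℕ}

theorem entry_mul_of_mem_borel {b b' : GroupG K n} (hb' : b' ∈ borelSubgroup K n) :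
    (b * b').1 0 0 = b.1 0 0 * b'.1 0 0 := by
  have h : b'.1 1 0 = 0 := hb'
  simp [Matrix.mul_apply, Fin.sum_univ_two, h]

theorem entry_ne_zero_of_mem_borel {b : GroupG K n} (hb : b ∈ borelSubgroup K n) :
    b.1 0 0 ≠ 0 := by
  have h : b.1 1 0 = 0 := hb
  intro h0
  have := b.1.det_coe
  rw [Matrix.det_fin_two, h, h0] at this
  simp at this

theorem torus_le_borel : torus K n ≤ borelSubgroup K n := fun _ h => h.2

theorem charEval_mul {b b' : GroupG K n} (hb' : b' ∈ borelSubgroup K n) (e : CharLattice n) :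
    charEval e (b * b') = charEval e b * charEval e b' := by
  simp only [charEval, entry_mul_of_mem_borel hb', mul_zpow, Prod.snd_mul, Pi.mul_apply,
    Units.val_mul, Finset.prod_mul_distrib]
  ring

theorem charEval_one (e : CharLattice n) : charEval e (1 : GroupG K n) = 1 := by
  simp [charEval]

theorem charEval_ne_zero {b : GroupG K n} (hb : b ∈ borelSubgroup K n) (e : CharLattice n) :
    charEval e b ≠ 0 :=
  mul_ne_zero (zpow_ne_zero _ (entry_ne_zero_of_mem_borel hb))
    (Finset.prod_ne_zero_iff.2 fun i _ => zpow_ne_zero _ (b.2 i).ne_zero)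

theorem charEval_add {b : GroupG K n} (hb : b ∈ borelSubgroup K n) (e e' : CharLattice n) :
    charEval (e + e') b = charEval e b * charEval e' b := by
  simp only [charEval, Prod.fst_add, Prod.snd_add, Pi.add_apply,
    zpow_add₀ (entry_ne_zero_of_mem_borel hb), zpow_add₀ (Units.ne_zero _),
    Finset.prod_mul_distrib]
  ring

theorem charEval_zero (b : GroupG K n) : charEval 0 b = 1 := by
  simp [charEval]

/-- The element of `SL₂` with the given entries. -/
def slMk (a b c d : K) (h : a * d - b * c = 1) : Matrix.SpecialLinearGroup (Fin 2) K :=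
  ⟨!![a, b; c, d], by rw [Matrix.det_fin_two_of, h]⟩

@[simp]
theorem coe_slMk (a b c d : K) (h : a * d - b * c = 1) :
    (slMk a b c d h : Matrix (Fin 2) (Fin 2) K) = !![a, b; c, d] := rfl

/-- The element `diag(s, s⁻¹)` of `T₁` together with an element of `T'`. -/
def torusMk (s : Kˣ) (t : Fin n → Kˣ) : GroupG K n :=
  (slMk (s : K) 0 0 ((s⁻¹ : Kˣ) : K) (by simp), t)

theorem torusMk_mem (s : Kˣ) (t : Fin n → Kˣ) : torusMk s t ∈ torus K n := by
  constructor <;> simp [torusMk]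

theorem charEval_torusMk (e : CharLattice n) (s : Kˣ) (t : Fin n → Kˣ) :
    charEval e (torusMk s t) = (s : K) ^ e.1 * ∏ i, ((t i : K)) ^ (e.2 i) := by
  simp [charEval, torusMk]

/-- The character of `T` given by `e`. -/
def torusChar (e : CharLattice n) : torus K n →* K where
  toFun t := charEval e (t : GroupG K n)
  map_one' := charEval_one e
  map_mul' _ b := charEval_mul (torus_le_borel b.2) e

theorem two_zpow_injective [CharZero K] {a b : ℤ} (h : (2 : K) ^ a = 2 ^ b) : a = b := by
  have h1 : ((2 : ℚ) ^ a : ℚ) = (2 : ℚ) ^ b := by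
    have : (((2 : ℚ) ^ a : ℚ) : K) = (((2 : ℚ) ^ b : ℚ) : K) := by push_cast; exact h
    exact_mod_cast this
  exact zpow_right_injective₀ (by norm_num) (by norm_num) h1

theorem charEval_injective [CharZero K] {e e' : CharLattice n}
    (h : ∀ t ∈ torus K n, charEval e t = charEval (K := K) e' t) : e = e' := by
  refine Prod.ext ?_ (funext fun i => ?_)
  · have := h _ (torusMk_mem (Units.mk0 2 two_ne_zero) 1)
    simp only [charEval_torusMk, Units.val_mk0, Pi.one_apply, Units.val_one, one_zpow,
      Finset.prod_const_one, mul_one] at this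
    exact two_zpow_injective this
  · have := h _ (torusMk_mem 1 (Pi.mulSingle i (Units.mk0 2 two_ne_zero)))
    simp only [charEval_torusMk, Units.val_one, one_zpow, one_mul] at this
    rw [Finset.prod_eq_single i, Finset.prod_eq_single i] at this
    · rw [Pi.mulSingle_eq_same, Units.val_mk0] at this
      exact two_zpow_injective this
    all_goals simp +contextual [Pi.mulSingle_eq_of_ne]

theorem torusChar_injective [CharZero K] :
    Function.Injective (torusChar : CharLattice n → (torus K n →* K)) := by
  intro e e' h
  exact charEval_injective fun t ht => DFunLike.congr_fun h (⟨t, ht⟩ : torus K n)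

/-- The linear independence of characters, with coefficients in a vector space. -/
theorem eq_zero_of_sum_charEval_smul_eq_zero [CharZero K] {E : Type*} [AddCommGroup E]
    [Module K E] {F : Finset (CharLattice n)} {x : CharLattice n → E}
    (h : ∀ t ∈ torus K n, ∑ m ∈ F, charEval m t • x m = 0) {m : CharLattice n} (hm : m ∈ F) :
    x m = 0 := by
  rw [← Module.forall_dual_apply_eq_zero_iff K]
  intro l
  have h1 := (linearIndependent_monoidHom (torus K n) K).comp _ (torusChar_injective (K := K))
  refine linearIndependent_iff'.1 h1 F (fun m => l (x m)) ?_ m hm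
  ext t
  have := congrArg l (h t t.2)
  rw [map_sum, map_zero] at this
  rw [Finset.sum_apply, Pi.zero_apply, ← this]
  refine Finset.sum_congr rfl fun m _ => ?_
  rw [map_smul, smul_eq_mul, mul_comm]
  rfl

/-- On the torus, regular functions are linear combinations of characters. -/
theorem exists_sum_charEval {c : GroupG K n → K} (hc : c ∈ regularFunctions K n) :
    ∃ F : CharLattice n →₀ K, ∀ t ∈ torus K n, c t = ∑ m ∈ F.support, F m * charEval m t := by
  let X : Set (torus K n → K) := Set.range fun (e : CharLattice n) t => torusChar e t
  have hX : ∀ e : CharLattice n, (fun t : torus K n => charEval e (t : GroupG K n)) ∈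
      Algebra.adjoin K X := fun e => Algebra.subset_adjoin ⟨e, rfl⟩
  have h1 : (fun t : torus K n => c t) ∈ Algebra.adjoin K X := by
    induction hc using Algebra.adjoin_induction with
    | mem f hf =>
      rcases hf with (⟨i, j, rfl⟩ | ⟨i, rfl⟩) | ⟨i, rfl⟩
      · fin_cases i <;> fin_cases j
        · convert hX (1, 0) using 2
          simp [charEval]
        · convert zero_mem (Algebra.adjoin K X) using 2 with t
          exact t.2.1
        · convert zero_mem (Algebra.adjoin K X) using 2 with t
          exact t.2.2
        · convert hX (-1, 0) using 2 with t
          have h2 := t.1.1.det_coe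
          have h3 : t.1.1 0 1 = 0 := t.2.1
          rw [Matrix.det_fin_two, h3, zero_mul, sub_zero] at h2
          simpa [charEval] using (eq_inv_of_mul_eq_one_right h2)
      · convert hX (0, Pi.single i 1) using 2 with t
        rw [charEval, Finset.prod_eq_single i]
        all_goals simp +contextual
      · convert hX (0, Pi.single i (-1)) using 2 with t
        rw [charEval, Finset.prod_eq_single i]
        all_goals simp +contextual
    | algebraMap r => exact Subalgebra.algebraMap_mem _ r
    | add f g _ _ hf hg => exact add_mem hf hg
    | mul f g _ _ hf hg => exact mul_mem hf hg
  have h2 : (fun t : torus K n => c t) ∈ Submodule.span K X := by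
    rw [← Subalgebra.mem_toSubmodule, Algebra.adjoin_eq_span] at h1
    refine Submodule.span_mono (fun f hf => ?_) h1
    induction hf using Submonoid.closure_induction with
    | mem f hf => exact hf
    | one => exact ⟨0, funext fun t => charEval_zero _⟩
    | mul f g _ _ hf hg =>
      obtain ⟨e, rfl⟩ := hf
      obtain ⟨e', rfl⟩ := hg
      exact ⟨e + e', funext fun t => charEval_add (torus_le_borel t.2) e e'⟩
  obtain ⟨F, hF⟩ := (Finsupp.mem_span_range_iff_exists_finsupp).1 h2
  refine ⟨F, fun t ht => ?_⟩
  have := congrFun hF ⟨t, ht⟩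
  rw [← this, Finsupp.sum, Finset.sum_apply]
  rfl

variable {A : Type*} [CommRing A] [Algebra K A]

/-- The space of `T`-semi-invariant functions of weight `m`. -/
def weightSpace (act : GroupG K n →* (A ≃ₐ[K] A)) (m : CharLattice n) : Submodule K A where
  carrier := {f | ∀ t ∈ torus K n, act t f = charEval m t • f}
  add_mem' ha hb t ht := by rw [map_add, ha t ht, hb t ht, smul_add]
  zero_mem' t _ := by simp
  smul_mem' c a ha t ht := by rw [map_smul, ha t ht, smul_comm]

theorem mul_mem_weightSpace {act : GroupG K n →* (A ≃ₐ[K] A)} {m m' : CharLattice n} {f g : A}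
    (hf : f ∈ weightSpace act m) (hg : g ∈ weightSpace act m') :
    f * g ∈ weightSpace act (m + m') := by
  intro t ht
  rw [map_mul, hf t ht, hg t ht, charEval_add (torus_le_borel ht), smul_mul_smul_comm]

theorem one_mem_weightSpace (act : GroupG K n →* (A ≃ₐ[K] A)) : 1 ∈ weightSpace act 0 := by
  intro t _
  rw [map_one, charEval_zero, one_smul]

/-- Every regular function is a sum of `T`-semi-invariants. -/
theorem exists_sum_weightSpace [CharZero K] {act : GroupG K n →* (A ≃ₐ[K] A)}
    (hG : IsGVariety act) (f : A) :
    ∃ (F : Finset (CharLattice n)) (g : CharLattice n → A),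
      (∀ m ∈ F, g m ∈ weightSpace act m) ∧ f = ∑ m ∈ F, g m := by
  classical
  obtain ⟨r, c, b, hc, hact⟩ := hG f
  choose P hP using fun i => exists_sum_charEval (hc i)
  let F : Finset (CharLattice n) := Finset.univ.biUnion fun i => (P i).support
  let g : CharLattice n → A := fun m => ∑ i, P i m • b i
  have h1 : ∀ t ∈ torus K n, act t f = ∑ m ∈ F, charEval m t • g m := by
    intro t ht
    rw [hact]
    simp only [g, Finset.smul_sum]
    rw [Finset.sum_comm]
    refine Finset.sum_congr rfl fun i _ => ?_
    rw [hP i t ht, Finset.sum_smul]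
    have hsub : (P i).support ⊆ F :=
      Finset.subset_biUnion_of_mem (fun i => (P i).support) (Finset.mem_univ i)
    rw [Finset.sum_subset hsub]
    · exact Finset.sum_congr rfl fun m _ => by rw [smul_smul, mul_comm]
    · intro m _ hm
      rw [Finsupp.notMem_support_iff.1 hm, zero_mul, zero_smul]
  refine ⟨F, g, fun m hm t' ht' => ?_, ?_⟩
  · have h2 : ∀ t ∈ torus K n,
        ∑ m ∈ F, charEval m t • (act t' (g m) - charEval m t' • g m) = 0 := by
      intro t ht
      have h3 : act t' (act t f) = act (t' * t) f := by rw [map_mul]; rfl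
      rw [h1 t ht, h1 _ (mul_mem ht' ht), map_sum] at h3
      simp only [smul_sub, Finset.sum_sub_distrib]
      rw [sub_eq_zero]
      convert h3 using 2 with m hm m hm
      · rw [map_smul]
      · rw [smul_smul, charEval_mul (torus_le_borel ht), mul_comm]
    exact sub_eq_zero.1 (eq_zero_of_sum_charEval_smul_eq_zero h2 hm)
  · have := h1 1 (one_mem _)
    simpa [charEval_one] using this

theorem eq_zero_of_sum_weightSpace [CharZero K] {act : GroupG K n →* (A ≃ₐ[K] A)}
    {F : Finset (CharLattice n)} {g : CharLattice n → A}
    (hg : ∀ m ∈ F, g m ∈ weightSpace act m) (h : ∑ m ∈ F, g m = 0) {m : CharLattice n}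
    (hm : m ∈ F) : g m = 0 := by
  refine eq_zero_of_sum_charEval_smul_eq_zero (K := K) (F := F) (fun t ht => ?_) hm
  have := congrArg (act t) h
  rw [map_sum, map_zero] at this
  rw [← this]
  exact Finset.sum_congr rfl fun m hm => (hg m hm t ht).symm

/-- A nonzero function on an affine variety has a point where it does not vanish. -/
theorem exists_algHom_ne_zero [IsAlgClosed K] [IsDomain A] [Algebra.FiniteType K A] {f : A}
    (hf : f ≠ 0) : ∃ x : A →ₐ[K] K, x f ≠ 0 := by
  have hnt : Nontrivial (Localization.Away f) :=
    (IsLocalization.injective (Localization.Away f)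
      (powers_le_nonZeroDivisors_of_noZeroDivisors hf)).nontrivial
  obtain ⟨m, hm⟩ := Ideal.exists_maximal (Localization.Away f)
  let _ := Ideal.Quotient.field m
  have hfin : Module.Finite K (Localization.Away f ⧸ m) :=
    finite_of_finite_type_of_isJacobsonRing K _
  have hbij : Function.Bijective (algebraMap K (Localization.Away f ⧸ m)) :=
    IsAlgClosed.algebraMap_bijective_of_isIntegral
  let e : K ≃ₐ[K] (Localization.Away f ⧸ m) :=
    AlgEquiv.ofBijective (Algebra.ofId K _) hbij
  let y : A →ₐ[K] (Localization.Away f ⧸ m) :=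
    (Ideal.Quotient.mkₐ K m).comp (IsScalarTower.toAlgHom K A (Localization.Away f))
  refine ⟨(e.symm : (Localization.Away f ⧸ m) →ₐ[K] K).comp y, ?_⟩
  have hu : IsUnit (y f) :=
    (IsLocalization.Away.algebraMap_isUnit (S := Localization.Away f) f).map
      (Ideal.Quotient.mkₐ K m)
  exact (hu.map (e.symm : (Localization.Away f ⧸ m) →ₐ[K] K)).ne_zero

/-- A semi-invariant vanishing at a point of the open `T`-orbit vanishes on the orbit, hence
everywhere. -/
theorem exists_point_of_hasOpenOrbit [IsAlgClosed K] [IsDomain A] [Algebra.FiniteType K A]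
    {act : GroupG K n →* (A ≃ₐ[K] A)} (htoric : HasOpenOrbit act (torus K n)) :
    ∃ x : A →ₐ[K] K, ∀ m, ∀ f ∈ weightSpace act m, x f = 0 → f = 0 := by
  obtain ⟨x, I, hI⟩ := htoric
  refine ⟨x, fun m f hf hxf => ?_⟩
  have hx : x ∈ {y | ∃ g ∈ torus K n, y = pointAct act g x} := by
    refine ⟨1, one_mem _, ?_⟩
    ext a
    simp [pointAct]
  rw [hI] at hx
  obtain ⟨h, hhI, hxh⟩ := hx
  -- `f` vanishes on the orbit and `h` vanishes outside of it
  have h1 : f * h = 0 := by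
    by_contra hne
    obtain ⟨y, hy⟩ := exists_algHom_ne_zero (K := K) hne
    rw [map_mul] at hy
    have hy' : y ∈ {x : A →ₐ[K] K | ∃ f ∈ I, x f ≠ 0} := ⟨h, hhI, right_ne_zero_of_mul hy⟩
    rw [← hI] at hy'
    obtain ⟨t, ht, rfl⟩ := hy'
    refine left_ne_zero_of_mul hy ?_
    change x (act t⁻¹ f) = 0
    rw [hf _ (inv_mem ht), map_smul, hxf, smul_zero]
  refine (mul_eq_zero.1 h1).resolve_right ?_
  rintro rfl
  exact hxh (map_zero x)

end Weights

/-! ### The weight monoid of a toric variety and homogeneous derivations -/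

section WeightBasis

/-- An additive function on a submonoid of a rational vector space extends to a linear
functional. -/
theorem exists_linear_extension {V : Type*} [AddCommGroup V] [Module ℚ V] (S : AddSubmonoid V)
    (f : V → ℚ) (hf : ∀ a ∈ S, ∀ b ∈ S, f (a + b) = f a + f b) :
    ∃ ρ : V →ₗ[ℚ] ℚ, ∀ a ∈ S, ρ a = f a := by
  have hdiff : ∀ g ∈ AddSubgroup.closure (S : Set V), ∃ a ∈ S, ∃ b ∈ S, g = a - b := by
    intro g hg
    induction hg using AddSubgroup.closure_induction with
    | mem x hx => exact ⟨x, hx, 0, S.zero_mem, by simp⟩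
    | zero => exact ⟨0, S.zero_mem, 0, S.zero_mem, by simp⟩
    | add x y _ _ hx hy =>
      obtain ⟨a, ha, b, hb, rfl⟩ := hx
      obtain ⟨c, hc, d, hd, rfl⟩ := hy
      exact ⟨a + c, S.add_mem ha hc, b + d, S.add_mem hb hd, by abel⟩
    | neg x _ hx =>
      obtain ⟨a, ha, b, hb, rfl⟩ := hx
      exact ⟨b, hb, a, ha, by abel⟩
  choose! p hp q hq hpq using hdiff
  have hwd : ∀ a ∈ S, ∀ b ∈ S, ∀ c ∈ S, ∀ d ∈ S, a - b = c - d → f a - f b = f c - f d := by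
    intro a ha b hb c hc d hd h
    have h1 : a + d = c + b := by
      rw [sub_eq_sub_iff_add_eq_add] at h; exact h
    have h2 := hf a ha d hd
    rw [h1, hf c hc b hb] at h2
    linarith
  let g : AddSubgroup.closure (S : Set V) →+ ℚ :=
    { toFun := fun x => f (p x) - f (q x)
      map_zero' := by
        have := hwd _ (hp 0 (zero_mem _)) _ (hq 0 (zero_mem _)) 0 S.zero_mem 0 S.zero_mem
          (by rw [← hpq 0 (zero_mem _), sub_zero])
        simpa using this
      map_add' := fun x y => by
        have := hwd _ (hp _ (x + y).2) _ (hq _ (x + y).2) _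
          (S.add_mem (hp _ x.2) (hp _ y.2)) _ (S.add_mem (hq _ x.2) (hq _ y.2)) (by
            rw [← hpq _ (x + y).2, add_sub_add_comm, ← hpq _ x.2, ← hpq _ y.2]; rfl)
        rw [hf _ (hp _ x.2) _ (hp _ y.2), hf _ (hq _ x.2) _ (hq _ y.2)] at this
        linarith }
  obtain ⟨h, hh⟩ := (Module.Baer.of_divisible ℚ).extension_property
    ((AddSubgroup.closure (S : Set V)).subtype.toIntLinearMap) Subtype.val_injective
    g.toIntLinearMap
  refine ⟨h.toAddMonoidHom.toRatLinearMap, fun a ha => ?_⟩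
  have ha' : a ∈ AddSubgroup.closure (S : Set V) := AddSubgroup.subset_closure ha
  have h1 := LinearMap.congr_fun hh ⟨a, ha'⟩
  change h a = f (p a) - f (q a) at h1
  change h a = f a
  have hf0 : f 0 = 0 := by simpa using hf 0 S.zero_mem 0 S.zero_mem
  rw [h1, hwd _ (hp a ha') _ (hq a ha') a ha 0 S.zero_mem (by rw [← hpq a ha', sub_zero]), hf0,
    sub_zero]

theorem toRat_add {n : ℕ} (m m' : CharLattice n) : toRat (m + m') = toRat m + toRat m' := by
  ext <;> simp [toRat]

theorem toRat_zero {n : ℕ} : toRat (0 : CharLattice n) = 0 := by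
  ext <;> simp [toRat]

theorem toRat_injective {n : ℕ} : Function.Injective (toRat : CharLattice n → RatCharSpace n) := by
  intro m m' h
  refine Prod.ext ?_ (funext fun i => ?_)
  · have h1 : ((m.1 : ℤ) : ℚ) = m'.1 := congrArg Prod.fst h
    exact_mod_cast h1
  · have h1 : ((m.2 i : ℤ) : ℚ) = m'.2 i := congrFun (congrArg Prod.snd h) i
    exact_mod_cast h1

/-- The inclusion of the character lattice into its rational span, as a homomorphism. -/
def toRatHom (n : ℕ) : CharLattice n →+ RatCharSpace n where
  toFun := toRat
  map_zero' := toRat_zero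
  map_add' := toRat_add

/-- The image in `𝔛(T)_ℚ` of a monoid of weights. -/
abbrev ratMonoid {n : ℕ} (S : AddSubmonoid (CharLattice n)) : AddSubmonoid (RatCharSpace n) :=
  S.map (toRatHom n)

theorem toRat_mem_ratMonoid {n : ℕ} {S : AddSubmonoid (CharLattice n)} {m : CharLattice n} :
    toRat m ∈ ratMonoid S ↔ m ∈ S :=
  ⟨fun ⟨_, hm, h⟩ => toRat_injective h ▸ hm, fun h => ⟨m, h, rfl⟩⟩

theorem coe_ratMonoid {n : ℕ} (S : AddSubmonoid (CharLattice n)) :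
    (ratMonoid S : Set (RatCharSpace n)) = toRat '' (S : Set (CharLattice n)) := rfl

theorem exists_toRat_of_mem_closure {n : ℕ} {S : AddSubmonoid (CharLattice n)}
    {v : RatCharSpace n} (hv : v ∈ AddSubgroup.closure (ratMonoid S : Set (RatCharSpace n))) :
    ∃ m ∈ AddSubgroup.closure (S : Set (CharLattice n)), toRat m = v := by
  have : v ∈ (AddSubgroup.closure (S : Set (CharLattice n))).map (toRatHom n) := by
    rw [AddMonoidHom.map_closure]
    exact hv
  obtain ⟨m, hm, h⟩ := this
  exact ⟨m, hm, h⟩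

variable {K : Type*} [Field K] {n : ℕ} {A : Type*} [CommRing A] [Algebra K A]

/-- `S` is the set of `T`-weights of `A`, and the semi-invariants `χ m`, normalized so as to be
multiplicative in `m`, span the weight spaces; outside `S` one has `χ m = 0`. -/
structure IsWeightBasis (act : GroupG K n →* (A ≃ₐ[K] A)) (S : AddSubmonoid (CharLattice n))
    (χ : CharLattice n → A) : Prop where
  weight : ∀ m, χ m ∈ weightSpace act m
  ne_zero_iff : ∀ m, χ m ≠ 0 ↔ m ∈ S
  one : χ 0 = 1
  add : ∀ m ∈ S, ∀ m' ∈ S, χ (m + m') = χ m * χ m'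
  exists_smul : ∀ m, ∀ f ∈ weightSpace act m, ∃ c : K, f = c • χ m

/-- If `T` has an open orbit, the semi-invariants taking the value one at a point of this orbit
form a weight basis. -/
theorem exists_isWeightBasis [IsAlgClosed K] [IsDomain A] [Algebra.FiniteType K A]
    {act : GroupG K n →* (A ≃ₐ[K] A)} (htoric : HasOpenOrbit act (torus K n)) :
    ∃ S χ, IsWeightBasis act S χ := by
  classical
  obtain ⟨x, hx⟩ := exists_point_of_hasOpenOrbit htoric
  let S : AddSubmonoid (CharLattice n) :=
    { carrier := {m | ∃ f ∈ weightSpace act m, f ≠ 0}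
      zero_mem' := ⟨1, one_mem_weightSpace act, one_ne_zero⟩
      add_mem' := by
        rintro m m' ⟨f, hf, hf0⟩ ⟨g, hg, hg0⟩
        exact ⟨f * g, mul_mem_weightSpace hf hg, mul_ne_zero hf0 hg0⟩ }
  have hex : ∀ m ∈ S, ∃ f ∈ weightSpace act m, x f = 1 := by
    rintro m ⟨f, hf, hf0⟩
    have hxf : x f ≠ 0 := fun h => hf0 (hx m f hf h)
    exact ⟨(x f)⁻¹ • f, Submodule.smul_mem _ _ hf, by simp [inv_mul_cancel₀ hxf]⟩
  have hinj : ∀ {m} {f g : A}, f ∈ weightSpace act m → g ∈ weightSpace act m → x f = x g →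
      f = g := fun hf hg h =>
    sub_eq_zero.1 (hx _ _ (Submodule.sub_mem _ hf hg) (by rw [map_sub, h, sub_self]))
  choose! χ hχ hχ1 using hex
  let χ' : CharLattice n → A := fun m => if m ∈ S then χ m else 0
  have hS : ∀ m ∈ S, χ' m = χ m := fun m hm => if_pos hm
  have hmem : ∀ m, χ' m ∈ weightSpace act m := by
    intro m
    by_cases hm : m ∈ S
    · rw [hS m hm]; exact hχ m hm
    · rw [show χ' m = 0 from if_neg hm]; exact Submodule.zero_mem _
  refine ⟨S, χ', hmem, fun m => ?_, ?_, fun m hm m' hm' => ?_, fun m f hf => ?_⟩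
  · refine ⟨fun h => by_contra fun hm => h (if_neg hm), fun hm h => ?_⟩
    rw [hS m hm] at h
    have := hχ1 m hm
    rw [h, map_zero] at this
    exact zero_ne_one this
  · have h0 : (0 : CharLattice n) ∈ S := zero_mem _
    refine hinj (hmem 0) (one_mem_weightSpace act) ?_
    rw [hS 0 h0, hχ1 0 h0, map_one]
  · refine hinj (hmem _) (mul_mem_weightSpace (hmem m) (hmem m')) ?_
    rw [hS _ (add_mem hm hm'), hS m hm, hS m' hm', map_mul, hχ1 _ (add_mem hm hm'), hχ1 m hm,
      hχ1 m' hm', mul_one]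
  · by_cases hm : m ∈ S
    · refine ⟨x f, hinj hf (Submodule.smul_mem _ _ (hmem m)) ?_⟩
      rw [map_smul, hS m hm, hχ1 m hm, smul_eq_mul, mul_one]
    · exact ⟨0, by rw [zero_smul]; exact by_contra fun h => hm ⟨f, hf, h⟩⟩

/-- The derivation `D` is homogeneous of weight `e` for the action of `T`. -/
def IsHomogeneous (act : GroupG K n →* (A ≃ₐ[K] A)) (D : Derivation K A A)
    (e : CharLattice n) : Prop :=
  ∀ t ∈ torus K n, ∀ a, act t (D a) = charEval e t • D (act t a)

namespace IsWeightBasis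

variable {act : GroupG K n →* (A ≃ₐ[K] A)} {S : AddSubmonoid (CharLattice n)}
  {χ : CharLattice n → A}

theorem exists_sum [CharZero K] (hχ : IsWeightBasis act S χ) (hG : IsGVariety act) (f : A) :
    ∃ (F : Finset (CharLattice n)) (c : CharLattice n → K), (∀ m ∈ F, m ∈ S) ∧
      f = ∑ m ∈ F, c m • χ m := by
  classical
  obtain ⟨F, g, hg, rfl⟩ := exists_sum_weightSpace hG f
  have h1 : ∀ m, ∃ c : K, m ∈ F → g m = c • χ m := by
    intro m
    by_cases hm : m ∈ F
    · exact (hχ.exists_smul m _ (hg m hm)).imp fun c hc _ => hc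
    · exact ⟨0, fun h => absurd h hm⟩
  choose c hc using h1
  refine ⟨F.filter (· ∈ S), c, fun m hm => (Finset.mem_filter.1 hm).2, ?_⟩
  rw [Finset.sum_congr rfl hc]
  symm
  refine Finset.sum_filter_of_ne fun m _ h => (hχ.ne_zero_iff m).1 ?_
  exact right_ne_zero_of_smul h

theorem coeff_eq_zero [CharZero K] (hχ : IsWeightBasis act S χ) {F : Finset (CharLattice n)}
    {c : CharLattice n → K} (hF : ∀ m ∈ F, m ∈ S) (h : ∑ m ∈ F, c m • χ m = 0)
    {m : CharLattice n} (hm : m ∈ F) : c m = 0 := by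
  have := eq_zero_of_sum_weightSpace (act := act) (F := F) (g := fun m => c m • χ m)
    (fun m _ => Submodule.smul_mem _ _ (hχ.weight m)) h hm
  exact (smul_eq_zero.1 this).resolve_right ((hχ.ne_zero_iff m).2 (hF m hm))

theorem induction_on [CharZero K] (hχ : IsWeightBasis act S χ) (hG : IsGVariety act)
    {P : A → Prop} (f : A) (mem : ∀ m ∈ S, P (χ m)) (add : ∀ a b, P a → P b → P (a + b))
    (smul : ∀ (c : K) a, P a → P (c • a)) : P f := by
  obtain ⟨F, c, hF, rfl⟩ := hχ.exists_sum hG f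
  have h0 : P 0 := by simpa using smul 0 _ (mem 0 S.zero_mem)
  exact Finset.sum_induction _ P add h0 fun m hm => smul _ _ (mem m (hF m hm))

theorem linearIndependent [CharZero K] (hχ : IsWeightBasis act S χ) :
    LinearIndependent K fun m : S => χ m := by
  classical
  rw [linearIndependent_iff']
  intro F g hg m hm
  have h1 := hχ.coeff_eq_zero (F := F.image Subtype.val)
    (c := fun m => if h : m ∈ S then g ⟨m, h⟩ else 0)
    (fun m hm => by obtain ⟨m', -, rfl⟩ := Finset.mem_image.1 hm; exact m'.2)
    (by
      rw [Finset.sum_image Subtype.val_injective.injOn, ← hg]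
      exact Finset.sum_congr rfl fun m _ => by simp)
    (Finset.mem_image_of_mem _ hm)
  simpa using h1

/-- The basis of `A` consisting of the semi-invariants `χ m`, `m ∈ S`. -/
noncomputable def basis [CharZero K] (hχ : IsWeightBasis act S χ) (hG : IsGVariety act) :
    Module.Basis S K A :=
  Module.Basis.mk hχ.linearIndependent fun f _ => by
    refine hχ.induction_on hG f (fun m hm => Submodule.subset_span ⟨⟨m, hm⟩, rfl⟩)
      (fun a b ha hb => Submodule.add_mem _ ha hb) fun c a ha => Submodule.smul_mem _ _ ha

theorem basis_apply [CharZero K] (hχ : IsWeightBasis act S χ) (hG : IsGVariety act) (m : S) :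
    hχ.basis hG m = χ m := by
  simp [basis]

theorem mem_of_mem_weightSpace (hχ : IsWeightBasis act S χ) {m : CharLattice n} {f : A}
    (hf : f ∈ weightSpace act m) (hf0 : f ≠ 0) : m ∈ S := by
  obtain ⟨c, rfl⟩ := hχ.exists_smul m f hf
  exact (hχ.ne_zero_iff m).1 (right_ne_zero_of_smul hf0)

/-- The weights occurring in algebra generators of `A` generate the weight monoid. -/
theorem fg [CharZero K] [Algebra.FiniteType K A] (hχ : IsWeightBasis act S χ)
    (hG : IsGVariety act) : S.FG := by
  classical
  have hA : (⊤ : Subalgebra K A).FG := Algebra.FiniteType.out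
  obtain ⟨G, hGtop⟩ := hA
  choose F c hF hf using hχ.exists_sum hG
  let F' : Finset (CharLattice n) := G.biUnion F
  refine ⟨F', le_antisymm ?_ ?_⟩
  · rw [AddSubmonoid.closure_le]
    intro m hm
    obtain ⟨g, -, hg⟩ := Finset.mem_biUnion.1 hm
    exact hF g m hg
  set N := AddSubmonoid.closure (F' : Set (CharLattice n)) with hN
  have hNS : N ≤ S := by
    rw [hN, AddSubmonoid.closure_le]
    intro m hm
    obtain ⟨g, -, hg⟩ := Finset.mem_biUnion.1 hm
    exact hF g m hg
  have hspan : ∀ f : A, f ∈ Submodule.span K (χ '' N) := by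
    intro f
    have h1 : f ∈ Algebra.adjoin K (G : Set A) := hGtop ▸ Algebra.mem_top
    induction h1 using Algebra.adjoin_induction with
    | mem g hg =>
      rw [hf g]
      refine Submodule.sum_mem _ fun m hm => Submodule.smul_mem _ _ (Submodule.subset_span ?_)
      exact ⟨m, AddSubmonoid.subset_closure (Finset.mem_biUnion.2 ⟨g, hg, hm⟩), rfl⟩
    | algebraMap r =>
      rw [Algebra.algebraMap_eq_smul_one, ← hχ.one]
      exact Submodule.smul_mem _ _ (Submodule.subset_span ⟨0, N.zero_mem, rfl⟩)
    | add f g _ _ hf hg => exact Submodule.add_mem _ hf hg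
    | mul f g _ _ hf hg =>
      have h2 := Submodule.mul_mem_mul hf hg
      rw [Submodule.span_mul_span] at h2
      refine Submodule.span_mono ?_ h2
      rintro _ ⟨_, ⟨m, hm, rfl⟩, _, ⟨m', hm', rfl⟩, rfl⟩
      exact ⟨m + m', N.add_mem hm hm', hχ.add m (hNS hm) m' (hNS hm')⟩
  intro m hm
  by_contra hmN
  refine hχ.linearIndependent.notMem_span_image (s := {x : S | (x : CharLattice n) ∈ N})
    (x := ⟨m, hm⟩) hmN ?_
  refine Submodule.span_mono ?_ (hspan (χ m))
  rintro _ ⟨m', hm', rfl⟩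
  exact ⟨⟨m', hNS hm'⟩, hm', rfl⟩

theorem nsmul (hχ : IsWeightBasis act S χ) {m : CharLattice n} (hm : m ∈ S) (k : ℕ) :
    χ (k • m) = χ m ^ k := by
  induction k with
  | zero => rw [zero_smul, pow_zero, hχ.one]
  | succ k ih => rw [succ_nsmul, hχ.add _ (S.nsmul_mem hm k) m hm, ih, pow_succ]

/-- Normality of `A` makes the weight monoid saturated: the quotient of semi-invariants of weight
`v` has a power in `A`. -/
theorem saturated [IsDomain A] [IsIntegrallyClosed A] (hχ : IsWeightBasis act S χ)
    {v : CharLattice n} (hv : v ∈ AddSubgroup.closure (S : Set (CharLattice n))) {k : ℕ}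
    (hk : 0 < k) (hkv : k • v ∈ S) : v ∈ S := by
  obtain ⟨a, ha, b, hb, rfl⟩ : ∃ a ∈ S, ∃ b ∈ S, v = a - b := by
    clear hkv
    induction hv using AddSubgroup.closure_induction with
    | mem x hx => exact ⟨x, hx, 0, S.zero_mem, by simp⟩
    | zero => exact ⟨0, S.zero_mem, 0, S.zero_mem, by simp⟩
    | add x y _ _ hx hy =>
      obtain ⟨a, ha, b, hb, rfl⟩ := hx
      obtain ⟨c, hc, d, hd, rfl⟩ := hy
      exact ⟨a + c, S.add_mem ha hc, b + d, S.add_mem hb hd, by abel⟩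
    | neg x _ hx =>
      obtain ⟨a, ha, b, hb, rfl⟩ := hx
      exact ⟨b, hb, a, ha, by abel⟩
  have h1 : χ b ^ k ∣ χ a ^ k := by
    refine ⟨χ (k • (a - b)), ?_⟩
    rw [← hχ.nsmul ha, ← hχ.nsmul hb, ← hχ.add _ (S.nsmul_mem hb k) _ hkv]
    congr 1
    rw [smul_sub]; abel
  obtain ⟨f, hf⟩ := (IsIntegrallyClosed.pow_dvd_pow_iff hk.ne').1 h1
  have ha0 := (hχ.ne_zero_iff a).2 ha
  have hb0 := (hχ.ne_zero_iff b).2 hb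
  refine hχ.mem_of_mem_weightSpace (f := f) (fun t ht => ?_) ?_
  · have h2 := congrArg (act t) hf
    have htb := charEval_ne_zero (torus_le_borel ht) b
    have hab : charEval a t = charEval (a - b) t * charEval b t := by
      rw [← charEval_add (torus_le_borel ht), sub_add_cancel]
    rw [map_mul, hχ.weight a t ht, hχ.weight b t ht, hf, hab] at h2
    refine mul_left_cancel₀ (smul_ne_zero htb hb0 : charEval b t • χ b ≠ 0) ?_
    rw [← h2, smul_mul_smul_comm, mul_comm (charEval b t)]
  · rintro rfl
    rw [mul_zero] at hf
    exact ha0 hf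

theorem ratMonoid_fg [CharZero K] [Algebra.FiniteType K A] (hχ : IsWeightBasis act S χ)
    (hG : IsGVariety act) : (ratMonoid S).FG :=
  (hχ.fg hG).map _

theorem ratMonoid_saturated [IsDomain A] [IsIntegrallyClosed A] (hχ : IsWeightBasis act S χ) :
    ∀ v ∈ AddSubgroup.closure (ratMonoid S : Set (RatCharSpace n)), ∀ k : ℕ, 0 < k →
      k • v ∈ ratMonoid S → v ∈ ratMonoid S := by
  intro v hv k hk hkv
  obtain ⟨m, hm, rfl⟩ := exists_toRat_of_mem_closure hv
  rw [toRat_mem_ratMonoid]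
  refine hχ.saturated hm hk (toRat_mem_ratMonoid.1 ?_)
  rwa [show toRat (k • m) = k • toRat m from map_nsmul (toRatHom n) k m]

theorem derivation_ext [CharZero K] (hχ : IsWeightBasis act S χ) (hG : IsGVariety act)
    {D D' : Derivation K A A} (h : ∀ m ∈ S, D (χ m) = D' (χ m)) : D = D' := by
  ext f
  refine hχ.induction_on hG (P := fun f => D f = D' f) f h (fun a b ha hb => ?_) fun c a ha => ?_
  · rw [map_add, map_add, ha, hb]
  · rw [D.map_smul, D'.map_smul, ha]

/-- A nonzero homogeneous locally nilpotent derivation is given by a root functional. On each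
string `m, m + e, m + 2e, …` the coefficients of `D` form an arithmetic progression, which reaches
zero by local nilpotency. -/
theorem exists_isRootFunctional [CharZero K] [IsDomain A] (hχ : IsWeightBasis act S χ)
    (hG : IsGVariety act) {D : Derivation K A A} (hnil : ∀ a, ∃ N, D^[N] a = 0)
    {e : CharLattice n} (hD : IsHomogeneous act D e) (hD0 : D ≠ 0) :
    ∃ (c : K) (ρ : RatCharSpace n →ₗ[ℚ] ℚ), c ≠ 0 ∧
      IsRootFunctional (ratMonoid S) (toRat e) ρ ∧
      ∀ m ∈ S, D (χ m) = (c * (ρ (toRat m) : K)) • χ (m + e) := by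
  classical
  have hex : ∀ m, ∃ r : K, D (χ m) = r • χ (m + e) ∧ (r ≠ 0 → m + e ∈ S) := by
    intro m
    have h1 : D (χ m) ∈ weightSpace act (m + e) := by
      intro t ht
      rw [hD t ht, hχ.weight m t ht, D.map_smul, smul_smul, charEval_add (torus_le_borel ht),
        mul_comm]
    obtain ⟨r, hr⟩ := hχ.exists_smul _ _ h1
    by_cases hme : m + e ∈ S
    · exact ⟨r, hr, fun _ => hme⟩
    · refine ⟨0, ?_, fun h => absurd rfl h⟩
      rw [hr, not_not.1 (mt (hχ.ne_zero_iff (m + e)).1 hme), smul_zero, smul_zero]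
  choose ψ hψ hψS using hex
  have hadd : ∀ m ∈ S, ∀ m' ∈ S, ψ (m + m') = ψ m + ψ m' := by
    intro m hm m' hm'
    have key : ∀ a ∈ S, ∀ b ∈ S, χ a * (ψ b • χ (b + e)) = ψ b • χ (a + b + e) := by
      intro a ha b hb
      by_cases h0 : ψ b = 0
      · rw [h0, zero_smul, zero_smul, mul_zero]
      · rw [mul_smul_comm, ← hχ.add a ha _ (hψS b h0), add_assoc]
    by_cases hmem : m + m' + e ∈ S
    · have h1 := hψ (m + m')
      rw [hχ.add m hm m' hm', D.leibniz, hψ, hψ, smul_eq_mul, smul_eq_mul, key m hm m' hm',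
        key m' hm' m hm, add_comm m' m, ← add_smul] at h1
      have := smul_left_injective K ((hχ.ne_zero_iff _).2 hmem) h1
      rw [← this, add_comm]
    · have h1 : ψ (m + m') = 0 := by_contra fun h => hmem (hψS _ h)
      have h2 : ψ m = 0 := by_contra fun h => hmem (by
        have := S.add_mem (hψS _ h) hm'
        rwa [add_right_comm] at this)
      have h3 : ψ m' = 0 := by_contra fun h => hmem (by
        have := S.add_mem hm (hψS _ h)
        rwa [← add_assoc] at this)
      rw [h1, h2, h3, add_zero]
  obtain ⟨m₀, hm₀, hψ₀⟩ : ∃ m ∈ S, ψ m ≠ 0 := by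
    by_contra! h
    exact hD0 (hχ.derivation_ext hG fun m hm => by rw [hψ, h m hm, zero_smul]; rfl)
  -- the difference of the arithmetic progressions
  set δ := ψ (m₀ + e) - ψ m₀ with hδ
  have hstep : ∀ m ∈ S, ψ m ≠ 0 → ψ (m + e) = ψ m + δ := by
    intro m hm h
    have h1 := hadd _ (hψS m h) m₀ hm₀
    have h2 := hadd m hm _ (hψS m₀ hψ₀)
    rw [show m + e + m₀ = m + (m₀ + e) by abel, h2] at h1
    rw [hδ]
    linear_combination -h1
  have hend : ∀ m ∈ S, ∃ k : ℕ, ψ m + k * δ = 0 := by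
    intro m hm
    by_contra! h
    have h1 : ∀ k : ℕ, m + k • e ∈ S ∧ ψ (m + k • e) = ψ m + k * δ ∧
        ∃ r : K, r ≠ 0 ∧ D^[k] (χ m) = r • χ (m + k • e) := by
      intro k
      induction k with
      | zero => exact ⟨by simpa using hm, by simp, 1, one_ne_zero, by simp⟩
      | succ k ih =>
        obtain ⟨ih1, ih2, r, hr, ih3⟩ := ih
        have hne : ψ (m + k • e) ≠ 0 := ih2 ▸ h k
        rw [succ_nsmul, ← add_assoc]
        refine ⟨hψS _ hne, ?_, r * ψ (m + k • e), mul_ne_zero hr hne, ?_⟩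
        · rw [hstep _ ih1 hne, ih2]; push_cast; ring
        · rw [Function.iterate_succ_apply', ih3, D.map_smul, hψ, smul_smul]
    obtain ⟨N, hN⟩ := hnil (χ m)
    obtain ⟨h2, -, r, hr, h3⟩ := h1 N
    rw [hN] at h3
    exact smul_ne_zero hr ((hχ.ne_zero_iff _).2 h2) h3.symm
  choose! k hk using hend
  have hδ0 : δ ≠ 0 := by
    intro h
    have := hk m₀ hm₀
    rw [h, mul_zero, add_zero] at this
    exact hψ₀ this
  have hψk : ∀ m ∈ S, ψ m = -δ * k m := fun m hm => by linear_combination hk m hm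
  have hkinj : ∀ {a b : ℚ}, -δ * (a : K) = -δ * (b : K) → a = b := fun h => by
    have := mul_left_cancel₀ (neg_ne_zero.2 hδ0) h
    exact_mod_cast this
  have hkadd : ∀ m ∈ S, ∀ m' ∈ S, (k (m + m') : ℚ) = k m + k m' := by
    intro m hm m' hm'
    apply hkinj
    have := hadd m hm m' hm'
    rw [hψk _ (S.add_mem hm hm'), hψk m hm, hψk m' hm'] at this
    push_cast
    rw [this]; ring
  let f : RatCharSpace n → ℚ := Function.extend toRat (fun m => (k m : ℚ)) 0
  have hf : ∀ m, f (toRat m) = k m := fun m => toRat_injective.extend_apply _ _ m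
  obtain ⟨ρ, hρ⟩ := exists_linear_extension (ratMonoid S) f (by
    rintro _ ⟨m, hm, rfl⟩ _ ⟨m', hm', rfl⟩
    change f (toRat m + toRat m') = f (toRat m) + f (toRat m')
    rw [← toRat_add, hf, hf, hf, hkadd m hm m' hm'])
  have hρk : ∀ m ∈ S, ρ (toRat m) = k m := fun m hm => by
    rw [hρ _ (toRat_mem_ratMonoid.2 hm), hf]
  have hne : ∀ m ∈ S, ρ (toRat m) ≠ 0 → ψ m ≠ 0 := by
    intro m hm h h0
    rw [hψk m hm] at h0
    refine h (hkinj (a := ρ (toRat m)) (b := 0) ?_)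
    rw [hρk m hm]
    push_cast
    rw [h0, mul_zero]
  refine ⟨-δ, ρ, neg_ne_zero.2 hδ0, ⟨?_, ?_, ?_, ?_⟩, fun m hm => ?_⟩
  · rintro _ ⟨m, hm, rfl⟩
    exact ⟨k m, hρk m hm⟩
  · have h1 : ρ (toRat (m₀ + e)) = ρ (toRat m₀) + ρ (toRat e) := by rw [toRat_add, map_add]
    rw [hρk _ (hψS m₀ hψ₀), hρk m₀ hm₀] at h1
    have h2 : ((k (m₀ + e) : ℚ)) = k m₀ - 1 := by
      apply hkinj
      push_cast
      have h3 := hψk _ (hψS m₀ hψ₀)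
      have h4 := hψk _ hm₀
      rw [hstep m₀ hm₀ hψ₀] at h3
      linear_combination -h3 + h4
    linarith
  · rintro _ ⟨m, hm, rfl⟩ h
    change toRat m + toRat e ∈ _
    rw [← toRat_add, toRat_mem_ratMonoid]
    exact hψS m (hne m hm h)
  · refine ⟨toRat m₀, toRat_mem_ratMonoid.2 hm₀, fun h => hψ₀ ?_⟩
    rw [hρk m₀ hm₀] at h
    rw [hψk m₀ hm₀]
    have : k m₀ = 0 := by exact_mod_cast h
    rw [this]; simp
  · rw [hψ, hψk m hm, hρk m hm]
    push_cast
    rfl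

/-- Every root functional defines a homogeneous locally nilpotent derivation. -/
theorem exists_derivation [CharZero K] (hχ : IsWeightBasis act S χ)
    (hG : IsGVariety act) {e : CharLattice n} {ρ : RatCharSpace n →ₗ[ℚ] ℚ}
    (hρ : IsRootFunctional (ratMonoid S) (toRat e) ρ) :
    ∃ D : Derivation K A A, (∀ a, ∃ N, D^[N] a = 0) ∧ IsHomogeneous act D e ∧
      ∀ m ∈ S, D (χ m) = (ρ (toRat m) : K) • χ (m + e) := by
  let L : A →ₗ[K] A := (hχ.basis hG).constr K fun m : S =>
    (ρ (toRat (m : CharLattice n)) : K) • χ (m + e)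
  have hL : ∀ m ∈ S, L (χ m) = (ρ (toRat m) : K) • χ (m + e) := by
    intro m hm
    have := (hχ.basis hG).constr_basis K (fun m : S =>
      (ρ (toRat (m : CharLattice n)) : K) • χ (m + e)) ⟨m, hm⟩
    rwa [basis_apply] at this
  have hadd_mem : ∀ m ∈ S, ρ (toRat m) ≠ 0 → m + e ∈ S := by
    intro m hm h
    have := hρ.add_mem _ (toRat_mem_ratMonoid.2 hm) h
    rwa [← toRat_add, toRat_mem_ratMonoid] at this
  have key : ∀ m ∈ S, ∀ m' ∈ S, χ m * L (χ m') = (ρ (toRat m') : K) • χ (m + m' + e) := by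
    intro m hm m' hm'
    rw [hL m' hm']
    by_cases h : ρ (toRat m') = 0
    · rw [h]; simp
    · rw [mul_smul_comm, ← hχ.add m hm _ (hadd_mem m' hm' h), add_assoc]
  have hleib : ∀ a b, L (a * b) = a * L b + b * L a := by
    intro a b
    refine hχ.induction_on hG (P := fun a => L (a * b) = a * L b + b * L a) a
      (fun m hm => ?_) (fun a a' ha ha' => ?_) fun c a ha => ?_
    · refine hχ.induction_on hG (P := fun b => L (χ m * b) = χ m * L b + b * L (χ m)) b
        (fun m' hm' => ?_) (fun b b' hb hb' => ?_) fun c b hb => ?_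
      · rw [← hχ.add m hm m' hm', hL _ (S.add_mem hm hm'), key m hm m' hm', key m' hm' m hm,
          add_comm m' m, ← add_smul, toRat_add, map_add]
        push_cast
        rw [add_comm]
      · rw [mul_add, map_add, map_add, hb, hb']; ring
      · rw [mul_smul_comm, map_smul, map_smul, hb, smul_add, mul_smul_comm, smul_mul_assoc]
    · rw [add_mul, map_add, map_add, ha, ha']; ring
    · rw [smul_mul_assoc, map_smul, map_smul, ha, smul_add, mul_smul_comm, smul_mul_assoc]
  let D : Derivation K A A := Derivation.mk' L hleib
  have hD : ∀ m ∈ S, D (χ m) = (ρ (toRat m) : K) • χ (m + e) := hL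
  refine ⟨D, fun a => ?_, fun t ht a => ?_, hD⟩
  · refine hχ.induction_on hG (P := fun a => ∃ N, D^[N] a = 0) a (fun m hm => ?_)
      (fun a b ha hb => ?_) fun c a ha => ?_
    · obtain ⟨k, hk⟩ := hρ.nat _ (toRat_mem_ratMonoid.2 hm)
      refine ⟨k + 1, ?_⟩
      induction k generalizing m with
      | zero =>
        rw [zero_add, Function.iterate_one, hD m hm, hk]
        simp
      | succ k ih =>
        have h0 : ρ (toRat m) ≠ 0 := by rw [hk]; positivity
        rw [Function.iterate_succ_apply, hD m hm]
        have h1 := ih (m + e) (hadd_mem m hm h0) (by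
          rw [toRat_add, map_add, hk, hρ.root]; push_cast; ring)
        rw [iterate_derivation_smul, h1, smul_zero]
    · obtain ⟨N, hN⟩ := ha
      obtain ⟨N', hN'⟩ := hb
      refine ⟨max N N', ?_⟩
      rw [iterate_map_add D, iterate_eq_zero_of_le (le_max_left _ _) hN,
        iterate_eq_zero_of_le (le_max_right _ _) hN', add_zero]
    · obtain ⟨N, hN⟩ := ha
      refine ⟨N, ?_⟩
      rw [iterate_derivation_smul, hN, smul_zero]
  · refine hχ.induction_on hG (P := fun a => act t (D a) = charEval e t • D (act t a)) a
      (fun m hm => ?_) (fun a b ha hb => ?_) fun c a ha => ?_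
    · rw [hχ.weight m t ht, D.map_smul, hD m hm, map_smul, hχ.weight _ t ht,
        charEval_add (torus_le_borel ht)]
      simp only [smul_smul]
      congr 1
      ring
    · simp only [map_add, ha, hb, smul_add]
    · rw [D.map_smul, map_smul, map_smul, D.map_smul, ha, smul_comm]

end IsWeightBasis

end WeightBasis

/-! ### The action of `U` and the weights of `B`-root subgroups -/

section Borel

variable {K : Type*} [Field K] {n : ℕ} {A : Type*} [CommRing A] [Algebra K A]

/-- A linear map commutes with a `𝔾_a`-action if and only if it commutes with the derivation. -/
theorem IsExponential.commute_iff [CharZero K] {D : Derivation K A A}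
    {φ : Multiplicative K →* (A ≃ₐ[K] A)} (h : IsExponential D φ) (L : A →ₗ[K] A) :
    (∀ (s : K) a, L (φ (Multiplicative.ofAdd s) a) = φ (Multiplicative.ofAdd s) (L a)) ↔
      ∀ a, L (D a) = D (L a) := by
  constructor
  · intro hL a
    obtain ⟨N, hN⟩ := h.exists_le a
    obtain ⟨N', hN'⟩ := h.exists_le (L a)
    have h3 : ∀ s : K, ∑ i ∈ Finset.range (N + N' + 2),
        s ^ i • (L ((i.factorial : K)⁻¹ • D^[i] a) - (i.factorial : K)⁻¹ • D^[i] (L a)) = 0 := by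
      intro s
      have h4 := hL s a
      rw [(hN (N + N' + 2) (by omega)).2, (hN' (N + N' + 2) (by omega)).2, map_sum] at h4
      simp only [smul_sub, Finset.sum_sub_distrib]
      rw [sub_eq_zero, ← h4]
      exact Finset.sum_congr rfl fun i _ => (map_smul L _ _).symm
    have h5 := eq_zero_of_sum_pow_smul_eq_zero h3 (show 1 < N + N' + 2 by omega)
    simpa [sub_eq_zero] using h5
  · intro hL s a
    have hit : ∀ i a, L (D^[i] a) = D^[i] (L a) := by
      intro i a
      induction i with
      | zero => rfl
      | succ i ih => rw [Function.iterate_succ_apply', hL, ih, Function.iterate_succ_apply']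
    obtain ⟨N, hN⟩ := h.exists_le a
    obtain ⟨N', hN'⟩ := h.exists_le (L a)
    rw [(hN _ (le_max_left N N')).2, (hN' _ (le_max_right N N')).2, map_sum]
    exact Finset.sum_congr rfl fun i _ => by rw [map_smul, map_smul, hit]

/-- The parametrization `r ↦ (1 r; 0 1)` of `U`. -/
def unipotentHom (K : Type*) [Field K] (n : ℕ) : Multiplicative K →* GroupG K n where
  toFun r := (slMk 1 r.toAdd 0 1 (by simp), 1)
  map_one' := by
    refine Prod.ext ?_ rfl
    ext i j
    fin_cases i <;> fin_cases j <;> simp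
  map_mul' r s := by
    refine Prod.ext ?_ (by simp)
    ext i j
    fin_cases i <;> fin_cases j <;> simp [Matrix.mul_apply, Fin.sum_univ_two, add_comm]

theorem unipotentHom_mem (r : Multiplicative K) : unipotentHom K n r ∈ unipotent K n := by
  refine ⟨?_, ?_, ?_, ?_⟩ <;> simp [unipotentHom]

theorem exists_unipotentHom_eq {u : GroupG K n} (hu : u ∈ unipotent K n) :
    ∃ r : K, unipotentHom K n (Multiplicative.ofAdd r) = u := by
  obtain ⟨h1, h2, h3, h4⟩ := hu
  refine ⟨u.1 0 1, Prod.ext ?_ h4.symm⟩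
  ext i j
  fin_cases i <;> fin_cases j <;> simp [unipotentHom, h1, h2, h3]

theorem unipotent_le_borel : unipotent K n ≤ borelSubgroup K n := fun _ h => h.2.1

theorem charEval_of_mem_unipotent {u : GroupG K n} (hu : u ∈ unipotent K n)
    (e : CharLattice n) : charEval e u = 1 := by
  obtain ⟨h1, -, -, h4⟩ := hu
  simp [charEval, h1, h4]

/-- The torus acts on `U` through the positive root. -/
theorem conj_unipotentHom {t : GroupG K n} (ht : t ∈ torus K n) (r : K) :
    t * unipotentHom K n (Multiplicative.ofAdd r) * t⁻¹ =
      unipotentHom K n (Multiplicative.ofAdd (charEval (posRoot n) t * r)) := by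
  obtain ⟨h1, h2⟩ := ht
  have h3 := t.1.det_coe
  rw [Matrix.det_fin_two, h1, h2, mul_zero, sub_zero] at h3
  refine Prod.ext ?_ (by simp [unipotentHom])
  ext i j
  have hval : charEval (posRoot n) t = t.1 0 0 * t.1 0 0 := by
    simp [charEval, posRoot, zpow_ofNat, sq]
  fin_cases i <;> fin_cases j <;>
    simp [unipotentHom, Matrix.mul_apply, Fin.sum_univ_two, h1, h2, Matrix.adjugate_fin_two, h3,
      hval, mul_comm, mul_left_comm]
  ring

theorem exists_torus_mul_unipotent {b : GroupG K n} (hb : b ∈ borelSubgroup K n) :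
    ∃ t ∈ torus K n, ∃ u ∈ unipotent K n, b = t * u := by
  have h0 := entry_ne_zero_of_mem_borel hb
  have h1 : b.1 1 0 = 0 := hb
  have h2 := b.1.det_coe
  rw [Matrix.det_fin_two, h1, mul_zero, sub_zero] at h2
  refine ⟨torusMk (Units.mk0 _ h0) b.2, torusMk_mem _ _,
    unipotentHom K n (Multiplicative.ofAdd ((b.1 0 0)⁻¹ * b.1 0 1)), unipotentHom_mem _,
    Prod.ext ?_ (by simp [torusMk, unipotentHom])⟩
  ext i j
  fin_cases i <;> fin_cases j <;>
    simp [torusMk, unipotentHom, Matrix.mul_apply, Fin.sum_univ_two, h1, h0]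
  exact eq_inv_of_mul_eq_one_right h2

/-- The action of `U` as a `𝔾_a`-action. -/
def unipotentAct (act : GroupG K n →* (A ≃ₐ[K] A)) : Multiplicative K →* (A ≃ₐ[K] A) :=
  act.comp (unipotentHom K n)

theorem isRegularAction_unipotentAct {act : GroupG K n →* (A ≃ₐ[K] A)} (hG : IsGVariety act) :
    IsRegularAction (regularFunctionsGa K) (unipotentAct act) := by
  have hreg : ∀ c ∈ regularFunctions K n,
      (fun r => c (unipotentHom K n r)) ∈ regularFunctionsGa K := by
    intro c hc
    have h0 : (0 : Multiplicative K → K) ∈ regularFunctionsGa K := zero_mem _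
    have h1 : (1 : Multiplicative K → K) ∈ regularFunctionsGa K := one_mem _
    induction hc using Algebra.adjoin_induction with
    | mem f hf =>
      rcases hf with (⟨i, j, rfl⟩ | ⟨i, rfl⟩) | ⟨i, rfl⟩
      · fin_cases i <;> fin_cases j
        · exact h1
        · exact Algebra.subset_adjoin (Set.mem_singleton _)
        · exact h0
        · exact h1
      · exact h1
      · convert h1 using 2
        simp [unipotentHom]
    | algebraMap r => exact Subalgebra.algebraMap_mem _ r
    | add f g _ _ hf hg => exact add_mem hf hg
    | mul f g _ _ hf hg => exact mul_mem hf hg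
  intro a
  obtain ⟨m, c, b, hc, hact⟩ := hG a
  exact ⟨m, fun i r => c i (unipotentHom K n r), b, fun i => hreg _ (hc i), fun r => hact _⟩

theorem isUInvariant_iff [CharZero K] {act : GroupG K n →* (A ≃ₐ[K] A)} {DU : Derivation K A A}
    (hDU : IsExponential DU (unipotentAct act)) {f : A} : IsUInvariant act f ↔ DU f = 0 := by
  rw [hDU.apply_eq_zero_iff]
  constructor
  · exact fun h s => h _ (unipotentHom_mem _)
  · intro h u hu
    obtain ⟨r, rfl⟩ := exists_unipotentHom_eq hu
    exact h r

theorem isHomogeneous_unipotent [CharZero K] {act : GroupG K n →* (A ≃ₐ[K] A)}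
    {DU : Derivation K A A} (hDU : IsExponential DU (unipotentAct act)) :
    IsHomogeneous act DU (posRoot n) := by
  intro t ht
  refine (hDU.semiconj_iff (act t) _).1 fun s => ?_
  rw [← map_inv]
  simp only [unipotentAct, MonoidHom.comp_apply]
  rw [← conj_unipotentHom ht, map_mul, map_mul]

/-- A homogeneous locally nilpotent derivation commuting with the one of `U` yields a `B`-root
subgroup. -/
theorem isBRootSubgroup_range [CharZero K] {act : GroupG K n →* (A ≃ₐ[K] A)}
    {DU : Derivation K A A} (hDU : IsExponential DU (unipotentAct act)) {D : Derivation K A A}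
    {φ : Multiplicative K →* (A ≃ₐ[K] A)} (hD : IsExponential D φ) (hD0 : D ≠ 0)
    {e : CharLattice n} (he : IsHomogeneous act D e) (hcomm : ∀ a, D (DU a) = DU (D a)) :
    IsBRootSubgroup act φ.range ∧ HasWeight act φ.range e := by
  have hpar : IsGaParametrization φ φ.range :=
    ⟨hD.isRegularAction, fun h => hD0 (hD.eq_one_iff.1 h), rfl⟩
  have hconj : ∀ b ∈ borelSubgroup K n, ∀ s : K,
      act b * φ (Multiplicative.ofAdd s) * (act b)⁻¹ =
        φ (Multiplicative.ofAdd (charEval e b * s)) := by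
    intro b hb
    obtain ⟨t, ht, u, hu, rfl⟩ := exists_torus_mul_unipotent hb
    refine (hD.semiconj_iff _ _).2 fun a => ?_
    obtain ⟨r, rfl⟩ := exists_unipotentHom_eq hu
    have h1 := (hDU.commute_iff D.toLinearMap).2 hcomm r
    rw [charEval_mul (unipotent_le_borel hu), charEval_of_mem_unipotent hu, mul_one, map_mul,
      AlgEquiv.mul_apply, AlgEquiv.mul_apply]
    exact (congrArg (act t) (h1 a).symm).trans (he t ht _)
  refine ⟨⟨⟨φ, hpar⟩, ?_⟩, φ, hpar, hconj⟩
  rintro _ ⟨b, hb, rfl⟩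
  have hmem : ∀ b ∈ borelSubgroup K n, ∀ h ∈ φ.range, act b * h * (act b)⁻¹ ∈ φ.range := by
    rintro b hb _ ⟨s, rfl⟩
    exact ⟨_, (hconj b hb s.toAdd).symm⟩
  rw [Subgroup.mem_normalizer_iff]
  refine fun h => ⟨hmem b hb h, fun hh => ?_⟩
  have := hmem b⁻¹ (inv_mem hb) _ hh
  rwa [map_inv, inv_inv, mul_assoc (act b), inv_mul_cancel_left, inv_mul_cancel_right] at this

/-- The derivation of a `B`-root subgroup is homogeneous, by the action of `T`, and commutes with
the one of `U`, since characters of `B` are trivial on `U`. -/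
theorem HasWeight.exists_derivation [CharZero K] [IsDomain A]
    {act : GroupG K n →* (A ≃ₐ[K] A)}
    {DU : Derivation K A A} (hDU : IsExponential DU (unipotentAct act))
    {H : Subgroup (A ≃ₐ[K] A)} {e : CharLattice n} (h : HasWeight act H e) :
    ∃ (D : Derivation K A A) (φ : Multiplicative K →* (A ≃ₐ[K] A)), IsExponential D φ ∧
      IsGaParametrization φ H ∧ D ≠ 0 ∧ IsHomogeneous act D e ∧ ∀ a, D (DU a) = DU (D a) := by
  obtain ⟨φ, hφ, hconj⟩ := h
  obtain ⟨D, hD⟩ := exists_isExponential hφ.regular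
  refine ⟨D, φ, hD, hφ, fun h => hφ.nontrivial (hD.eq_one_iff.2 h), fun t ht => ?_, ?_⟩
  · exact (hD.semiconj_iff _ _).1 (hconj t (torus_le_borel ht))
  · refine (hDU.commute_iff D.toLinearMap).1 fun s a => ?_
    have hu : unipotentHom K n (Multiplicative.ofAdd s) ∈ unipotent K n := unipotentHom_mem _
    have h1 := (hD.semiconj_iff _ _).1 (hconj _ (unipotent_le_borel hu)) a
    rw [charEval_of_mem_unipotent hu, one_smul] at h1
    exact h1.symm

theorem IsGaParametrization.conj {φ : Multiplicative K →* (A ≃ₐ[K] A)}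
    {H : Subgroup (A ≃ₐ[K] A)} (hφ : IsGaParametrization φ H) {g : A ≃ₐ[K] A}
    (hg : g ∈ Subgroup.normalizer (H : Set (A ≃ₐ[K] A))) :
    IsGaParametrization ((MulAut.conj g).toMonoidHom.comp φ) H := by
  refine ⟨fun a => ?_, fun h => hφ.nontrivial ?_, ?_⟩
  · obtain ⟨m, c, b, hc, hact⟩ := hφ.regular (g⁻¹ a)
    refine ⟨m, c, fun i => g (b i), hc, fun s => ?_⟩
    change g (φ s (g⁻¹ a)) = _
    rw [hact, map_sum]
    exact Finset.sum_congr rfl fun i _ => map_smul g _ _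
  · refine MonoidHom.ext fun s => (MulAut.conj g).injective ?_
    rw [MonoidHom.one_apply, map_one]
    exact DFunLike.congr_fun h s
  · rw [MonoidHom.range_comp, hφ.range_eq]
    ext x
    constructor
    · rintro ⟨h, hh, rfl⟩
      exact (Subgroup.mem_normalizer_iff.1 hg h).1 hh
    · intro hx
      refine ⟨g⁻¹ * x * g, ?_, ?_⟩
      · refine (Subgroup.mem_normalizer_iff.1 hg _).2 ?_
        have : g * (g⁻¹ * x * g) * g⁻¹ = x := by group
        rwa [this]
      · change g * (g⁻¹ * x * g) * g⁻¹ = x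
        group

/-- A `B`-root subgroup has a weight. Conjugation by `b ∈ B` rescales the parameter by some
`c b`. As `U` consists of commutators of elements of `B`, the multiplicative function `c` is trivial
on `U`, and on `T` it is the ratio of two weights occurring in `χ m` and its image under the
derivation. -/
theorem IsBRootSubgroup.exists_hasWeight [CharZero K] [IsDomain A]
    {act : GroupG K n →* (A ≃ₐ[K] A)}
    (hG : IsGVariety act) {S : AddSubmonoid (CharLattice n)} {χ : CharLattice n → A}
    (hχ : IsWeightBasis act S χ) {H : Subgroup (A ≃ₐ[K] A)} (hH : IsBRootSubgroup act H) :
    ∃ e, HasWeight act H e := by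
  obtain ⟨⟨φ, hφ⟩, hnorm⟩ := hH
  obtain ⟨D, hD⟩ := exists_isExponential hφ.regular
  have hD0 : D ≠ 0 := fun h => hφ.nontrivial (hD.eq_one_iff.2 h)
  have hex : ∀ b ∈ borelSubgroup K n, ∃ c : K, ∀ a, act b (D a) = c • D (act b a) := by
    intro b hb
    obtain ⟨c, -, hc⟩ := hφ.exists_eq_mul (hφ.conj (hnorm ⟨b, hb, rfl⟩))
    exact ⟨c, (hD.semiconj_iff _ _).1 hc⟩
  choose! c hc using hex
  obtain ⟨a₀, ha₀⟩ : ∃ a, D a ≠ 0 := by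
    by_contra! h
    exact hD0 (Derivation.ext h)
  have huniq : ∀ b ∈ borelSubgroup K n, ∀ x : K, (∀ a, act b (D a) = x • D (act b a)) →
      x = c b := by
    intro b hb x hx
    have h1 := (hx ((act b)⁻¹ a₀)).symm.trans (hc b hb _)
    rw [← AlgEquiv.mul_apply, mul_inv_cancel, AlgEquiv.one_apply] at h1
    exact smul_left_injective K ha₀ h1
  have hmul : ∀ b ∈ borelSubgroup K n, ∀ b' ∈ borelSubgroup K n, c (b * b') = c b * c b' := by
    intro b hb b' hb'
    refine (huniq _ (mul_mem hb hb') _ fun a => ?_).symm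
    rw [map_mul, AlgEquiv.mul_apply, AlgEquiv.mul_apply, hc b' hb', map_smul, hc b hb, smul_smul,
      mul_comm]
  have hone : c 1 = 1 := by
    refine (huniq 1 (one_mem _) 1 fun a => ?_).symm
    rw [map_one, AlgEquiv.one_apply, AlgEquiv.one_apply, one_smul]
  have hinv : ∀ b ∈ borelSubgroup K n, c b * c b⁻¹ = 1 := fun b hb => by
    rw [← hmul b hb _ (inv_mem hb), mul_inv_cancel, hone]
  have hU : ∀ u ∈ unipotent K n, c u = 1 := by
    intro u hu
    obtain ⟨r, rfl⟩ := exists_unipotentHom_eq hu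
    -- conjugation by `diag(2, 1/2)` scales by `4`, and `4 (r/3) - r/3 = r`
    let t : GroupG K n := torusMk (Units.mk0 2 two_ne_zero) 1
    have ht : t ∈ torus K n := torusMk_mem _ _
    have ht' := torus_le_borel ht
    let v := unipotentHom K n (Multiplicative.ofAdd (r / 3))
    have hv : v ∈ borelSubgroup K n := unipotent_le_borel (unipotentHom_mem _)
    have h1 : unipotentHom K n (Multiplicative.ofAdd r) = t * v * t⁻¹ * v⁻¹ := by
      rw [conj_unipotentHom ht, eq_mul_inv_iff_mul_eq, ← map_mul, ← ofAdd_add]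
      congr 2
      rw [charEval_torusMk]
      simp only [posRoot, Units.val_mk0]
      simp
      norm_num
      ring
    have h2 := hinv t ht'
    have h3 := hinv v hv
    rw [h1, hmul _ (mul_mem (mul_mem ht' hv) (inv_mem ht')) _ (inv_mem hv),
      hmul _ (mul_mem ht' hv) _ (inv_mem ht'), hmul t ht' v hv]
    linear_combination h2 * (c v * c v⁻¹) + h3
  obtain ⟨m, hm, hDm⟩ : ∃ m ∈ S, D (χ m) ≠ 0 := by
    by_contra! h
    exact hD0 (hχ.derivation_ext hG fun m hm => by rw [h m hm]; rfl)
  obtain ⟨F, x, hF, hsum⟩ := hχ.exists_sum hG (D (χ m))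
  obtain ⟨k, hk, hxk⟩ : ∃ k ∈ F, x k ≠ 0 := by
    by_contra! h
    refine hDm (hsum.trans (Finset.sum_eq_zero fun k hk => ?_))
    rw [h k hk, zero_smul]
  have hT : ∀ t ∈ torus K n, c t = charEval (k - m) t := by
    intro t ht
    have htB := torus_le_borel ht
    have h1 := hc t htB (χ m)
    rw [hχ.weight m t ht, D.map_smul, hsum, map_sum, smul_smul, Finset.smul_sum,
      ← sub_eq_zero, ← Finset.sum_sub_distrib] at h1
    have h2 := hχ.coeff_eq_zero (F := F)
      (c := fun k => x k * (charEval k t - c t * charEval m t)) hF (by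
        rw [← h1]
        refine Finset.sum_congr rfl fun k _ => ?_
        rw [map_smul, hχ.weight k t ht, smul_smul, smul_smul, ← sub_smul]
        congr 1
        ring) hk
    have h3 := (mul_eq_zero.1 h2).resolve_left hxk
    have h4 : charEval k t = charEval (k - m) t * charEval m t := by
      rw [← charEval_add htB, sub_add_cancel]
    rw [h4, ← sub_mul] at h3
    exact (sub_eq_zero.1 ((mul_eq_zero.1 h3).resolve_right (charEval_ne_zero htB m))).symm
  refine ⟨k - m, φ, hφ, fun b hb => (hD.semiconj_iff _ _).2 ?_⟩
  obtain ⟨t, ht, u, hu, rfl⟩ := exists_torus_mul_unipotent hb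
  have h1 := hc _ hb
  rwa [hmul t (torus_le_borel ht) u (unipotent_le_borel hu), hU u hu, hT t ht,
    ← charEval_of_mem_unipotent hu (k - m), ← charEval_mul (unipotent_le_borel hu)] at h1

theorem HasWeight.unique [CharZero K] [IsDomain A] {act : GroupG K n →* (A ≃ₐ[K] A)}
    {DU : Derivation K A A} (hDU : IsExponential DU (unipotentAct act))
    {H : Subgroup (A ≃ₐ[K] A)} {e e' : CharLattice n} (h : HasWeight act H e)
    (h' : HasWeight act H e') : e = e' := by
  obtain ⟨D, φ, hD, hφ, hD0, he, -⟩ := h.exists_derivation hDU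
  obtain ⟨D', ψ, hD', hψ, hD0', he', -⟩ := h'.exists_derivation hDU
  obtain ⟨c, hc, hcs⟩ := hφ.exists_eq_mul hψ
  have hexp := hD.smul c hcs
  refine charEval_injective (K := K) fun t ht => ?_
  obtain ⟨a₀, ha₀⟩ : ∃ a, D a ≠ 0 := by
    by_contra! h
    exact hD0 (Derivation.ext h)
  have h1 := (hD.semiconj_iff _ _).2 (he t ht)
  have h2 := (hD'.semiconj_iff _ _).2 (he' t ht)
  have h3 : ∀ s : K, act t * φ (Multiplicative.ofAdd s) * (act t)⁻¹ =
      φ (Multiplicative.ofAdd (charEval e' t * s)) := by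
    intro s
    have := h2 (c⁻¹ * s)
    rw [hcs, hcs, mul_inv_cancel_left₀ hc] at this
    rw [this]
    congr 2
    field_simp
  have h4 := (hD.semiconj_iff _ _).1 h3 ((act t)⁻¹ a₀)
  rw [he t ht, ← AlgEquiv.mul_apply, mul_inv_cancel, AlgEquiv.one_apply] at h4
  exact smul_left_injective K ha₀ h4

/-- A `B`-root subgroup is determined by its weight, as its derivation is determined by its root
up to scaling. -/
theorem HasWeight.eq_of_eq [CharZero K] [IsDomain A] {act : GroupG K n →* (A ≃ₐ[K] A)}
    (hG : IsGVariety act) {S : AddSubmonoid (CharLattice n)} {χ : CharLattice n → A}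
    (hχ : IsWeightBasis act S χ)
    {DU : Derivation K A A} (hDU : IsExponential DU (unipotentAct act))
    {H H' : Subgroup (A ≃ₐ[K] A)} {e : CharLattice n} (h : HasWeight act H e)
    (h' : HasWeight act H' e) : H = H' := by
  obtain ⟨D, φ, hD, hφ, hD0, he, -⟩ := h.exists_derivation hDU
  obtain ⟨D', ψ, hD', hψ, hD0', he', -⟩ := h'.exists_derivation hDU
  obtain ⟨c, ρ, hc, hρ, hDρ⟩ :=
    hχ.exists_isRootFunctional hG (fun a => (hD a).imp fun _ h => h.1) he hD0
  obtain ⟨c', ρ', hc', hρ', hDρ'⟩ :=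
    hχ.exists_isRootFunctional hG (fun a => (hD' a).imp fun _ h => h.1) he' hD0'
  have h1 : D' = (c' / c) • D := by
    refine hχ.derivation_ext hG fun m hm => ?_
    rw [Derivation.smul_apply, hDρ m hm, hDρ' m hm, smul_smul,
      hρ.eq_of_mem hρ' (toRat_mem_ratMonoid.2 hm)]
    congr 1
    field_simp
  rw [← hφ.range_eq, ← hψ.range_eq]
  exact hD.range_eq_of_smul (div_ne_zero hc' hc) (h1 ▸ hD')

end Borel

/-! ### Combinatorics of the weight monoid of an `SL₂ × T'`-variety -/

section Combinatorics

variable {n : ℕ}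

/-- The reflection `w` on the character lattice. -/
def weyl (m : CharLattice n) : CharLattice n := (-m.1, m.2)

theorem toRat_weyl (m : CharLattice n) : toRat (weyl m) = weylReflection (toRat m) := by
  ext <;> simp [weyl, toRat, weylReflection]

theorem toRat_weyl_eq (m : CharLattice n) :
    toRat (weyl m) = toRat m - (m.1 : ℚ) • toRat (posRoot n) := by
  ext
  · simp [weyl, toRat, posRoot]; ring
  · simp [weyl, toRat, posRoot]

theorem rho_weyl {ρ₀ : RatCharSpace n →ₗ[ℚ] ℚ} (h : ρ₀ (toRat (posRoot n)) = -1)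
    (m : CharLattice n) : ρ₀ (toRat (weyl m)) = ρ₀ (toRat m) + m.1 := by
  rw [toRat_weyl_eq, map_sub, map_smul, h, smul_eq_mul]
  ring

theorem toRat_add_nsmul (m e : CharLattice n) (k : ℕ) :
    toRat (m + k • e) = toRat m + k • toRat e := by
  rw [toRat_add]
  congr 1
  exact map_nsmul (toRatHom n) k e

/-- The weights in `S` on which the functional `ρ` vanishes. -/
def kerMonoid (S : AddSubmonoid (CharLattice n)) (ρ : RatCharSpace n →ₗ[ℚ] ℚ) :
    AddSubmonoid (CharLattice n) where
  carrier := {m | m ∈ S ∧ ρ (toRat m) = 0}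
  zero_mem' := ⟨S.zero_mem, by rw [toRat_zero, map_zero]⟩
  add_mem' := by
    rintro a b ⟨ha, ha'⟩ ⟨hb, hb'⟩
    exact ⟨S.add_mem ha hb, by rw [toRat_add, map_add, ha', hb', add_zero]⟩

variable {S : AddSubmonoid (CharLattice n)} {ρ₀ : RatCharSpace n →ₗ[ℚ] ℚ}

theorem mem_ratMonoid_kerMonoid {v : RatCharSpace n} :
    v ∈ ratMonoid (kerMonoid S ρ₀) ↔ v ∈ ratMonoid S ∧ ρ₀ v = 0 := by
  constructor
  · rintro ⟨m, ⟨hm, hm'⟩, rfl⟩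
    exact ⟨⟨m, hm, rfl⟩, hm'⟩
  · rintro ⟨⟨m, hm, rfl⟩, h⟩
    exact ⟨m, ⟨hm, h⟩, rfl⟩

/-- A face of a finitely generated monoid is generated by the generators lying on it. -/
theorem ratMonoid_kerMonoid_fg (hfg : (ratMonoid S).FG) (hρ₀ : ∀ v ∈ ratMonoid S, 0 ≤ ρ₀ v) :
    (ratMonoid (kerMonoid S ρ₀)).FG := by
  classical
  obtain ⟨F, hF⟩ := hfg
  have hFS : ∀ v ∈ AddSubmonoid.closure (F : Set (RatCharSpace n)), v ∈ ratMonoid S :=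
    fun v hv => hF ▸ hv
  refine ⟨F.filter fun v => ρ₀ v = 0, le_antisymm ?_ ?_⟩
  · rw [AddSubmonoid.closure_le]
    intro v hv
    obtain ⟨hv1, hv2⟩ := Finset.mem_filter.1 hv
    exact mem_ratMonoid_kerMonoid.2 ⟨hFS v (AddSubmonoid.subset_closure hv1), hv2⟩
  · intro v hv
    obtain ⟨hv1, hv2⟩ := mem_ratMonoid_kerMonoid.1 hv
    rw [← hF] at hv1
    clear hv
    induction hv1 using AddSubmonoid.closure_induction with
    | mem v hv => exact AddSubmonoid.subset_closure (Finset.mem_filter.2 ⟨hv, hv2⟩)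
    | zero => exact zero_mem _
    | add a b ha hb iha ihb =>
      have h1 := hρ₀ a (hFS a ha)
      have h2 := hρ₀ b (hFS b hb)
      rw [map_add] at hv2
      exact add_mem (iha (by linarith)) (ihb (by linarith))

theorem eq_zero_of_mem_closure_kerMonoid {v : RatCharSpace n}
    (hv : v ∈ AddSubgroup.closure (ratMonoid (kerMonoid S ρ₀) : Set (RatCharSpace n))) :
    ρ₀ v = 0 :=
  eqOn_span (Q' := 0) (fun _ h => (mem_ratMonoid_kerMonoid.1 h).2)
    ((ratSpan_closure _).le (Submodule.subset_span hv))

theorem ratMonoid_kerMonoid_saturated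
    (hsat : ∀ v ∈ AddSubgroup.closure (ratMonoid S : Set (RatCharSpace n)), ∀ k : ℕ, 0 < k →
      k • v ∈ ratMonoid S → v ∈ ratMonoid S) :
    ∀ v ∈ AddSubgroup.closure (ratMonoid (kerMonoid S ρ₀) : Set (RatCharSpace n)),
      ∀ k : ℕ, 0 < k → k • v ∈ ratMonoid (kerMonoid S ρ₀) →
      v ∈ ratMonoid (kerMonoid S ρ₀) := by
  intro v hv k hk hkv
  refine mem_ratMonoid_kerMonoid.2 ⟨hsat v (AddSubgroup.closure_mono ?_ hv) k hk
    (mem_ratMonoid_kerMonoid.1 hkv).1, eq_zero_of_mem_closure_kerMonoid hv⟩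
  exact fun w hw => (mem_ratMonoid_kerMonoid.1 hw).1

/-- The face of the cone of `S` cut out by `ρ₀` is the cone of the weights killed by `ρ₀`. -/
theorem faceOf_eq :
    faceOf (AddSubgroup.closure (ratMonoid S : Set (RatCharSpace n)))
      (PointedCone.hull ℚ (ratMonoid S : Set (RatCharSpace n))) (ρ₀.domRestrict _) =
      (PointedCone.hull ℚ (ratMonoid (kerMonoid S ρ₀) : Set (RatCharSpace n)) : Set _) := by
  ext v
  constructor
  · rintro ⟨hv, hv', h0⟩
    obtain ⟨k, hk, hkv⟩ := exists_nsmul_mem_of_mem_hull hv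
    refine mem_hull_of_nsmul_mem hk (PointedCone.subset_hull ?_)
    refine mem_ratMonoid_kerMonoid.2 ⟨hkv, ?_⟩
    rw [map_nsmul, show ρ₀ v = 0 from h0, smul_zero]
  · intro hv
    have h1 : (ratMonoid (kerMonoid S ρ₀) : Set (RatCharSpace n)) ⊆ ratMonoid S :=
      fun w hw => (mem_ratMonoid_kerMonoid.1 hw).1
    have h2 : v ∈ PointedCone.hull ℚ (ratMonoid S : Set (RatCharSpace n)) :=
      Submodule.span_mono h1 hv
    refine ⟨h2, ?_, ?_⟩
    · rw [ratSpan_closure]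
      exact PointedCone.hull_le_span _ _ h2
    · exact eqOn_span (Q' := 0) (fun _ h => (mem_ratMonoid_kerMonoid.1 h).2)
        (PointedCone.hull_le_span _ _ hv)

section Root

variable (hα : IsRootFunctional (ratMonoid S) (toRat (posRoot n)) ρ₀)
  (hw : ∀ m ∈ S, weyl m ∈ S)

include hα

theorem add_nsmul_posRoot_mem {m : CharLattice n} (hm : m ∈ S) {k : ℕ}
    (hk : (k : ℚ) ≤ ρ₀ (toRat m)) : m + k • posRoot n ∈ S := by
  rw [← toRat_mem_ratMonoid, toRat_add_nsmul]
  exact hα.add_nsmul_mem (toRat_mem_ratMonoid.2 hm) hk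

theorem exists_add_nsmul_mem_kerMonoid {m : CharLattice n} (hm : m ∈ S) :
    ∃ k : ℕ, ρ₀ (toRat m) = k ∧ m + k • posRoot n ∈ kerMonoid S ρ₀ := by
  obtain ⟨k, hk, h1, h2⟩ := hα.exists_add_nsmul_mem (toRat_mem_ratMonoid.2 hm)
  rw [← toRat_add_nsmul] at h1 h2
  exact ⟨k, hk, toRat_mem_ratMonoid.1 h1, h2⟩

/-- A ray of the dual cone is determined by its facet if the facet is cut out by `ρ₀`. -/
theorem eq_of_faceOf_eq {ρ : DualSpace (AddSubgroup.closure (ratMonoid S : Set (RatCharSpace n)))}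
    (hρ : ρ ∈ primitiveRays (AddSubgroup.closure (ratMonoid S : Set (RatCharSpace n)))
      (PointedCone.hull ℚ (ratMonoid S : Set (RatCharSpace n))))
    (hface : faceOf (AddSubgroup.closure (ratMonoid S : Set (RatCharSpace n)))
      (PointedCone.hull ℚ (ratMonoid S : Set (RatCharSpace n))) ρ =
      (PointedCone.hull ℚ (ratMonoid (kerMonoid S ρ₀) : Set (RatCharSpace n)) : Set _)) :
    ρ = ρ₀.domRestrict _ := by
  obtain ⟨Q, rfl⟩ := exists_domRestrict_eq _ ρ
  have h0 : ∀ v ∈ ratMonoid (kerMonoid S ρ₀), Q v = 0 := by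
    intro v hv
    have h1 : v ∈ (PointedCone.hull ℚ (ratMonoid (kerMonoid S ρ₀) : Set (RatCharSpace n)) :
        Set _) := PointedCone.subset_hull hv
    rw [← hface] at h1
    exact h1.2.2
  obtain ⟨h1, h2⟩ := hα.eq_smul_of_vanish (F := (ratMonoid S : Set (RatCharSpace n)))
    (AddSubmonoid.closure_eq _)
    (mem_dualCone_hull_iff.1 (mem_dualCone_of_mem_primitiveRays hρ)) fun v hv => by
      obtain ⟨k, hk, hk', hk0⟩ := hα.exists_add_nsmul_mem hv
      rw [hk, Nat.cast_smul_eq_nsmul]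
      exact h0 _ (mem_ratMonoid_kerMonoid.2 ⟨hk', hk0⟩)
  refine hρ.1.eq_of_smul_eq hα.mem_closure hα.root hα.isPrimitive.1 h1 ?_
  exact domRestrict_eq_iff (Q' := (-Q (toRat (posRoot n))) • ρ₀).2 fun v hv => by
    simpa using h2 v hv

/-- A root functional vanishing on the facet cut out by `ρ₀` coincides with `ρ₀`. -/
theorem eq_of_vanish {e : CharLattice n} {ρ : RatCharSpace n →ₗ[ℚ] ℚ}
    (hρ : IsRootFunctional (ratMonoid S) (toRat e) ρ)
    (h0 : ∀ m ∈ kerMonoid S ρ₀, ρ (toRat m) = 0) : ∀ v ∈ ratMonoid S, ρ v = ρ₀ v := by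
  obtain ⟨h1, h2⟩ := hα.eq_smul_of_vanish (F := (ratMonoid S : Set (RatCharSpace n)))
    (AddSubmonoid.closure_eq _) (fun v hv => hρ.nonneg hv) fun v hv => by
      obtain ⟨k, hk, hk', hk0⟩ := hα.exists_add_nsmul_mem hv
      rw [hk, Nat.cast_smul_eq_nsmul]
      obtain ⟨m, hm, hmv⟩ := mem_ratMonoid_kerMonoid.2 ⟨hk', hk0⟩
      rw [← hmv]
      exact h0 m hm
  have h3 : ρ.domRestrict _ = (ρ₀.domRestrict
      (ratSpan (AddSubgroup.closure (ratMonoid S : Set (RatCharSpace n))))) :=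
    hρ.isPrimitive.eq_of_smul_eq hα.mem_closure hα.root hα.isPrimitive.1 h1
      (domRestrict_eq_iff (Q' := (-ρ (toRat (posRoot n))) • ρ₀).2 fun v hv => by
        simpa using h2 v hv)
  exact domRestrict_eq_iff.1 h3

/-- Every weight differs from a highest weight by a multiple of `α`. -/
theorem closure_kerMonoid_sup_zmultiples :
    AddSubgroup.closure (ratMonoid (kerMonoid S ρ₀) : Set (RatCharSpace n)) ⊔
      AddSubgroup.zmultiples (toRat (posRoot n)) =
      AddSubgroup.closure (ratMonoid S : Set (RatCharSpace n)) := by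
  refine le_antisymm (sup_le ?_ ?_) ?_
  · exact AddSubgroup.closure_mono fun v hv => (mem_ratMonoid_kerMonoid.1 hv).1
  · rw [AddSubgroup.zmultiples_le]
    exact hα.mem_closure
  · rw [AddSubgroup.closure_le]
    intro v hv
    obtain ⟨k, -, hk', hk0⟩ := hα.exists_add_nsmul_mem hv
    have h1 : v = (v + k • toRat (posRoot n)) + (-(k • toRat (posRoot n))) := by abel
    rw [h1]
    refine AddSubgroup.add_mem _ ?_ (AddSubgroup.neg_mem _ ?_)
    · exact (le_sup_left : _ ≤ AddSubgroup.closure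
        (ratMonoid (kerMonoid S ρ₀) : Set (RatCharSpace n)) ⊔ _)
        (AddSubgroup.subset_closure (mem_ratMonoid_kerMonoid.2 ⟨hk', hk0⟩))
    · exact (le_sup_right : AddSubgroup.zmultiples (toRat (posRoot n)) ≤ _)
        (AddSubgroup.nsmul_mem _ (AddSubgroup.mem_zmultiples _) k)

include hw

/-- The functional `ρ₀` is nonnegative on the reflection `w m`. -/
theorem zero_le_add_fst {m : CharLattice n} (hm : m ∈ S) : 0 ≤ ρ₀ (toRat m) + m.1 := by
  rw [← rho_weyl hα.root]
  exact hα.nonneg (toRat_mem_ratMonoid.2 (hw m hm))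

theorem fst_nonneg_of_mem_kerMonoid {m : CharLattice n} (hm : m ∈ kerMonoid S ρ₀) :
    0 ≤ m.1 := by
  have := zero_le_add_fst hα hw hm.1
  rw [hm.2, zero_add] at this
  exact_mod_cast this

/-- A weight `m` of `S` lies on the segment between a highest weight `l` of the string through `m`
and its reflection `w l`. -/
theorem hull_kerMonoid_union_weyl :
    PointedCone.hull ℚ
      ((PointedCone.hull ℚ (ratMonoid (kerMonoid S ρ₀) : Set (RatCharSpace n)) : Set _) ∪
        weylReflection ''
          (PointedCone.hull ℚ (ratMonoid (kerMonoid S ρ₀) : Set (RatCharSpace n)) : Set _)) =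
      PointedCone.hull ℚ (ratMonoid S : Set (RatCharSpace n)) := by
  refine le_antisymm (Submodule.span_le.2 (Set.union_subset ?_ ?_)) (Submodule.span_le.2 ?_)
  · exact Submodule.span_mono fun v hv => (mem_ratMonoid_kerMonoid.1 hv).1
  · rintro _ ⟨v, hv', rfl⟩
    have hv : v ∈ Submodule.span {c : ℚ // 0 ≤ c}
      (ratMonoid (kerMonoid S ρ₀) : Set (RatCharSpace n)) := hv'
    clear hv'
    induction hv using Submodule.span_induction with
    | mem v hv =>
      obtain ⟨m, hm, rfl⟩ := hv
      refine PointedCone.subset_hull ?_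
      change weylReflection (toRat m) ∈ _
      rw [← toRat_weyl]
      exact ⟨_, hw m hm.1, rfl⟩
    | zero =>
      have : weylReflection (0 : RatCharSpace n) = 0 := by ext <;> simp [weylReflection]
      rw [this]
      exact Submodule.zero_mem _
    | add a b _ _ ha hb =>
      have : weylReflection (a + b) = weylReflection a + weylReflection b := by
        ext <;> simp [weylReflection, add_comm]
      rw [this]
      exact Submodule.add_mem _ ha hb
    | smul c a _ ha =>
      have : weylReflection (c • a) = c • weylReflection a := by
        ext <;> simp [weylReflection]
      rw [this]
      exact Submodule.smul_mem _ c ha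
  · rintro _ ⟨m, hm, rfl⟩
    obtain ⟨j, hj, hl⟩ := exists_add_nsmul_mem_kerMonoid hα hm
    set l := m + j • posRoot n with hldef
    have hl1 : l.1 = m.1 + 2 * j := by simp [hldef, posRoot, mul_comm]
    have hl2 : l.2 = m.2 := by simp [hldef, posRoot]
    have h1 := zero_le_add_fst hα hw hm
    rw [hj] at h1
    have h2 : (0 : ℤ) ≤ j + m.1 := by exact_mod_cast h1
    obtain ⟨k, hk⟩ := Int.eq_ofNat_of_zero_le h2
    have hmem1 : toRat l ∈ (PointedCone.hull ℚ
        (ratMonoid (kerMonoid S ρ₀) : Set (RatCharSpace n)) : Set _) :=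
      PointedCone.subset_hull ⟨l, hl, rfl⟩
    rcases Nat.eq_zero_or_pos (k + j) with h0 | hpos
    · have hj0 : j = 0 := by omega
      have : m = l := by rw [hldef, hj0]; simp
      rw [this]
      exact PointedCone.subset_hull (Or.inl hmem1)
    · refine mem_hull_of_nsmul_mem hpos ?_
      have h3 : (k + j) • toRat m = k • toRat l + j • weylReflection (toRat l) := by
        have hm1 : (m.1 : ℚ) = k - j := by
          have : m.1 = k - j := by
            omega
          exact_mod_cast this
        have hl1' : (l.1 : ℚ) = k + j := by
          rw [hl1]; push_cast; rw [hm1]; ring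
        ext
        · simp [toRat, weylReflection, hl1', hm1]; ring
        · simp [toRat, weylReflection, hl2]; ring
      change (k + j) • toRat m ∈ _
      rw [h3]
      refine Submodule.add_mem _ ?_ ?_
      · exact Submodule.smul_of_tower_mem _ k (PointedCone.subset_hull (Or.inl hmem1))
      · exact Submodule.smul_of_tower_mem _ j (PointedCone.subset_hull (Or.inr ⟨_, hmem1, rfl⟩))

/-- A root functional `ρ` on `S` with `ρ(α) = 0` and `ρ₀(e) = 0` restricts to a root functional on
the facet `ρ₀ = 0`, and `e` is dominant. -/
theorem mem_demazureRoots_of_isRootFunctional (hfg : (ratMonoid S).FG) {e : CharLattice n}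
    {ρ : RatCharSpace n →ₗ[ℚ] ℚ} (hρ : IsRootFunctional (ratMonoid S) (toRat e) ρ)
    (he : ρ₀ (toRat e) = 0) (hρα : ρ (toRat (posRoot n)) = 0) :
    toRat e ∈ demazureRoots
      (AddSubgroup.closure (ratMonoid (kerMonoid S ρ₀) : Set (RatCharSpace n)))
      (PointedCone.hull ℚ (ratMonoid (kerMonoid S ρ₀) : Set (RatCharSpace n))) ∧ 0 ≤ e.1 := by
  obtain ⟨l, hl, hρl⟩ : ∃ l ∈ kerMonoid S ρ₀, ρ (toRat l) ≠ 0 := by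
    obtain ⟨_, ⟨m, hm, rfl⟩, h0⟩ := hρ.ne_zero
    obtain ⟨k, -, hk⟩ := exists_add_nsmul_mem_kerMonoid hα hm
    refine ⟨_, hk, ?_⟩
    rw [toRat_add_nsmul, map_add, map_nsmul, hρα, smul_zero, add_zero]
    exact h0
  constructor
  · have hΓ : IsRootFunctional (ratMonoid (kerMonoid S ρ₀)) (toRat e) ρ := by
      refine ⟨fun m hm => hρ.nat m (mem_ratMonoid_kerMonoid.1 hm).1, hρ.root, fun m hm h => ?_,
        toRat l, ⟨l, hl, rfl⟩, hρl⟩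
      obtain ⟨hm1, hm2⟩ := mem_ratMonoid_kerMonoid.1 hm
      exact mem_ratMonoid_kerMonoid.2 ⟨hρ.add_mem m hm1 h, by rw [map_add, hm2, he, add_zero]⟩
    exact ⟨_, hΓ.mem_primitiveRays (ratMonoid_kerMonoid_fg hfg fun v hv => hα.nonneg hv),
      hΓ.mem_demazureRootsAt⟩
  · have h1 : weyl l + e ∈ S := by
      rw [← toRat_mem_ratMonoid, toRat_add]
      refine hρ.add_mem _ (toRat_mem_ratMonoid.2 (hw l hl.1)) ?_
      rw [toRat_weyl_eq, map_sub, map_smul, hρα, smul_zero, sub_zero]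
      exact hρl
    have h2 := zero_le_add_fst hα hw h1
    rw [toRat_add, map_add, rho_weyl hα.root, hl.2, he] at h2
    simp only [weyl, Prod.fst_add, Int.cast_add, Int.cast_neg] at h2
    have h3 : (0 : ℚ) ≤ e.1 := by linarith
    exact_mod_cast h3

/-- Conversely, a dominant Demazure root of the facet `ρ₀ = 0` belongs to a root functional on `S`
vanishing on `α`. -/
theorem exists_isRootFunctional_of_mem_demazureRoots (hfg : (ratMonoid S).FG)
    (hsat : ∀ v ∈ AddSubgroup.closure (ratMonoid S : Set (RatCharSpace n)), ∀ k : ℕ, 0 < k →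
      k • v ∈ ratMonoid S → v ∈ ratMonoid S) {e : CharLattice n}
    (he : toRat e ∈ demazureRoots
      (AddSubgroup.closure (ratMonoid (kerMonoid S ρ₀) : Set (RatCharSpace n)))
      (PointedCone.hull ℚ (ratMonoid (kerMonoid S ρ₀) : Set (RatCharSpace n)))) (he' : 0 ≤ e.1) :
    ∃ ρ, IsRootFunctional (ratMonoid S) (toRat e) ρ ∧ ρ₀ (toRat e) = 0 ∧
      ρ (toRat (posRoot n)) = 0 ∧ ∃ l ∈ kerMonoid S ρ₀, ρ (toRat l) ≠ 0 := by
  obtain ⟨ρ', hρ', heρ⟩ := he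
  obtain ⟨Q, rfl⟩ := exists_domRestrict_eq _ ρ'
  -- modify the extension off the facet so that it vanishes on `α`
  let ρ : RatCharSpace n →ₗ[ℚ] ℚ := Q + Q (toRat (posRoot n)) • ρ₀
  have hρQ : Q.domRestrict _ = ρ.domRestrict (ratSpan
      (AddSubgroup.closure (ratMonoid (kerMonoid S ρ₀) : Set (RatCharSpace n)))) :=
    domRestrict_eq_iff.2 fun v hv => by simp [ρ, (mem_ratMonoid_kerMonoid.1 hv).2]
  rw [hρQ] at hρ' heρ
  have hρα : ρ (toRat (posRoot n)) = 0 := by simp [ρ, hα.root]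
  have hΓ : IsRootFunctional (ratMonoid (kerMonoid S ρ₀)) (toRat e) ρ :=
    isRootFunctional_of_mem_demazureRootsAt
      (ratMonoid_kerMonoid_fg hfg fun v hv => hα.nonneg hv)
      (ratMonoid_kerMonoid_saturated hsat) hρ' heρ
  have he0 : ρ₀ (toRat e) = 0 := eq_zero_of_mem_closure_kerMonoid hΓ.mem_closure
  have hval : ∀ (m : CharLattice n) (k : ℕ), ρ (toRat (m + k • posRoot n)) = ρ (toRat m) := by
    intro m k
    rw [toRat_add_nsmul, map_add, map_nsmul, hρα, smul_zero, add_zero]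
  obtain ⟨_, ⟨l, hl, rfl⟩, hρl⟩ := hΓ.ne_zero
  refine ⟨ρ, ⟨?_, hΓ.root, ?_, ?_⟩, he0, hρα, l, hl, hρl⟩
  · rintro _ ⟨m, hm, rfl⟩
    obtain ⟨k, -, hk⟩ := exists_add_nsmul_mem_kerMonoid hα hm
    obtain ⟨j, hj⟩ := hΓ.nat _ (toRat_mem_ratMonoid.2 hk)
    rw [hval] at hj
    exact ⟨j, hj⟩
  · rintro _ ⟨m, hm, rfl⟩ h
    obtain ⟨j, hj, hk⟩ := exists_add_nsmul_mem_kerMonoid hα hm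
    have h1 := hΓ.add_mem _ (toRat_mem_ratMonoid.2 hk) (by rw [hval]; exact h)
    rw [← toRat_add, toRat_mem_ratMonoid] at h1
    -- `m + e` is reached from the reflection of the highest weight above it
    have h2 := zero_le_add_fst hα hw hm
    rw [hj] at h2
    have h3 : (0 : ℤ) ≤ j + m.1 := by exact_mod_cast h2
    obtain ⟨k, hk'⟩ := Int.eq_ofNat_of_zero_le (add_nonneg h3 he')
    have h4 : m + e = weyl (m + j • posRoot n + e) + k • posRoot n := by
      ext i
      · simp only [weyl, posRoot, Prod.fst_add, Prod.smul_mk, smul_zero, nsmul_eq_mul]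
        omega
      · simp [weyl, posRoot]
    change toRat m + toRat e ∈ _
    rw [← toRat_add, toRat_mem_ratMonoid, h4]
    refine add_nsmul_posRoot_mem hα (hw _ h1.1) ?_
    rw [rho_weyl hα.root, h1.2, zero_add]
    have h5 : ((m + j • posRoot n + e).1 : ℤ) = k + j := by
      simp only [posRoot, Prod.fst_add, Prod.smul_mk, smul_zero, nsmul_eq_mul]
      omega
    rw [h5]
    push_cast
    have : (0 : ℚ) ≤ j := j.cast_nonneg
    linarith
  · exact ⟨_, (mem_ratMonoid_kerMonoid.1 ⟨l, hl, rfl⟩).1, hρl⟩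

end Root

end Combinatorics

/-! ### The weight monoid of highest weights -/

section HighestWeights

variable {K : Type*} [Field K] {n : ℕ} {A : Type*} [CommRing A] [Algebra K A]
  {act : GroupG K n →* (A ≃ₐ[K] A)} {S : AddSubmonoid (CharLattice n)} {χ : CharLattice n → A}
  {DU : Derivation K A A}

/-- A representative in `SL₂` of the nontrivial element of the Weyl group. -/
def weylElt (K : Type*) [Field K] (n : ℕ) : GroupG K n := (slMk 0 1 (-1) 0 (by simp), 1)

theorem conj_weylElt_mem {t : GroupG K n} (ht : t ∈ torus K n) :
    (weylElt K n)⁻¹ * t * weylElt K n ∈ torus K n := by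
  obtain ⟨h1, h2⟩ := ht
  constructor <;>
  simp [weylElt, Matrix.mul_apply, Matrix.vecMul, dotProduct, Fin.sum_univ_two,
    Matrix.adjugate_fin_two, h1, h2]

theorem charEval_conj_weylElt {t : GroupG K n} (ht : t ∈ torus K n) (m : CharLattice n) :
    charEval m ((weylElt K n)⁻¹ * t * weylElt K n) = charEval (weyl m) t := by
  obtain ⟨h1, h2⟩ := ht
  have h3 := t.1.det_coe
  rw [Matrix.det_fin_two, h1, h2, mul_zero, sub_zero] at h3
  have h4 : t.1 1 1 = (t.1 0 0)⁻¹ := eq_inv_of_mul_eq_one_right h3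
  simp [charEval, weyl, weylElt, Matrix.mul_apply, Matrix.vecMul, dotProduct, Fin.sum_univ_two,
    Matrix.adjugate_fin_two, h4]

theorem act_weylElt_mem_weightSpace {m : CharLattice n} {f : A} (hf : f ∈ weightSpace act m) :
    act (weylElt K n) f ∈ weightSpace act (weyl m) := by
  intro t ht
  have h1 : t * weylElt K n = weylElt K n * ((weylElt K n)⁻¹ * t * weylElt K n) := by group
  rw [← AlgEquiv.mul_apply, ← map_mul, h1, map_mul, AlgEquiv.mul_apply,
    hf _ (conj_weylElt_mem ht), map_smul, charEval_conj_weylElt ht]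

theorem IsWeightBasis.exists_act_weylElt (hχ : IsWeightBasis act S χ) {m : CharLattice n}
    (hm : m ∈ S) : weyl m ∈ S ∧ ∃ c : K, c ≠ 0 ∧ act (weylElt K n) (χ m) = c • χ (weyl m) := by
  have h1 := act_weylElt_mem_weightSpace (hχ.weight m)
  have h2 : act (weylElt K n) (χ m) ≠ 0 := fun h =>
    (hχ.ne_zero_iff m).2 hm ((map_eq_zero_iff _ (act (weylElt K n)).injective).1 h)
  obtain ⟨c, hc⟩ := hχ.exists_smul _ _ h1
  refine ⟨hχ.mem_of_mem_weightSpace h1 h2, c, ?_, hc⟩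
  rintro rfl
  rw [zero_smul] at hc
  exact h2 hc

/-- A `T`-stable subspace contains the homogeneous components of its elements. -/
theorem mem_of_sum_mem [CharZero K] (hχ : IsWeightBasis act S χ) {W : Submodule K A}
    (hW : ∀ t ∈ torus K n, ∀ f ∈ W, act t f ∈ W) {F : Finset (CharLattice n)}
    {c : CharLattice n → K} (h : ∑ m ∈ F, c m • χ m ∈ W) {m : CharLattice n} (hm : m ∈ F) :
    c m • χ m ∈ W := by
  rw [← Submodule.Quotient.mk_eq_zero]
  refine eq_zero_of_sum_charEval_smul_eq_zero (K := K) (F := F)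
    (x := fun m => W.mkQ (c m • χ m)) (fun t ht => ?_) hm
  have h1 := (Submodule.Quotient.mk_eq_zero W).2 (hW t ht _ h)
  rw [← Submodule.mkQ_apply, map_sum, map_sum] at h1
  rw [← h1]
  refine Finset.sum_congr rfl fun m _ => ?_
  rw [map_smul (act t), hχ.weight m t ht, ← map_smul, smul_comm]

/-- The kernel of a homogeneous derivation is homogeneous. -/
theorem smul_apply_eq_zero_of_sum [CharZero K] (hχ : IsWeightBasis act S χ)
    {D : Derivation K A A} {e : CharLattice n} (hD : IsHomogeneous act D e)
    {F : Finset (CharLattice n)} {c : CharLattice n → K} (h : D (∑ m ∈ F, c m • χ m) = 0)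
    {m : CharLattice n} (hm : m ∈ F) : c m • D (χ m) = 0 := by
  refine eq_zero_of_sum_charEval_smul_eq_zero (K := K) (F := F)
    (x := fun m => c m • D (χ m)) (fun t ht => ?_) hm
  have h1 := congrArg (act t) h
  rw [map_zero, map_sum, map_sum] at h1
  have h2 : ∀ m, act t (D (c m • χ m)) = charEval e t • (charEval m t • (c m • D (χ m))) := by
    intro m
    rw [hD t ht, map_smul, hχ.weight m t ht, D.map_smul, D.map_smul, smul_comm (c m)]
  simp only [h2] at h1
  rw [← Finset.smul_sum] at h1
  exact (smul_eq_zero.1 h1).resolve_left (charEval_ne_zero (torus_le_borel ht) e)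

/-- If `U` acts trivially then so does `SL₂`, the normal closure of `U`. -/
theorem act_eq_one_of_unipotentAct_eq_one (h : unipotentAct act = 1)
    (g : Matrix.SpecialLinearGroup (Fin 2) K) : act (g, 1) = 1 := by
  have hu : ∀ r : K, act (unipotentHom K n (Multiplicative.ofAdd r)) = 1 := fun r =>
    DFunLike.congr_fun h (Multiplicative.ofAdd r)
  let low : K → GroupG K n := fun r => (slMk 1 0 r 1 (by simp), 1)
  have hl : ∀ r : K, act (low r) = 1 := by
    intro r
    have h1 : low r =
        (weylElt K n)⁻¹ * unipotentHom K n (Multiplicative.ofAdd (-r)) * weylElt K n := by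
      refine Prod.ext ?_ (by simp [low, weylElt, unipotentHom])
      ext i j
      fin_cases i <;> fin_cases j <;>
        simp [low, weylElt, unipotentHom, Matrix.mul_apply, Fin.sum_univ_two,
          Matrix.adjugate_fin_two]
    rw [h1, map_mul, map_mul, hu, mul_one, ← map_mul, inv_mul_cancel, map_one]
  -- a matrix with nonzero lower left entry is a product of elementary ones
  have hc : ∀ g : Matrix.SpecialLinearGroup (Fin 2) K, g 1 0 ≠ 0 → act (g, 1) = 1 := by
    intro g hg
    have hdet := g.det_coe
    rw [Matrix.det_fin_two] at hdet
    have h1 : ((g, 1) : GroupG K n) =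
        unipotentHom K n (Multiplicative.ofAdd ((g 0 0 - 1) / g 1 0)) * low (g 1 0) *
          unipotentHom K n (Multiplicative.ofAdd ((g 1 1 - 1) / g 1 0)) := by
      refine Prod.ext ?_ (by simp [low, unipotentHom])
      ext i j
      fin_cases i <;> fin_cases j <;>
        simp [low, unipotentHom, Matrix.mul_apply, Fin.sum_univ_two] <;> field_simp <;>
        first | ring1 | linear_combination -hdet
    rw [h1, map_mul, map_mul, hu, hu, hl, one_mul, one_mul]
  by_cases hg : g 1 0 = 0
  · have hdet := g.det_coe
    rw [Matrix.det_fin_two, hg, mul_zero, sub_zero] at hdet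
    have h1 : act (((g, 1) : GroupG K n) * low 1) = 1 := by
      rw [show ((g, 1) : GroupG K n) * low 1 = (g * (low 1).1, 1) from Prod.ext rfl (by simp [low])]
      refine hc (g * (low 1).1) ?_
      simp [low, Matrix.mul_apply, Fin.sum_univ_two, hg]
      rintro h0
      rw [h0, mul_zero] at hdet
      exact zero_ne_one hdet
    rwa [map_mul, hl, mul_one] at h1
  · exact hc g hg

theorem mem_of_mem_weightMonoid [CharZero K] (hχ : IsWeightBasis act S χ)
    (hDU : IsExponential DU (unipotentAct act)) {l : CharLattice n} (hl : l ∈ weightMonoid act) :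
    l ∈ S ∧ DU (χ l) = 0 := by
  obtain ⟨-, W, -, f, -, hf0, hfU, hfT⟩ := hl
  refine ⟨hχ.mem_of_mem_weightSpace (f := f) hfT hf0, ?_⟩
  obtain ⟨c, rfl⟩ := hχ.exists_smul l f hfT
  rw [isUInvariant_iff hDU, DU.map_smul] at hfU
  exact (smul_eq_zero.1 hfU).resolve_left (left_ne_zero_of_smul hf0)

/-- If `SL₂` acts trivially, the simple submodules are the weight spaces of `T`. -/
theorem weightMonoid_eq_of_trivial [CharZero K] (hχ : IsWeightBasis act S χ)
    (hDU : IsExponential DU (unipotentAct act)) (h0 : DU = 0) :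
    weightMonoid act = (S : Set (CharLattice n)) ∧ ∀ m ∈ S, m.1 = 0 := by
  have htriv := act_eq_one_of_unipotentAct_eq_one (hDU.eq_one_iff.2 h0)
  have hfst : ∀ m ∈ S, m.1 = 0 := by
    intro m hm
    have h1 := hχ.weight m (torusMk (Units.mk0 2 two_ne_zero) 1) (torusMk_mem _ _)
    rw [show act (torusMk (Units.mk0 2 two_ne_zero) 1) = 1 from htriv _, AlgEquiv.one_apply,
      charEval_torusMk] at h1
    have h2 : ((1 : K) - 2 ^ m.1) • χ m = 0 := by
      rw [sub_smul, one_smul, sub_eq_zero]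
      simpa using h1
    have h3 := (smul_eq_zero.1 h2).resolve_right ((hχ.ne_zero_iff m).2 hm)
    refine two_zpow_injective (K := K) ?_
    rw [zpow_zero]
    exact (sub_eq_zero.1 h3).symm
  refine ⟨Set.ext fun l => ⟨fun hl => (mem_of_mem_weightMonoid hχ hDU hl).1, fun hl => ?_⟩, hfst⟩
  have hne := (hχ.ne_zero_iff l).2 hl
  have hatom := nonzero_span_atom (K := K) (χ l) hne
  refine ⟨(hfst l hl).ge, Submodule.span K {χ l}, ⟨?_, hatom.1, fun W' _ hW' =>
    hatom.le_iff.1 hW'⟩, χ l, Submodule.mem_span_singleton_self _, hne, ?_, hχ.weight l⟩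
  · intro g f hf
    obtain ⟨c, rfl⟩ := Submodule.mem_span_singleton.1 hf
    have h1 : g = (g.1, 1) * torusMk 1 g.2 := by
      refine Prod.ext ?_ (by simp [torusMk])
      ext i j
      fin_cases i <;> fin_cases j <;> simp [torusMk, Matrix.mul_apply, Fin.sum_univ_two]
    rw [h1, map_mul, htriv, one_mul, map_smul, hχ.weight l _ (torusMk_mem _ _)]
    exact Submodule.smul_mem _ _ (Submodule.smul_mem _ _ (Submodule.mem_span_singleton_self _))
  · rw [isUInvariant_iff hDU, h0]
    rfl

/-- If `SL₂` acts nontrivially, the highest weights are the weights killed by `ρ₀`: the isotypic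
component of the centre of `G` containing `χ l` is a simple module. Indeed, from any of its
semi-invariants one reaches `χ l` by the action of `U`, then `χ (w l)` by the Weyl group, and then
all other semi-invariants of the component by the action of `U`. -/
theorem weightMonoid_eq_kerMonoid [CharZero K] (hG : IsGVariety act)
    (hχ : IsWeightBasis act S χ)
    (hDU : IsExponential DU (unipotentAct act)) {c₀ : K} (hc₀ : c₀ ≠ 0)
    {ρ₀ : RatCharSpace n →ₗ[ℚ] ℚ}
    (hα : IsRootFunctional (ratMonoid S) (toRat (posRoot n)) ρ₀)
    (hDUχ : ∀ m ∈ S, DU (χ m) = (c₀ * (ρ₀ (toRat m) : K)) • χ (m + posRoot n)) :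
    weightMonoid act = (kerMonoid S ρ₀ : Set (CharLattice n)) := by
  have hw : ∀ m ∈ S, weyl m ∈ S := fun m hm => (hχ.exists_act_weylElt hm).1
  have hne : ∀ m ∈ S, ρ₀ (toRat m) ≠ 0 → (c₀ * (ρ₀ (toRat m) : K)) ≠ 0 := fun m _ h =>
    mul_ne_zero hc₀ (by exact_mod_cast h)
  have hadd : ∀ m ∈ S, ρ₀ (toRat m) ≠ 0 → m + posRoot n ∈ S := by
    intro m hm h
    have := hα.add_mem _ (toRat_mem_ratMonoid.2 hm) h
    rwa [← toRat_add, toRat_mem_ratMonoid] at this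
  ext l
  constructor
  · intro hl
    obtain ⟨hlS, hlU⟩ := mem_of_mem_weightMonoid hχ hDU hl
    refine ⟨hlS, by_contra fun h => ?_⟩
    rw [hDUχ l hlS] at hlU
    exact smul_ne_zero (hne l hlS h) ((hχ.ne_zero_iff _).2 (hadd l hlS h)) hlU
  · intro hl
    have hlχ := (hχ.ne_zero_iff l).2 hl.1
    let W : Submodule K A :=
      { carrier := {f | ∀ z ∈ torus K n, (∀ g, z * g = g * z) → act z f = charEval l z • f}
        add_mem' := fun ha hb z hz hz' => by rw [map_add, ha z hz hz', hb z hz hz', smul_add]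
        zero_mem' := fun z _ _ => by simp
        smul_mem' := fun c a ha z hz hz' => by rw [map_smul, ha z hz hz', smul_comm] }
    have hWG : IsGStable act W := by
      intro g f hf z hz hz'
      rw [← AlgEquiv.mul_apply, ← map_mul, hz' g, map_mul, AlgEquiv.mul_apply, hf z hz hz',
        map_smul]
    have hlW : χ l ∈ W := fun z hz _ => hχ.weight l z hz
    -- the weights of `W` form a single string: the elements of `T'` determine the second component
    -- of a weight, and the centre of `SL₂` determines the parity of the first
    have hstring : ∀ m ∈ S, χ m ∈ W → ∃ j : ℕ, ρ₀ (toRat m) = j ∧ l = m + j • posRoot n := by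
      intro m hm hmW
      have h1 : ∀ z ∈ torus K n, (∀ g, z * g = g * z) → charEval m z = charEval l z := by
        intro z hz hz'
        have h2 := hmW z hz hz'
        rw [hχ.weight m z hz] at h2
        exact smul_left_injective K ((hχ.ne_zero_iff m).2 hm) h2
      have hsnd : m.2 = l.2 := by
        funext i
        have h2 := h1 _ (torusMk_mem 1 (Pi.mulSingle i (Units.mk0 2 two_ne_zero))) fun g => by
          refine Prod.ext ?_ (mul_comm _ _)
          ext a b
          fin_cases a <;> fin_cases b <;> simp [torusMk, Matrix.mul_apply, Fin.sum_univ_two]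
        simp only [charEval_torusMk, Units.val_one, one_zpow, one_mul] at h2
        rw [Finset.prod_eq_single i, Finset.prod_eq_single i] at h2
        · rw [Pi.mulSingle_eq_same, Units.val_mk0] at h2
          exact two_zpow_injective h2
        all_goals simp +contextual [Pi.mulSingle_eq_of_ne]
      have hpar : Even (l.1 - m.1) := by
        have h2 := h1 _ (torusMk_mem (-1) 1) fun g => by
          refine Prod.ext ?_ (mul_comm _ _)
          ext a b
          fin_cases a <;> fin_cases b <;> simp [torusMk, Matrix.mul_apply, Fin.sum_univ_two]
        simp only [charEval_torusMk, Units.val_neg, Units.val_one, Pi.one_apply, one_zpow,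
          Finset.prod_const_one, mul_one] at h2
        have h3 : (-1 : K) ^ (l.1 - m.1) = 1 := by
          rw [zpow_sub₀ (by simp), h2, div_self (zpow_ne_zero _ (by simp))]
        by_contra hodd
        rw [Int.not_even_iff_odd] at hodd
        rw [hodd.neg_one_zpow] at h3
        have h4 : (2 : K) = 0 := by linear_combination -h3
        exact two_ne_zero h4
      obtain ⟨d, hd⟩ := hpar
      have hlm : toRat l = toRat m + (d : ℚ) • toRat (posRoot n) := by
        have : l.1 = m.1 + d * 2 := by omega
        ext
        · simp [toRat, posRoot, this]
        · simp [toRat, posRoot, hsnd]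
      have hρd : ρ₀ (toRat m) = d := by
        have h2 := congrArg ρ₀ hlm
        rw [hl.2, map_add, map_smul, hα.root, smul_eq_mul] at h2
        linarith
      obtain ⟨j, hj⟩ := hα.nat _ (toRat_mem_ratMonoid.2 hm)
      refine ⟨j, hj, ?_⟩
      have hdj : d = j := by
        rw [hj] at hρd
        exact_mod_cast hρd.symm
      apply toRat_injective
      rw [toRat_add_nsmul, hlm, hdj, Int.cast_natCast, Nat.cast_smul_eq_nsmul]
    -- the action of `U` moves up the string
    have hup : ∀ W' : Submodule K A, IsGStable act W' → ∀ m ∈ S, χ m ∈ W' → ∀ i : ℕ,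
        (i : ℚ) ≤ ρ₀ (toRat m) → χ (m + i • posRoot n) ∈ W' := by
      intro W' hW' m hm hmW i
      induction i with
      | zero => intro _; simpa using hmW
      | succ i ih =>
        intro hi
        push_cast at hi
        have h1 := ih (by linarith)
        have hmS := add_nsmul_posRoot_mem hα hm (k := i) (by linarith)
        have h2 : DU (χ (m + i • posRoot n)) ∈ W' := hDU.apply_mem fun s => hW' _ _ h1
        have h3 : ρ₀ (toRat (m + i • posRoot n)) ≠ 0 := by
          rw [toRat_add_nsmul, map_add, map_nsmul, hα.root, smul_neg, nsmul_eq_mul, mul_one]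
          linarith
        rw [hDUχ _ hmS] at h2
        rw [succ_nsmul, ← add_assoc]
        exact (W'.smul_mem_iff (hne _ hmS h3)).1 h2
    refine ⟨fst_nonneg_of_mem_kerMonoid hα hw hl, W, ⟨hWG, ?_, fun W' hW' hle => ?_⟩, χ l, hlW,
      hlχ, ?_, hχ.weight l⟩
    · intro h
      rw [h, Submodule.mem_bot] at hlW
      exact hlχ hlW
    · by_cases hbot : W' = ⊥
      · exact Or.inl hbot
      refine Or.inr (le_antisymm hle fun f hf => ?_)
      obtain ⟨g, hg, hg0⟩ := Submodule.exists_mem_ne_zero_of_ne_bot hbot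
      obtain ⟨F, c, hF, rfl⟩ := hχ.exists_sum hG g
      obtain ⟨m, hmF, hcm⟩ : ∃ m ∈ F, c m ≠ 0 := by
        by_contra! h
        exact hg0 (Finset.sum_eq_zero fun m hm => by rw [h m hm, zero_smul])
      have hmW' : χ m ∈ W' := (W'.smul_mem_iff hcm).1
        (mem_of_sum_mem hχ (fun t _ f hf => hW' t f hf) hg hmF)
      have hlW' : χ l ∈ W' := by
        obtain ⟨j, hj, hlj⟩ := hstring m (hF m hmF) (hle hmW')
        have := hup W' hW' m (hF m hmF) hmW' j hj.ge
        rwa [← hlj] at this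
      have hwlW' : χ (weyl l) ∈ W' := by
        obtain ⟨-, d, hd, hact⟩ := hχ.exists_act_weylElt hl.1
        have := hW' (weylElt K n) _ hlW'
        rw [hact] at this
        exact (W'.smul_mem_iff hd).1 this
      obtain ⟨F, c, hF, rfl⟩ := hχ.exists_sum hG f
      refine Submodule.sum_mem _ fun m hm => ?_
      by_cases hcm : c m = 0
      · rw [hcm, zero_smul]; exact Submodule.zero_mem _
      refine Submodule.smul_mem _ _ ?_
      have hmW : χ m ∈ W := (W.smul_mem_iff hcm).1
        (mem_of_sum_mem hχ (fun t _ f hf => hWG t f hf) hf hm)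
      obtain ⟨j, hj, hlj⟩ := hstring m (hF m hm) hmW
      have h1 := zero_le_add_fst hα hw (hF m hm)
      rw [hj] at h1
      have h2 : (0 : ℤ) ≤ j + m.1 := by exact_mod_cast h1
      obtain ⟨i, hi⟩ := Int.eq_ofNat_of_zero_le h2
      have hl1 : l.1 = m.1 + 2 * j := by rw [hlj]; simp [posRoot, mul_comm]
      have hl2 : l.2 = m.2 := by rw [hlj]; simp [posRoot]
      have h3 : m = weyl l + i • posRoot n := by
        ext a
        · simp only [weyl, posRoot, Prod.fst_add, Prod.smul_mk, smul_zero, nsmul_eq_mul]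
          omega
        · simp [weyl, posRoot, hl2]
      rw [h3]
      refine hup W' hW' _ (hw l hl.1) hwlW' i ?_
      rw [rho_weyl hα.root, hl.2, zero_add]
      have : (i : ℤ) ≤ l.1 := by omega
      exact_mod_cast this
    · rw [isUInvariant_iff hDU, hDUχ l hl.1, hl.2]
      simp

/-- Two derivations given by root functionals commute if and only if their functionals and roots
satisfy a bilinear relation. -/
theorem commute_iff_of_isRootFunctional [CharZero K] [IsDomain A] (hG : IsGVariety act)
    (hχ : IsWeightBasis act S χ) {D₁ D₂ : Derivation K A A} {e₁ e₂ : CharLattice n}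
    {ρ₁ ρ₂ : RatCharSpace n →ₗ[ℚ] ℚ} {c₁ c₂ : K} (hc₁ : c₁ ≠ 0) (hc₂ : c₂ ≠ 0)
    (h₁ : IsRootFunctional (ratMonoid S) (toRat e₁) ρ₁)
    (h₂ : IsRootFunctional (ratMonoid S) (toRat e₂) ρ₂)
    (hD₁ : ∀ m ∈ S, D₁ (χ m) = (c₁ * (ρ₁ (toRat m) : K)) • χ (m + e₁))
    (hD₂ : ∀ m ∈ S, D₂ (χ m) = (c₂ * (ρ₂ (toRat m) : K)) • χ (m + e₂)) :
    (∀ a, D₁ (D₂ a) = D₂ (D₁ a)) ↔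
      ∀ m ∈ S, ρ₂ (toRat m) * ρ₁ (toRat e₂) = ρ₁ (toRat m) * ρ₂ (toRat e₁) := by
  have hadd : ∀ {e : CharLattice n} {ρ : RatCharSpace n →ₗ[ℚ] ℚ},
      IsRootFunctional (ratMonoid S) (toRat e) ρ → ∀ m ∈ S, ρ (toRat m) ≠ 0 → m + e ∈ S := by
    intro e ρ h m hm hρ
    have := h.add_mem _ (toRat_mem_ratMonoid.2 hm) hρ
    rwa [← toRat_add, toRat_mem_ratMonoid] at this
  have comp : ∀ {D D' : Derivation K A A} {e e' : CharLattice n}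
      {ρ ρ' : RatCharSpace n →ₗ[ℚ] ℚ} {c c' : K},
      IsRootFunctional (ratMonoid S) (toRat e') ρ' →
      (∀ m ∈ S, D (χ m) = (c * (ρ (toRat m) : K)) • χ (m + e)) →
      (∀ m ∈ S, D' (χ m) = (c' * (ρ' (toRat m) : K)) • χ (m + e')) →
      ∀ m ∈ S, D (D' (χ m)) = (c * c' * ((ρ' (toRat m) * (ρ (toRat m) + ρ (toRat e')) : ℚ) : K)) •
        χ (m + e' + e) := by
    intro D D' e e' ρ ρ' c c' h hD hD' m hm
    rw [hD' m hm, D.map_smul]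
    by_cases h0 : ρ' (toRat m) = 0
    · rw [h0]; simp
    · rw [hD _ (hadd h m hm h0), smul_smul, toRat_add, map_add]
      congr 1
      push_cast
      ring
  have hmem : ∀ {e e' : CharLattice n} {ρ ρ' : RatCharSpace n →ₗ[ℚ] ℚ},
      IsRootFunctional (ratMonoid S) (toRat e) ρ → IsRootFunctional (ratMonoid S) (toRat e') ρ' →
      ∀ m ∈ S, m + e' + e ∉ S → ρ' (toRat m) * (ρ (toRat m) + ρ (toRat e')) = 0 := by
    intro e e' ρ ρ' h h' m hm hnot
    by_contra hne
    have h1 := hadd h' m hm (left_ne_zero_of_mul hne)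
    refine hnot (hadd h _ h1 ?_)
    rw [toRat_add, map_add]
    exact right_ne_zero_of_mul hne
  constructor
  · intro hcomm m hm
    have h3 := hcomm (χ m)
    rw [comp h₂ hD₁ hD₂ m hm, comp h₁ hD₂ hD₁ m hm, add_right_comm m e₁ e₂] at h3
    by_cases hS : m + e₂ + e₁ ∈ S
    · have h4 := smul_left_injective K ((hχ.ne_zero_iff _).2 hS) h3
      simp only [mul_comm c₂ c₁] at h4
      have h5 := mul_left_cancel₀ (mul_ne_zero hc₁ hc₂) h4
      have h6 : ρ₂ (toRat m) * (ρ₁ (toRat m) + ρ₁ (toRat e₂)) =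
          ρ₁ (toRat m) * (ρ₂ (toRat m) + ρ₂ (toRat e₁)) := by exact_mod_cast h5
      linarith
    · have h4 := hmem h₁ h₂ m hm hS
      have h5 := hmem h₂ h₁ m hm (by rwa [add_right_comm])
      linarith
  · intro h a
    refine hχ.induction_on hG (P := fun a => D₁ (D₂ a) = D₂ (D₁ a)) a (fun m hm => ?_)
      (fun a b ha hb => ?_) fun c a ha => ?_
    · have h3 : ρ₂ (toRat m) * (ρ₁ (toRat m) + ρ₁ (toRat e₂)) =
          ρ₁ (toRat m) * (ρ₂ (toRat m) + ρ₂ (toRat e₁)) := by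
        linear_combination h m hm
      rw [comp h₂ hD₁ hD₂ m hm, comp h₁ hD₂ hD₁ m hm, add_right_comm m e₁ e₂, h3, mul_comm c₂]
    · simp only [map_add, ha, hb]
    · rw [D₂.map_smul, D₁.map_smul, D₁.map_smul, D₂.map_smul, ha]

end HighestWeights

/-! ### Vertical and horizontal weights -/

section Main

variable {K : Type*} [Field K] [CharZero K] {n : ℕ} {A : Type*} [CommRing A] [IsDomain A]
  [Algebra K A] {act : GroupG K n →* (A ≃ₐ[K] A)} {S : AddSubmonoid (CharLattice n)}
  {χ : CharLattice n → A} {DU : Derivation K A A}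

omit [IsDomain A] in
theorem isVertical_range_iff (hDU : IsExponential DU (unipotentAct act)) {D : Derivation K A A}
    {φ : Multiplicative K →* (A ≃ₐ[K] A)} (hD : IsExponential D φ) :
    IsVertical act φ.range ↔ ∀ f, DU f = 0 → D f = 0 := by
  constructor
  · intro h f hf
    exact hD.apply_eq_zero_iff.2 fun s => h _ ⟨_, rfl⟩ f ((isUInvariant_iff hDU).2 hf)
  · rintro h _ ⟨s, rfl⟩ f hf
    exact hD.apply_eq_zero_iff.1 (h f ((isUInvariant_iff hDU).1 hf)) s.toAdd

/-- A root functional whose derivation commutes with the one of `U` gives a `B`-root subgroup. -/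
theorem exists_hasWeight_of_isRootFunctional (hG : IsGVariety act) (hχ : IsWeightBasis act S χ)
    (hDU : IsExponential DU (unipotentAct act)) {e : CharLattice n}
    {ρ : RatCharSpace n →ₗ[ℚ] ℚ} (hρ : IsRootFunctional (ratMonoid S) (toRat e) ρ)
    (hcomm : ∀ D : Derivation K A A,
      (∀ m ∈ S, D (χ m) = ((1 : K) * (ρ (toRat m) : K)) • χ (m + e)) →
      ∀ a, D (DU a) = DU (D a)) :
    ∃ (D : Derivation K A A) (φ : Multiplicative K →* (A ≃ₐ[K] A)), IsExponential D φ ∧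
      IsHomogeneous act D e ∧ IsBRootSubgroup act φ.range ∧ HasWeight act φ.range e ∧
      ∀ m ∈ S, (D (χ m) = 0 ↔ ρ (toRat m) = 0) := by
  obtain ⟨D, hnil, hhom, hDχ⟩ := hχ.exists_derivation hG hρ
  obtain ⟨φ, hφ⟩ := exists_isExponential_of_locallyNilpotent D hnil
  have hker : ∀ m ∈ S, (D (χ m) = 0 ↔ ρ (toRat m) = 0) := by
    intro m hm
    rw [hDχ m hm]
    refine ⟨fun h => by_contra fun h0 => ?_, fun h => by rw [h]; simp⟩
    have h1 := hρ.add_mem _ (toRat_mem_ratMonoid.2 hm) h0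
    rw [← toRat_add, toRat_mem_ratMonoid] at h1
    exact smul_ne_zero (by exact_mod_cast h0) ((hχ.ne_zero_iff _).2 h1) h
  have hD0 : D ≠ 0 := by
    rintro rfl
    obtain ⟨_, ⟨m, hm, rfl⟩, h0⟩ := hρ.ne_zero
    exact h0 ((hker m hm).1 rfl)
  obtain ⟨h1, h2⟩ := isBRootSubgroup_range hDU hφ hD0 hhom
    (hcomm D fun m hm => by rw [one_mul]; exact hDχ m hm)
  exact ⟨D, φ, hφ, hhom, h1, h2, hker⟩

end Main

end RootSubgroups

theorem mainTheorem3 {K : Type*} [Field K] [IsAlgClosed K] [CharZero K]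
    {A : Type*} [CommRing A] [IsDomain A] [IsIntegrallyClosed A]
    [Algebra K A] [Algebra.FiniteType K A] {n : ℕ}
    (act : GroupG K n →* (A ≃ₐ[K] A)) (hG : IsGVariety act)
    (hspherical : HasOpenOrbit act (borelSubgroup K n)) (htoric : HasOpenOrbit act (torus K n)) :
    (∀ H : Subgroup (A ≃ₐ[K] A), IsBRootSubgroup act H → ∃! e : CharLattice n, HasWeight act H e) ∧
    (∀ (H₁ H₂ : Subgroup (A ≃ₐ[K] A)) (e : CharLattice n),
      IsBRootSubgroup act H₁ → IsBRootSubgroup act H₂ →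
      HasWeight act H₁ e → HasWeight act H₂ e → H₁ = H₂) ∧
    ((∃ g : Matrix.SpecialLinearGroup (Fin 2) K, act (g, 1) ≠ 1) →
      (∃! ρ₀ : DualSpace (latMBar act), IsRhoZero act ρ₀) ∧
      ∀ ρ₀ : DualSpace (latMBar act), IsRhoZero act ρ₀ →
        toRat '' verticalWeights act = demazureRootsAt (latMBar act) (coneGBar act) ρ₀) ∧
    toRat '' horizontalWeights act =
      demazureRoots (latM act) (coneG act) ∩ toRat '' dominantWeights n := by
  obtain ⟨S, χ, hχ⟩ := exists_isWeightBasis htoric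
  obtain ⟨DU, hDU⟩ := exists_isExponential (isRegularAction_unipotentAct hG)
  have hDUhom := isHomogeneous_unipotent hDU
  have hfg := hχ.ratMonoid_fg hG
  have hsat := hχ.ratMonoid_saturated
  refine ⟨fun H hH => ?_, fun H₁ H₂ e _ _ h₁ h₂ => h₁.eq_of_eq hG hχ hDU h₂, ?_⟩
  · obtain ⟨e, he⟩ := hH.exists_hasWeight hG hχ
    exact ⟨e, he, fun e' he' => he'.unique hDU he⟩
  by_cases hDU0 : DU = 0
  · -- `SL₂` acts trivially
    obtain ⟨hΓ, hfst⟩ := weightMonoid_eq_of_trivial hχ hDU hDU0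
    refine ⟨fun ⟨g, hg⟩ => absurd
      (act_eq_one_of_unipotentAct_eq_one (hDU.eq_one_iff.2 hDU0) g) hg, ?_⟩
    have hM : latM act = AddSubgroup.closure (ratMonoid S : Set (RatCharSpace n)) := by
      rw [latM, hΓ, coe_ratMonoid]
    have hC : coneG act = PointedCone.hull ℚ (ratMonoid S : Set (RatCharSpace n)) := by
      rw [coneG, hΓ, coe_ratMonoid]
    rw [hM, hC]
    ext v
    constructor
    · rintro ⟨e, ⟨H, hH, -, hw⟩, rfl⟩
      obtain ⟨D, φ, hD, -, hD0, he, -⟩ := hw.exists_derivation hDU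
      obtain ⟨c, ρ, -, hρ, -⟩ :=
        hχ.exists_isRootFunctional hG (fun a => (hD a).imp fun _ h => h.1) he hD0
      refine ⟨⟨_, hρ.mem_primitiveRays hfg, hρ.mem_demazureRootsAt⟩, e, ?_, rfl⟩
      have h1 : ∀ v ∈ (ratMonoid S : Set (RatCharSpace n)),
          LinearMap.fst ℚ ℚ (Fin n → ℚ) v = (0 : RatCharSpace n →ₗ[ℚ] ℚ) v := by
        rintro _ ⟨m, hm, rfl⟩
        change ((m.1 : ℤ) : ℚ) = 0
        rw [hfst m hm]
        simp
      have h2 := eqOn_span h1 ((ratSpan_closure _).le (Submodule.subset_span hρ.mem_closure))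
      have h3 : ((e.1 : ℤ) : ℚ) = 0 := h2
      have h4 : e.1 = 0 := by exact_mod_cast h3
      exact h4.ge
    · rintro ⟨⟨ρ', hρ', he⟩, e, -, rfl⟩
      obtain ⟨ρ, rfl⟩ := exists_domRestrict_eq _ ρ'
      have hρ := isRootFunctional_of_mem_demazureRootsAt hfg hsat hρ' he
      obtain ⟨D, φ, hD, -, hB, hwt, hker⟩ :=
        exists_hasWeight_of_isRootFunctional hG hχ hDU hρ fun D _ a => by rw [hDU0]; simp
      refine ⟨e, ⟨φ.range, hB, fun hvert => ?_, hwt⟩, rfl⟩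
      obtain ⟨_, ⟨m, hm, rfl⟩, h0⟩ := hρ.ne_zero
      exact h0 ((hker m hm).1 ((isVertical_range_iff hDU hD).1 hvert _ (by rw [hDU0]; rfl)))
  · obtain ⟨c₀, ρ₀, hc₀, hα, hDUχ⟩ :=
      hχ.exists_isRootFunctional hG (fun a => (hDU a).imp fun _ h => h.1) hDUhom hDU0
    have hw : ∀ m ∈ S, weyl m ∈ S := fun m hm => (hχ.exists_act_weylElt hm).1
    have hΓ := weightMonoid_eq_kerMonoid hG hχ hDU hc₀ hα hDUχ
    have hM : latM act =
        AddSubgroup.closure (ratMonoid (kerMonoid S ρ₀) : Set (RatCharSpace n)) := by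
      rw [latM, hΓ, coe_ratMonoid]
    have hC : coneG act =
        PointedCone.hull ℚ (ratMonoid (kerMonoid S ρ₀) : Set (RatCharSpace n)) := by
      rw [coneG, hΓ, coe_ratMonoid]
    have hMBar : latMBar act = AddSubgroup.closure (ratMonoid S : Set (RatCharSpace n)) := by
      rw [latMBar, hM, closure_kerMonoid_sup_zmultiples hα]
    have hCBar : coneGBar act = PointedCone.hull ℚ (ratMonoid S : Set (RatCharSpace n)) := by
      rw [coneGBar, hC, hull_kerMonoid_union_weyl hα hw]
    -- `K[X]^U` is spanned by the `χ m` with `ρ₀ m = 0`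
    have hkerU : ∀ m ∈ S, DU (χ m) = 0 → m ∈ kerMonoid S ρ₀ := by
      intro m hm h
      refine ⟨hm, by_contra fun h0 => ?_⟩
      have h1 := hα.add_mem _ (toRat_mem_ratMonoid.2 hm) h0
      rw [← toRat_add, toRat_mem_ratMonoid] at h1
      rw [hDUχ m hm] at h
      exact smul_ne_zero (mul_ne_zero hc₀ (by exact_mod_cast h0)) ((hχ.ne_zero_iff _).2 h1) h
    have hUker : ∀ m ∈ kerMonoid S ρ₀, DU (χ m) = 0 := by
      intro m hm
      rw [hDUχ m hm.1, hm.2]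
      simp
    constructor
    · intro _
      simp only [IsRhoZero]
      rw [hC, hMBar, hCBar]
      refine ⟨⟨ρ₀.domRestrict _, ⟨hα.mem_primitiveRays hfg, faceOf_eq⟩,
        fun ρ hρ => eq_of_faceOf_eq hα hρ.1 hρ.2⟩, ?_⟩
      rintro ρ ⟨hρ1, hρ2⟩
      obtain rfl := eq_of_faceOf_eq hα hρ1 hρ2
      ext v
      constructor
      · rintro ⟨e, ⟨H, hH, hvert, hwt⟩, rfl⟩
        obtain ⟨D, φ, hD, hφ, hD0, he, -⟩ := hwt.exists_derivation hDU
        obtain ⟨c, ρ, hc, hρ, hDχ⟩ :=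
          hχ.exists_isRootFunctional hG (fun a => (hD a).imp fun _ h => h.1) he hD0
        rw [← hφ.range_eq, isVertical_range_iff hDU hD] at hvert
        have hzero : ∀ m ∈ kerMonoid S ρ₀, ρ (toRat m) = 0 := by
          intro m hm
          by_contra h0
          have h1 := hρ.add_mem _ (toRat_mem_ratMonoid.2 hm.1) h0
          rw [← toRat_add, toRat_mem_ratMonoid] at h1
          have h2 := hvert _ (hUker m hm)
          rw [hDχ m hm.1] at h2
          exact smul_ne_zero (mul_ne_zero hc (by exact_mod_cast h0))
            ((hχ.ne_zero_iff _).2 h1) h2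
        have h1 := eq_of_vanish hα hρ hzero
        have h2 : ρ.domRestrict _ = ρ₀.domRestrict
            (ratSpan (AddSubgroup.closure (ratMonoid S : Set (RatCharSpace n)))) :=
          domRestrict_eq_iff.2 h1
        rw [← h2]
        exact hρ.mem_demazureRootsAt
      · intro hv
        obtain ⟨e, -, rfl⟩ := exists_toRat_of_mem_closure hv.1
        have hρ := isRootFunctional_of_mem_demazureRootsAt hfg hsat hρ1 hv
        obtain ⟨D, φ, hD, hhom, hB, hwt, hker⟩ :=
          exists_hasWeight_of_isRootFunctional hG hχ hDU hρ fun D hDχ =>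
            (commute_iff_of_isRootFunctional hG hχ one_ne_zero hc₀ hρ hα hDχ hDUχ).2
              fun m _ => by rw [hα.root, hρ.root]
        refine ⟨e, ⟨φ.range, hB, ?_, hwt⟩, rfl⟩
        rw [isVertical_range_iff hDU hD]
        intro f hf
        obtain ⟨F, c, hF, rfl⟩ := hχ.exists_sum hG f
        rw [map_sum]
        refine Finset.sum_eq_zero fun m hm => ?_
        have h1 := smul_apply_eq_zero_of_sum hχ hDUhom hf hm
        rw [D.map_smul]
        rcases smul_eq_zero.1 h1 with h1 | h1
        · rw [h1, zero_smul]
        · rw [(hker m (hF m hm)).2 (hkerU m (hF m hm) h1).2, smul_zero]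
    · rw [hM, hC]
      ext v
      constructor
      · rintro ⟨e, ⟨H, hH, hhor, hwt⟩, rfl⟩
        obtain ⟨D, φ, hD, hφ, hD0, he, hcomm⟩ := hwt.exists_derivation hDU
        obtain ⟨c, ρ, hc, hρ, hDχ⟩ :=
          hχ.exists_isRootFunctional hG (fun a => (hD a).imp fun _ h => h.1) he hD0
        rw [commute_iff_of_isRootFunctional hG hχ hc hc₀ hρ hα hDχ hDUχ] at hcomm
        rw [← hφ.range_eq, isVertical_range_iff hDU hD] at hhor
        obtain ⟨l, hl, hρl⟩ : ∃ l ∈ kerMonoid S ρ₀, ρ (toRat l) ≠ 0 := by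
          by_contra! h
          refine hhor fun f hf => ?_
          obtain ⟨F, x, hF, rfl⟩ := hχ.exists_sum hG f
          rw [map_sum]
          refine Finset.sum_eq_zero fun m hm => ?_
          have h1 := smul_apply_eq_zero_of_sum hχ hDUhom hf hm
          rw [D.map_smul]
          rcases smul_eq_zero.1 h1 with h1 | h1
          · rw [h1, zero_smul]
          · rw [hDχ m (hF m hm), h m (hkerU m (hF m hm) h1)]
            simp
        -- the commutation relation, first at `l` and then at a weight where `ρ₀` is nonzero
        have he0 : ρ₀ (toRat e) = 0 := by
          have h1 := hcomm l hl.1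
          rw [hl.2, zero_mul] at h1
          exact (mul_eq_zero.1 h1.symm).resolve_left hρl
        have hρα : ρ (toRat (posRoot n)) = 0 := by
          obtain ⟨_, ⟨m, hm, rfl⟩, h0⟩ := hα.ne_zero
          have h1 := hcomm m hm
          rw [he0, mul_zero] at h1
          exact (mul_eq_zero.1 h1).resolve_left h0
        obtain ⟨h1, h2⟩ := mem_demazureRoots_of_isRootFunctional hα hw hfg hρ he0 hρα
        exact ⟨h1, e, h2, rfl⟩
      · rintro ⟨hv, e, he', rfl⟩
        obtain ⟨ρ, hρ, he0, hρα, l, hl, hρl⟩ :=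
          exists_isRootFunctional_of_mem_demazureRoots hα hw hfg hsat hv he'
        obtain ⟨D, φ, hD, hhom, hB, hwt, hker⟩ :=
          exists_hasWeight_of_isRootFunctional hG hχ hDU hρ fun D hDχ =>
            (commute_iff_of_isRootFunctional hG hχ one_ne_zero hc₀ hρ hα hDχ hDUχ).2
              fun m _ => by rw [hρα, he0, mul_zero, mul_zero]
        refine ⟨e, ⟨φ.range, hB, fun hvert => ?_, hwt⟩, rfl⟩
        exact hρl ((hker l hl.1).1 ((isVertical_range_iff hDU hD).1 hvert _ (hUker l hl)))
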